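/- Let $a>0$ and $\Omega=(-a,a)^2\subset\mathbb R^2$. Let $B:\mathbb R^2\to\mathbb R$ be a locally integrable magnetic field with $\operatorname{supp}B\subset\Omega$ that is not identically zero (i.e. not zero almost everywhere). Then there is a constant $\alpha_0=\alpha_0(\Omega,B)>0$ with the following property. Let $A=(A_1,A_2):\mathbb R^2\to\mathbb R^2$ be any vector potential of $B$, i.e. $\partial_xA_2-\partial_yA_1=B$ in the sense of distributions, for which $A\psi\in L^2(\mathbb R^2)$ for all $\psi\in H^1(\mathbb R^2)$ (every bounded $A$ is such). Let $\gamma:\mathbb R\to\mathbb R$ be continuous and piecewise $C^1$, with $\gamma(x)=x$ for $|x|\ge a$ and $|\gamma(x)|\le a$ for $|x|<a$, let $\Gamma=\{(x,\gamma(x)):x\in\mathbb R\}$ and let $\mu$ be the arc length measure on $\Gamma$. For $\alpha>0$ let $H=(i\nabla+A)^2-\alpha\delta_\Gamma$ be the operator in $L^2(\mathbb R^2)$ associated with the quadratic form $$q[\psi]=\int_{\mathbb R^2}|i\nabla\psi+A\psi|^2\,dx\,dy-\alpha\int_\Gamma|\psi|^2\,d\mu,\qquad \psi\in H^1(\mathbb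 R^2),$$ where $\psi$ on $\Gamma$ is understood as the trace. If $\alpha\in(0,\alpha_0]$ and $$\|\gamma'\|_\infty^2\le\frac{2\alpha_0^2}{\alpha^2}-1,$$ then the spectrum of $H$ below $-\frac14\alpha^2$ is empty, i.e. no real $\lambda<-\frac14\alpha^2$ belongs to $\sigma(H)$. -/

import Mathlib

open MeasureTheory Filter Topology Set
open scoped ENNReal ContDiff

noncomputable section

namespace LeakyWire

/-- The Hilbert space `L²(ℝ²; ℂ)`. The plane is `ℝ × ℝ` with its Lebesgue measure; the norm of
`ℝ × ℝ` plays no role below. -/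
abbrev L2 : Type := Lp ℂ 2 (volume : Measure (ℝ × ℝ))

/-- The square `(-a, a)²`. -/
def square (a : ℝ) : Set (ℝ × ℝ) := Ioo (-a) a ×ˢ Ioo (-a) a

/-- The coordinate direction of `x`. -/
def ex : ℝ × ℝ := (1, 0)

/-- The coordinate direction of `y`. -/
def ey : ℝ × ℝ := (0, 1)

/-! ### The Sobolev space `H¹(ℝ²)` -/

/-- `g` is the weak (distributional) derivative of `ψ` in the direction `v`. -/
def IsWeakDeriv (v : ℝ × ℝ) (ψ g : L2) : Prop :=
  ∀ φ : ℝ × ℝ → ℝ, ContDiff ℝ ∞ φ → HasCompactSupport φ →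
    ∫ p, (fderiv ℝ φ p v) • ψ p = - ∫ p, φ p • g p

/-- The Sobolev space `H¹(ℝ²)`, as a set of elements of `L²(ℝ²)`. -/
def H1 : Set L2 := {ψ | (∃ g, IsWeakDeriv ex ψ g) ∧ ∃ g, IsWeakDeriv ey ψ g}

open Classical in
/-- The weak derivative in `L²` in the direction `v` (it is unique where it exists). -/
def weakDeriv (v : ℝ × ℝ) (ψ : L2) : L2 :=
  if h : ∃ g, IsWeakDeriv v ψ g then h.choose else 0

/-! ### The magnetic field and its vector potentials -/

/-- `A = (A₁, A₂)` is a vector potential for the field `B`: `∂ₓA₂ - ∂_yA₁ = B` in the sense of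
distributions, and `Aψ ∈ L²` for all `ψ ∈ H¹(ℝ²)`, that is, the magnetic form
`∫ |i∇ψ + Aψ|²` is defined on all of `H¹(ℝ²)`. The second requirement holds for every bounded
measurable `A`; it implies that `A` is measurable and locally square integrable. -/
structure IsVectorPotential (B : ℝ × ℝ → ℝ) (A : ℝ × ℝ → ℝ × ℝ) : Prop where
  memLp_fst : ∀ ψ ∈ H1, MemLp (fun p => ((A p).1 : ℂ) * ψ p) 2 volume
  memLp_snd : ∀ ψ ∈ H1, MemLp (fun p => ((A p).2 : ℂ) * ψ p) 2 volume
  rot_eq : ∀ φ : ℝ × ℝ → ℝ, ContDiff ℝ ∞ φ → HasCompactSupport φ →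
    ∫ p, ((A p).1 * fderiv ℝ φ p ey - (A p).2 * fderiv ℝ φ p ex) = ∫ p, B p * φ p

/-! ### The curve `Γ = {(x, γ(x))}` -/

/-- `γ` is continuous and piecewise `C¹`: it is `C¹` off a finite set, at whose points the
derivative has finite one-sided limits. -/
def IsPiecewiseC1 (γ : ℝ → ℝ) : Prop :=
  Continuous γ ∧ ∃ S : Finset ℝ, ContDiffOn ℝ 1 γ (S : Set ℝ)ᶜ ∧
    ∀ s ∈ S, (∃ l, Tendsto (deriv γ) (𝓝[<] s) (𝓝 l)) ∧ ∃ r, Tendsto (deriv γ) (𝓝[>] s) (𝓝 r)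

/-- The graph of `γ` is a deformation, inside the square `(-a, a)²`, of the line `y = x`. -/
structure IsDeformedLine (a : ℝ) (γ : ℝ → ℝ) : Prop where
  piecewiseC1 : IsPiecewiseC1 γ
  eq_outside : ∀ x, a ≤ |x| → γ x = x
  abs_le_inside : ∀ x, |x| < a → |γ x| ≤ a

/-- The arc length measure of the graph of `γ`, as a measure on the plane: the image of
`√(1 + γ'(x)²) dx` under `x ↦ (x, γ(x))`. -/
def arcLength (γ : ℝ → ℝ) : Measure (ℝ × ℝ) :=
  (volume.withDensity fun x => ENNReal.ofReal √(1 + deriv γ x ^ 2)).map fun x => (x, γ x)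

/-- `τ ∈ L²(Γ)` is the trace of `ψ ∈ H¹(ℝ²)` on the graph `Γ` of `γ`: some test functions
converge to `ψ` in `H¹(ℝ²)` while their restrictions to `Γ` converge to `τ` in `L²(Γ)`. -/
def IsTrace (γ : ℝ → ℝ) (ψ : L2) (τ : Lp ℂ 2 (arcLength γ)) : Prop :=
  ∃ φ : ℕ → ℝ × ℝ → ℂ, (∀ n, ContDiff ℝ ∞ (φ n) ∧ HasCompactSupport (φ n)) ∧
    Tendsto (fun n => eLpNorm (fun p => φ n p - ψ p) 2 volume) atTop (𝓝 0) ∧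
    Tendsto (fun n => eLpNorm (fun p => fderiv ℝ (φ n) p ex - weakDeriv ex ψ p) 2 volume)
      atTop (𝓝 0) ∧
    Tendsto (fun n => eLpNorm (fun p => fderiv ℝ (φ n) p ey - weakDeriv ey ψ p) 2 volume)
      atTop (𝓝 0) ∧
    Tendsto (fun n => eLpNorm (fun p => φ n p - τ p) 2 (arcLength γ)) atTop (𝓝 0)

open Classical in
/-- The trace of `ψ ∈ H¹(ℝ²)` on the graph of `γ`; it exists and is unique when `γ` is
Lipschitz. -/
def trace (γ : ℝ → ℝ) (ψ : L2) : Lp ℂ 2 (arcLength γ) :=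
  if h : ∃ τ, IsTrace γ ψ τ then h.choose else 0

/-! ### The form and the operator -/

/-- The first component of `i∇ψ + Aψ`. -/
def magX (A : ℝ × ℝ → ℝ × ℝ) (ψ : L2) (p : ℝ × ℝ) : ℂ :=
  Complex.I * weakDeriv ex ψ p + ((A p).1 : ℂ) * ψ p

/-- The second component of `i∇ψ + Aψ`. -/
def magY (A : ℝ × ℝ → ℝ × ℝ) (ψ : L2) (p : ℝ × ℝ) : ℂ :=
  Complex.I * weakDeriv ey ψ p + ((A p).2 : ℂ) * ψ p

/-- The sesquilinear form (antilinear in the first argument) whose diagonal is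
`q[ψ] = ∫_{ℝ²} |i∇ψ + Aψ|² dx dy - α ∫_Γ |ψ|² dμ`, on `H¹(ℝ²)`. -/
def form (A : ℝ × ℝ → ℝ × ℝ) (γ : ℝ → ℝ) (α : ℝ) (φ ψ : L2) : ℂ :=
  (∫ p, (star (magX A φ p) * magX A ψ p + star (magY A φ p) * magY A ψ p))
    - α * ∫ p, star (trace γ φ p) * trace γ ψ p ∂(arcLength γ)

/-- The graph of the operator `H = (i∇ + A)² - α δ_Γ` associated with the form:
`ψ ∈ Dom H` and `Hψ = f` if and only if `ψ ∈ H¹(ℝ²)` and `q(φ, ψ) = ⟨φ, f⟩` for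
all `φ ∈ H¹(ℝ²)`. -/
def hamiltonian (A : ℝ × ℝ → ℝ × ℝ) (γ : ℝ → ℝ) (α : ℝ) : Set (L2 × L2) :=
  {u | u.1 ∈ H1 ∧ ∀ φ ∈ H1, form A γ α φ u.1 = inner ℂ φ u.2}

/-- The resolvent set of an (unbounded) operator given by its graph `T`: those `z` for which
`T - z` is a bijection from the domain onto `L²` with a bounded inverse `R`, i.e.
`(T - z)ψ = g` if and only if `ψ = R g`. -/
def resolventSet (T : Set (L2 × L2)) : Set ℂ :=
  {z | ∃ R : L2 →L[ℂ] L2, ∀ ψ g : L2, (ψ, g + z • ψ) ∈ T ↔ ψ = R g}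

/-- The spectrum of an (unbounded) operator given by its graph. -/
def spectrum (T : Set (L2 × L2)) : Set ℂ := (resolventSet T)ᶜ

end LeakyWire

end

noncomputable section

namespace LeakyWire

/-! ### Test functions and the Hilbert space `H¹(ℝ²)` -/

/-! The curve is treated separately inside and outside the square. Outside, it is the diagonal. On
each antidiagonal `x + y = c` a compactly supported function is bounded by half the integral of its
absolute derivative, and completing squares shows that the attraction costs at most `α² / 4` times
the mass of the strip `|x + y| ≥ 2a` (`setIntegral_diagonal_le_magSq`). This strip does not meet the
square, so the energy inside the square is still available there. Inside, the restriction to the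
curve is bounded by mass plus magnetic energy (`setIntegral_graph_le_magSq`), and the field turns
mass into energy by the Hardy inequality `∫_Ω |φ|² ≤ K ∫_Ω |(i∇ + A)φ|²` (`exists_hardy`). If `α`
times the largest arc length density is small enough, the energy in the square pays for the whole
attraction there. Together this gives `q ≥ -α² / 4` on test functions (`arc_le_magSq`).

For the Hardy inequality take `χ` supported in the square with `∫ Bχ ≠ 0`. The modulus of `φ`,
regularised to a smooth `w`, has gradient at most `|(i∇ + A)φ|` (diamagnetic inequality), so by
Poincaré `w` is close to a constant `c`. The integral `∫ Bχ|φ|²` is then computed twice. By the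
commutator of the two covariant derivatives it is controlled by the magnetic energy, up to a small
multiple of the mass (`exists_magnetic_bound`). On the other hand it is close to `c² ∫ Bχ`
(`exists_oscillation_bound`). Hence `c` is controlled by the energy, and so is `φ`. As `B` is only
locally integrable, the second comparison writes `B` as the rotation of one fixed potential, which
multiplies `H¹` boundedly into `L²` by the closed graph theorem. The first has constants depending
on `χ` alone. So `K` does not depend on `A`.

The passage to the spectrum is Lax–Milgram on `H¹`. Test functions are dense there
(`denseRange_testToSobolev`), the `H¹` norm is controlled by the magnetic one (`exists_norm_sq_le`),
and below `-α² / 4` the shifted form is coercive (`exists_coercive`), which yields the resolvent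
(`mem_resolventSet_of_isUnit`). -/

theorem hasCompactSupport_fderiv_apply {F : Type*} [NormedAddCommGroup F] [NormedSpace ℝ F]
    {φ : ℝ × ℝ → F} (h : HasCompactSupport φ) (v : ℝ × ℝ) :
    HasCompactSupport fun p => fderiv ℝ φ p v :=
  (h.fderiv ℝ).comp_left (g := fun L : ℝ × ℝ →L[ℝ] F => L v) (by simp)

theorem contDiff_fderiv_apply {F : Type*} [NormedAddCommGroup F] [NormedSpace ℝ F]
    {φ : ℝ × ℝ → F} (h : ContDiff ℝ ∞ φ) (v : ℝ × ℝ) :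
    ContDiff ℝ ∞ fun p => fderiv ℝ φ p v :=
  (h.fderiv_right (m := ∞) (by simp)).clm_apply contDiff_const

/-- The complex test functions `C_c^∞(ℝ²)`. -/
def testSpace : Submodule ℂ (ℝ × ℝ → ℂ) where
  carrier := {φ | ContDiff ℝ ∞ φ ∧ HasCompactSupport φ}
  zero_mem' := ⟨contDiff_const, HasCompactSupport.zero⟩
  add_mem' h k := ⟨h.1.add k.1, h.2.add k.2⟩
  smul_mem' c _ h := ⟨contDiff_const.smul h.1, h.2.smul_left (f := fun _ => c)⟩

theorem testSpace_contDiff (φ : testSpace) : ContDiff ℝ ∞ (φ : ℝ × ℝ → ℂ) := φ.2.1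

theorem testSpace_hasCompactSupport (φ : testSpace) : HasCompactSupport (φ : ℝ × ℝ → ℂ) := φ.2.2

theorem testSpace_continuous (φ : testSpace) : Continuous (φ : ℝ × ℝ → ℂ) := φ.2.1.continuous

theorem testSpace_differentiable (φ : testSpace) : Differentiable ℝ (φ : ℝ × ℝ → ℂ) :=
  φ.2.1.differentiable (by simp)

theorem testSpace_fderiv_mem (φ : testSpace) (v : ℝ × ℝ) :
    (fun p => fderiv ℝ (φ : ℝ × ℝ → ℂ) p v) ∈ testSpace :=
  show _ ∧ _ from ⟨contDiff_fderiv_apply (testSpace_contDiff φ) v,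
    hasCompactSupport_fderiv_apply (testSpace_hasCompactSupport φ) v⟩

/-- The partial derivative of a test function in the direction `v`. -/
def testDeriv (v : ℝ × ℝ) : testSpace →ₗ[ℂ] testSpace where
  toFun φ := ⟨fun p => fderiv ℝ φ p v, testSpace_fderiv_mem φ v⟩
  map_add' φ χ := Subtype.ext <| funext fun p => congrArg (fun L : ℝ × ℝ →L[ℝ] ℂ => L v)
    (fderiv_add (testSpace_differentiable φ p) (testSpace_differentiable χ p))
  map_smul' c φ := Subtype.ext <| funext fun p => congrArg (fun L : ℝ × ℝ →L[ℝ] ℂ => L v)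
    (fderiv_const_smul (testSpace_differentiable φ p) c)

@[simp] theorem testDeriv_apply (v : ℝ × ℝ) (φ : testSpace) (p : ℝ × ℝ) :
    (testDeriv v φ : ℝ × ℝ → ℂ) p = fderiv ℝ φ p v := rfl

theorem testSpace_memLp (φ : testSpace) (μ : Measure (ℝ × ℝ)) [IsFiniteMeasureOnCompacts μ] :
    MemLp (φ : ℝ × ℝ → ℂ) 2 μ :=
  (testSpace_continuous φ).memLp_of_hasCompactSupport φ.2.2

/-- The class of a test function in `L²(μ)`. -/
def testToLp (μ : Measure (ℝ × ℝ)) [IsFiniteMeasureOnCompacts μ] :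
    testSpace →ₗ[ℂ] Lp ℂ 2 μ where
  toFun φ := (testSpace_memLp φ μ).toLp φ
  map_add' φ χ := MemLp.toLp_add (testSpace_memLp φ μ) (testSpace_memLp χ μ)
  map_smul' c φ := MemLp.toLp_const_smul c (testSpace_memLp φ μ)

theorem coeFn_testToLp (μ : Measure (ℝ × ℝ)) [IsFiniteMeasureOnCompacts μ] (φ : testSpace) :
    (testToLp μ φ : ℝ × ℝ → ℂ) =ᵐ[μ] φ :=
  MemLp.coeFn_toLp (testSpace_memLp φ μ)

/-- A real test function, seen as a complex one. -/
def testOfReal (φ : ℝ × ℝ → ℝ) (h : ContDiff ℝ ∞ φ) (hc : HasCompactSupport φ) : testSpace :=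
  ⟨fun p => (φ p : ℂ), Complex.ofRealCLM.contDiff.comp h, hc.comp_left (g := fun x : ℝ => (x : ℂ)) (by simp)⟩

theorem testOfReal_deriv (φ : ℝ × ℝ → ℝ) (h : ContDiff ℝ ∞ φ) (hc : HasCompactSupport φ)
    (v p : ℝ × ℝ) : fderiv ℝ (testOfReal φ h hc) p v = (fderiv ℝ φ p v : ℂ) := by
  have := (Complex.ofRealCLM.hasFDerivAt (x := φ p)).comp p
    ((h.differentiable (by simp)) p).hasFDerivAt
  have h2 : fderiv ℝ (testOfReal φ h hc : ℝ × ℝ → ℂ) p = _ := this.fderiv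
  rw [h2]; simp

theorem integral_real_smul_eq_inner (η : ℝ × ℝ → ℝ) (h : ContDiff ℝ ∞ η)
    (hc : HasCompactSupport η) (ψ : L2) :
    ∫ p, η p • ψ p = inner ℂ (testToLp volume (testOfReal η h hc)) ψ := by
  rw [L2.inner_def]
  refine integral_congr_ae ?_
  filter_upwards [coeFn_testToLp volume (testOfReal η h hc)] with p hp
  rw [hp]
  simp [testOfReal, mul_comm]

/-- As a family of equations between inner products, the condition is visibly linear and closed in
the pair `(ψ, g)`. This makes `sobolev` a closed subspace. -/
theorem isWeakDeriv_iff (v : ℝ × ℝ) (ψ g : L2) : IsWeakDeriv v ψ g ↔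
    ∀ (φ : ℝ × ℝ → ℝ) (h : ContDiff ℝ ∞ φ) (hc : HasCompactSupport φ),
      inner ℂ (testToLp volume (testOfReal _ (contDiff_fderiv_apply h v)
        (hasCompactSupport_fderiv_apply hc v))) ψ
      + inner ℂ (testToLp volume (testOfReal φ h hc)) g = 0 := by
  refine forall_congr' fun φ => forall_congr' fun h => forall_congr' fun hc => ?_
  rw [← integral_real_smul_eq_inner, ← integral_real_smul_eq_inner, add_eq_zero_iff_eq_neg]

theorem IsWeakDeriv.unique {v : ℝ × ℝ} {ψ g g' : L2} (h : IsWeakDeriv v ψ g)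
    (h' : IsWeakDeriv v ψ g') : g = g' := by
  refine Lp.ext ?_
  refine ae_eq_of_integral_contDiff_smul_eq ((Lp.memLp g).locallyIntegrable (by norm_num))
    ((Lp.memLp g').locallyIntegrable (by norm_num)) fun φ hφ hc => ?_
  have := (h φ hφ hc).symm.trans (h' φ hφ hc)
  simpa using this

theorem IsWeakDeriv.weakDeriv_eq {v : ℝ × ℝ} {ψ g : L2} (h : IsWeakDeriv v ψ g) :
    weakDeriv v ψ = g := by
  have hex : ∃ g, IsWeakDeriv v ψ g := ⟨g, h⟩
  rw [weakDeriv, dif_pos hex]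
  exact hex.choose_spec.unique h

theorem isWeakDeriv_test (v : ℝ × ℝ) (φ : testSpace) :
    IsWeakDeriv v (testToLp volume φ) (testToLp volume (testDeriv v φ)) := by
  intro η hη hc
  have e1 : ∫ p, (fderiv ℝ η p v) • testToLp volume φ p = ∫ p, (fderiv ℝ η p v) • (φ : ℝ × ℝ → ℂ) p :=
    integral_congr_ae ((coeFn_testToLp volume φ).mono fun p hp => by simp only [hp])
  have e2 : ∫ p, η p • testToLp volume (testDeriv v φ) p = ∫ p, η p • fderiv ℝ φ p v :=
    integral_congr_ae ((coeFn_testToLp volume (testDeriv v φ)).mono fun p hp => by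
      simp only [hp, testDeriv_apply])
  rw [e1, e2]
  have hint : ∀ (f : ℝ × ℝ → ℝ) (g : ℝ × ℝ → ℂ), Continuous f → HasCompactSupport f →
      Continuous g → Integrable (fun p => f p • g p) := fun f g hf hfc hg =>
    (hf.smul hg).integrable_of_hasCompactSupport hfc.smul_right
  have hdη := (contDiff_fderiv_apply hη v).continuous
  have hdφ := (contDiff_fderiv_apply φ.2.1 v).continuous
  rw [integral_smul_fderiv_eq_neg_fderiv_smul_of_integrable (hint _ _ hdη
    (hasCompactSupport_fderiv_apply hc v) (testSpace_continuous φ)) (hint _ _ hη.continuous hc hdφ)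
    (hint _ _ hη.continuous hc (testSpace_continuous φ)) (fun p _ => hη.differentiable (by simp) p)
    (fun p _ => testSpace_differentiable φ p), neg_neg]

/-- The Hilbert space of triples `(ψ, ∂ₓψ, ∂_yψ)` with `ψ ∈ H¹(ℝ²)`. -/
def sobolev : Submodule ℂ (PiLp 2 fun _ : Fin 3 => L2) where
  carrier := {u | IsWeakDeriv ex (u 0) (u 1) ∧ IsWeakDeriv ey (u 0) (u 2)}
  zero_mem' := by
    simp only [mem_ofPred_eq, isWeakDeriv_iff]
    exact ⟨fun φ h hc => by simp, fun φ h hc => by simp⟩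
  add_mem' {u w} hu hw := by
    simp only [mem_ofPred_eq, isWeakDeriv_iff] at hu hw ⊢
    refine ⟨fun φ h hc => ?_, fun φ h hc => ?_⟩
    · have h1 := hu.1 φ h hc
      have h2 := hw.1 φ h hc
      simp only [PiLp.add_apply, inner_add_right]
      linear_combination h1 + h2
    · have h1 := hu.2 φ h hc
      have h2 := hw.2 φ h hc
      simp only [PiLp.add_apply, inner_add_right]
      linear_combination h1 + h2
  smul_mem' c u hu := by
    simp only [mem_ofPred_eq, isWeakDeriv_iff] at hu ⊢
    refine ⟨fun φ h hc => ?_, fun φ h hc => ?_⟩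
    · have h1 := hu.1 φ h hc
      simp only [PiLp.smul_apply, inner_smul_right]
      linear_combination c * h1
    · have h1 := hu.2 φ h hc
      simp only [PiLp.smul_apply, inner_smul_right]
      linear_combination c * h1

theorem isClosed_sobolev : IsClosed (sobolev : Set (PiLp 2 fun _ : Fin 3 => L2)) := by
  have : (sobolev : Set (PiLp 2 fun _ : Fin 3 => L2)) =
      {u | IsWeakDeriv ex (u 0) (u 1)} ∩ {u | IsWeakDeriv ey (u 0) (u 2)} := rfl
  rw [this]
  have hc : ∀ i : Fin 3, Continuous fun u : PiLp 2 (fun _ : Fin 3 => L2) => u i := fun i =>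
    (PiLp.proj 2 (𝕜 := ℂ) (fun _ : Fin 3 => L2) i).continuous
  refine IsClosed.inter ?_ ?_ <;>
  · simp only [isWeakDeriv_iff, ofPred_forall]
    refine isClosed_iInter fun φ => isClosed_iInter fun h => isClosed_iInter fun hc' => ?_
    exact isClosed_eq (((innerSL ℂ _).continuous.comp (hc _)).add
      ((innerSL ℂ _).continuous.comp (hc _))) continuous_const

instance : CompleteSpace sobolev := isClosed_sobolev.completeSpace_coe

/-- The coordinates `ψ`, `∂ₓψ`, `∂_yψ` of an element of `H¹(ℝ²)`. -/
def coord (i : Fin 3) : sobolev →L[ℂ] L2 :=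
  (PiLp.proj 2 (𝕜 := ℂ) (fun _ : Fin 3 => L2) i).comp sobolev.subtypeL

theorem sobolev_norm_sq (u : sobolev) :
    ‖u‖ ^ 2 = ‖coord 0 u‖ ^ 2 + ‖coord 1 u‖ ^ 2 + ‖coord 2 u‖ ^ 2 := by
  change ‖(u : PiLp 2 fun _ : Fin 3 => L2)‖ ^ 2 = _
  rw [PiLp.norm_sq_eq_of_L2, Fin.sum_univ_three]
  rfl

theorem coord_mem_H1 (u : sobolev) : coord 0 u ∈ H1 := ⟨⟨_, u.2.1⟩, ⟨_, u.2.2⟩⟩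

theorem weakDeriv_ex_coord (u : sobolev) : weakDeriv ex (coord 0 u) = coord 1 u :=
  IsWeakDeriv.weakDeriv_eq u.2.1

theorem weakDeriv_ey_coord (u : sobolev) : weakDeriv ey (coord 0 u) = coord 2 u :=
  IsWeakDeriv.weakDeriv_eq u.2.2

theorem exists_coord_eq {ψ : L2} (h : ψ ∈ H1) : ∃ u : sobolev, coord 0 u = ψ := by
  obtain ⟨⟨g, hg⟩, ⟨k, hk⟩⟩ := h
  exact ⟨⟨WithLp.toLp 2 ![ψ, g, k], hg, hk⟩, rfl⟩

/-- Weak derivatives are unique, so a triple is determined by its function. This identifies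
`sobolev` with the set `H1`. -/
theorem coord_zero_injective : Function.Injective (coord 0) := by
  intro u w h
  have h1 : coord 1 u = coord 1 w := by rw [← weakDeriv_ex_coord, ← weakDeriv_ex_coord, h]
  have h2 : coord 2 u = coord 2 w := by rw [← weakDeriv_ey_coord, ← weakDeriv_ey_coord, h]
  ext i : 2
  fin_cases i
  exacts [h, h1, h2]

/-- The embedding of the test functions into `H¹(ℝ²)`. -/
def testToSobolev : testSpace →ₗ[ℂ] sobolev where
  toFun φ := ⟨WithLp.toLp 2 ![testToLp volume φ, testToLp volume (testDeriv ex φ),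
    testToLp volume (testDeriv ey φ)], isWeakDeriv_test ex φ, isWeakDeriv_test ey φ⟩
  map_add' φ χ := coord_zero_injective (map_add (testToLp volume) φ χ)
  map_smul' c φ := coord_zero_injective (map_smul (testToLp volume) c φ)

theorem coord_zero_test (φ : testSpace) : coord 0 (testToSobolev φ) = testToLp volume φ := rfl

theorem coord_one_test (φ : testSpace) :
    coord 1 (testToSobolev φ) = testToLp volume (testDeriv ex φ) := rfl

theorem coord_two_test (φ : testSpace) :
    coord 2 (testToSobolev φ) = testToLp volume (testDeriv ey φ) := rfl

end LeakyWire

end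

noncomputable section

namespace LeakyWire

/-! ### Mollification in `L²` and density of the test functions in `H¹(ℝ²)` -/

theorem sq_lintegral_le {α : Type*} [MeasurableSpace α] (ν : Measure α) [IsProbabilityMeasure ν]
    {h : α → ℝ≥0∞} (hh : AEMeasurable h ν) : (∫⁻ t, h t ∂ν) ^ 2 ≤ ∫⁻ t, h t ^ 2 ∂ν := by
  have := ENNReal.lintegral_mul_le_Lp_mul_Lq ν Real.HolderConjugate.two_two hh
    (aemeasurable_const (b := (1 : ℝ≥0∞)))
  simp only [Pi.mul_apply, mul_one, ENNReal.one_rpow, lintegral_const, measure_univ] at this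
  calc (∫⁻ t, h t ∂ν) ^ 2 ≤ ((∫⁻ t, h t ^ (2 : ℝ) ∂ν) ^ (1 / 2 : ℝ)) ^ 2 := by gcongr
    _ = ∫⁻ t, h t ^ 2 ∂ν := by
      rw [← ENNReal.rpow_natCast, ← ENNReal.rpow_mul]
      norm_num

theorem eLpNorm_two_sq {α E : Type*} [MeasurableSpace α] [NormedAddCommGroup E] (μ : Measure α)
    (f : α → E) : eLpNorm f 2 μ ^ 2 = ∫⁻ x, ‖f x‖ₑ ^ 2 ∂μ := by
  rw [eLpNorm_eq_lintegral_rpow_enorm_toReal (by norm_num) (by norm_num), ← ENNReal.rpow_natCast,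
    ← ENNReal.rpow_mul]
  norm_num

/-- The mollification of `f` by `ρ`. -/
def mollify (ρ : ℝ × ℝ → ℝ) (f : ℝ × ℝ → ℂ) (x : ℝ × ℝ) : ℂ := ∫ t, ρ t • f (x - t)

theorem integrable_mollify {ρ : ℝ × ℝ → ℝ} (hρ : Continuous ρ) (hc : HasCompactSupport ρ)
    {f : ℝ × ℝ → ℂ} (hf : LocallyIntegrable f) (x : ℝ × ℝ) :
    Integrable fun t => ρ t • f (x - t) :=
  hc.convolutionExists_left (ContinuousLinearMap.lsmul ℝ ℝ) hρ hf x

/-- Since `ρ dt` is a probability measure, the left side is the squared norm of an average of `f (x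
- t) - f x`, and Jensen's inequality applies. -/
theorem enorm_mollify_sub_sq_le {ρ : ℝ × ℝ → ℝ} (hρ : Continuous ρ) (hc : HasCompactSupport ρ)
    (h0 : ∀ t, 0 ≤ ρ t) (h1 : ∫ t, ρ t = 1) {f : ℝ × ℝ → ℂ} (hfm : Measurable f)
    (hf : LocallyIntegrable f) (x : ℝ × ℝ) :
    ‖mollify ρ f x - f x‖ₑ ^ 2 ≤ ∫⁻ t, ENNReal.ofReal (ρ t) * ‖f (x - t) - f x‖ₑ ^ 2 := by
  have hρi : Integrable ρ := hρ.integrable_of_hasCompactSupport hc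
  have hρm : Measurable fun t => ENNReal.ofReal (ρ t) := hρ.measurable.ennreal_ofReal
  have hprob : IsProbabilityMeasure (volume.withDensity fun t => ENNReal.ofReal (ρ t)) := by
    refine ⟨?_⟩
    rw [withDensity_apply _ MeasurableSet.univ, Measure.restrict_univ,
      ← ofReal_integral_eq_lintegral_ofReal hρi (ae_of_all _ h0), h1, ENNReal.ofReal_one]
  have hm : Measurable fun t => ‖f (x - t) - f x‖ₑ :=
    ((hfm.comp (measurable_const.sub measurable_id)).sub measurable_const).enorm
  have e : mollify ρ f x - f x = ∫ t, ρ t • (f (x - t) - f x) := by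
    simp only [smul_sub]
    rw [integral_sub (integrable_mollify hρ hc hf x) (hρi.smul_const _), integral_smul_const, h1,
      one_smul]
    rfl
  have hle : ‖mollify ρ f x - f x‖ₑ ≤
      ∫⁻ t, ‖f (x - t) - f x‖ₑ ∂(volume.withDensity fun t => ENNReal.ofReal (ρ t)) := by
    rw [e, lintegral_withDensity_eq_lintegral_mul _ hρm hm]
    refine (enorm_integral_le_lintegral_enorm _).trans (le_of_eq (lintegral_congr fun t => ?_))
    rw [enorm_smul, Pi.mul_apply, Real.enorm_of_nonneg (h0 t)]
  calc ‖mollify ρ f x - f x‖ₑ ^ 2 ≤ _ := by gcongr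
    _ ≤ _ := sq_lintegral_le _ hm.aemeasurable
    _ = _ := by rw [lintegral_withDensity_eq_lintegral_mul _ hρm (hm.pow_const 2)]; rfl

/-- By Tonelli the error of mollification is at most the worst translation error over the support of
the mollifier. -/
theorem eLpNorm_mollify_sub_le {ρ : ℝ × ℝ → ℝ} (hρ : Continuous ρ) (hc : HasCompactSupport ρ)
    (h0 : ∀ t, 0 ≤ ρ t) (h1 : ∫ t, ρ t = 1) {f : ℝ × ℝ → ℂ} (hfm : Measurable f)
    (hf : LocallyIntegrable f) {ε : ℝ≥0∞}
    (hε : ∀ t ∈ Function.support ρ, eLpNorm (fun x => f (x - t) - f x) 2 volume ≤ ε) :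
    eLpNorm (fun x => mollify ρ f x - f x) 2 volume ≤ ε := by
  have hρi : Integrable ρ := hρ.integrable_of_hasCompactSupport hc
  have hρm : Measurable fun t => ENNReal.ofReal (ρ t) := hρ.measurable.ennreal_ofReal
  refine (ENNReal.pow_le_pow_left_iff (two_ne_zero)).1 ?_
  rw [eLpNorm_two_sq]
  calc ∫⁻ x, ‖mollify ρ f x - f x‖ₑ ^ 2
      ≤ ∫⁻ x, ∫⁻ t, ENNReal.ofReal (ρ t) * ‖f (x - t) - f x‖ₑ ^ 2 :=
        lintegral_mono fun x => enorm_mollify_sub_sq_le hρ hc h0 h1 hfm hf x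
    _ = ∫⁻ t, ∫⁻ x, ENNReal.ofReal (ρ t) * ‖f (x - t) - f x‖ₑ ^ 2 := by
        refine lintegral_lintegral_swap (Measurable.aemeasurable ?_)
        exact (hρm.comp measurable_snd).mul (((hfm.comp (measurable_fst.sub measurable_snd)).sub
          (hfm.comp measurable_fst)).enorm.pow_const 2)
    _ ≤ ∫⁻ t, ENNReal.ofReal (ρ t) * ε ^ 2 := by
        refine lintegral_mono fun t => ?_
        have hm : Measurable fun x => ‖f (x - t) - f x‖ₑ ^ 2 :=
          ((hfm.comp (measurable_id.sub measurable_const)).sub hfm).enorm.pow_const 2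
        rw [lintegral_const_mul _ hm, ← eLpNorm_two_sq volume fun x => f (x - t) - f x]
        by_cases ht : t ∈ Function.support ρ
        · gcongr; exact hε t ht
        · simp [Function.notMem_support.1 ht]
    _ = ε ^ 2 := by
        rw [lintegral_mul_const _ hρm, ← ofReal_integral_eq_lintegral_ofReal hρi (ae_of_all _ h0),
          h1, ENNReal.ofReal_one, one_mul]

theorem tendsto_eLpNorm_translate (f : L2) :
    Tendsto (fun t : ℝ × ℝ => eLpNorm (fun x => f (x - t) - f x) 2 volume) (𝓝 0) (𝓝 0) := by
  let G : C(ℝ × ℝ, C(ℝ × ℝ, ℝ × ℝ)) :=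
    ContinuousMap.curry ⟨fun q : (ℝ × ℝ) × (ℝ × ℝ) => q.2 - q.1, by fun_prop⟩
  have hG : ∀ t, MeasurePreserving (G t) volume volume := fun t =>
    measurePreserving_sub_right volume t
  have h := Tendsto.compMeasurePreservingLp (tendsto_const_nhds (x := f)) (G.continuous.tendsto 0)
    hG (hG 0) (by norm_num)
  rw [Lp.tendsto_Lp_iff_tendsto_eLpNorm'] at h
  refine h.congr fun t => eLpNorm_congr_ae ?_
  filter_upwards [Lp.coeFn_compMeasurePreserving f (hG t),
    Lp.coeFn_compMeasurePreserving f (hG 0)] with x hx hx0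
  simp only [Pi.sub_apply, hx, hx0, Function.comp_apply]
  simp [G]

/-- A sequence of smooth mollifiers shrinking to the origin. -/
def bump (n : ℕ) : ContDiffBump (0 : ℝ × ℝ) where
  rIn := 1 / (2 * (n + 1))
  rOut := 1 / (n + 1)
  rIn_pos := by positivity
  rIn_lt_rOut := by
    apply one_div_lt_one_div_of_lt <;> nlinarith [(Nat.cast_nonneg n : (0 : ℝ) ≤ n)]

/-- The mollification of `f` at the scale `1 / (n + 1)`. -/
def mol (n : ℕ) (f : ℝ × ℝ → ℂ) : ℝ × ℝ → ℂ := mollify ((bump n).normed volume) f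

theorem tendsto_eLpNorm_mol (f : L2) :
    Tendsto (fun n => eLpNorm (fun x => mol n f x - f x) 2 volume) atTop (𝓝 0) := by
  rw [ENNReal.tendsto_atTop_zero]
  intro ε hε
  obtain ⟨δ, hδ, h⟩ := Metric.eventually_nhds_iff.1
    ((tendsto_order.1 (tendsto_eLpNorm_translate f)).2 ε hε)
  obtain ⟨N, hN⟩ := exists_nat_one_div_lt hδ
  refine ⟨N, fun n hn => eLpNorm_mollify_sub_le (bump n).continuous_normed
    (bump n).hasCompactSupport_normed (bump n).nonneg_normed (bump n).integral_normed
    (Lp.stronglyMeasurable f).measurable ((Lp.memLp f).locallyIntegrable (by norm_num))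
    fun t ht => (h ?_).le⟩
  rw [(bump n).support_normed_eq, Metric.mem_ball] at ht
  refine ht.trans (lt_of_le_of_lt ?_ hN)
  exact one_div_le_one_div_of_le (by positivity) (by gcongr)

theorem mol_eq_convolution (n : ℕ) (f : ℝ × ℝ → ℂ) :
    mol n f = convolution ((bump n).normed volume) f (ContinuousLinearMap.lsmul ℝ ℝ) volume := by
  rfl

theorem contDiff_mol (n : ℕ) (f : L2) : ContDiff ℝ ∞ (mol n f) := by
  rw [mol_eq_convolution]
  exact (bump n).hasCompactSupport_normed.contDiff_convolution_left _ (bump n).contDiff_normed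
    ((Lp.memLp f).locallyIntegrable (by norm_num))

/-- The derivative of the convolution falls on the mollifier, and `s ↦ ρ (x - s)` is an admissible
test function for the weak derivative of `f`. -/
theorem fderiv_mol (n : ℕ) {v : ℝ × ℝ} {f g : L2} (h : IsWeakDeriv v f g) (x : ℝ × ℝ) :
    fderiv ℝ (mol n f) x v = mol n g x := by
  set ρ := (bump n).normed volume with hρ
  have hρc : HasCompactSupport ρ := (bump n).hasCompactSupport_normed
  have hρs : ContDiff ℝ ∞ ρ := (bump n).contDiff_normed
  have hf : LocallyIntegrable f := (Lp.memLp f).locallyIntegrable (by norm_num)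
  have hd := hρc.hasFDerivAt_convolution_left (ContinuousLinearMap.lsmul ℝ ℝ)
    (hρs.of_le (by simp)) hf x
  rw [mol_eq_convolution, hd.fderiv]
  have hex := (hρc.fderiv ℝ).convolutionExists_left
    ((ContinuousLinearMap.lsmul ℝ ℝ : ℝ →L[ℝ] ℂ →L[ℝ] ℂ).precompL (ℝ × ℝ))
    (hρs.continuous_fderiv (by simp)) hf x
  rw [convolution, ContinuousLinearMap.integral_apply hex]
  have e1 : ∀ t, ((ContinuousLinearMap.lsmul ℝ ℝ : ℝ →L[ℝ] ℂ →L[ℝ] ℂ).precompL (ℝ × ℝ)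
      (fderiv ℝ ρ t) (f (x - t))) v = (fderiv ℝ ρ t v) • f (x - t) := fun t => by
    simp [ContinuousLinearMap.precompL_apply]
  simp only [e1]
  have hcs : HasCompactSupport fun s => ρ (x - s) :=
    hρc.comp_homeomorph (Homeomorph.subLeft x)
  have hw := h (fun s => ρ (x - s)) (hρs.comp (contDiff_const.sub contDiff_id)) hcs
  have e2 : ∀ s, fderiv ℝ (fun s => ρ (x - s)) s v = - fderiv ℝ ρ (x - s) v := fun s => by
    have h1 : HasFDerivAt (fun s : ℝ × ℝ => x - s) (-ContinuousLinearMap.id ℝ (ℝ × ℝ)) s :=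
      (hasFDerivAt_id s).const_sub x
    have h2 := ((hρs.differentiable (by simp)) (x - s)).hasFDerivAt.comp s h1
    rw [show fderiv ℝ (fun s => ρ (x - s)) s = _ from h2.fderiv]
    simp
  simp only [e2, neg_smul, integral_neg, neg_inj] at hw
  rw [← integral_sub_left_eq_self (fun t => (fderiv ℝ ρ t v) • f (x - t)) volume x]
  simp only [sub_sub_cancel]
  rw [hw, ← integral_sub_left_eq_self (fun t => ρ (x - t) • g t) volume x]
  simp only [sub_sub_cancel]
  rfl

/-- Every translate of `f` differs from `f` by at most `2‖f‖` in `L²`, hence so does the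
mollification. -/
theorem memLp_mol (n : ℕ) (f : L2) : MemLp (mol n f) 2 volume := by
  have hsub : MemLp (fun x => mol n f x - f x) 2 volume := by
    refine ⟨(contDiff_mol n f).continuous.aestronglyMeasurable.sub (Lp.aestronglyMeasurable f),
      lt_of_le_of_lt (b := eLpNorm f 2 volume + eLpNorm f 2 volume) ?_
      (ENNReal.add_lt_top.2 ⟨Lp.eLpNorm_lt_top f, Lp.eLpNorm_lt_top f⟩)⟩
    refine eLpNorm_mollify_sub_le (bump n).continuous_normed
      (bump n).hasCompactSupport_normed (bump n).nonneg_normed (bump n).integral_normed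
      (Lp.stronglyMeasurable f).measurable ((Lp.memLp f).locallyIntegrable (by norm_num))
      fun t _ => ?_
    have hmp := measurePreserving_sub_right (volume : Measure (ℝ × ℝ)) t
    have e := eLpNorm_comp_measurePreserving (p := 2) (Lp.aestronglyMeasurable f) hmp
    refine (eLpNorm_sub_le ((Lp.aestronglyMeasurable f).comp_measurePreserving hmp)
      (Lp.aestronglyMeasurable f) (by norm_num)).trans ?_
    rw [e]
  have e : mol n f = (fun x => mol n f x - f x) + f := by ext x; simp
  rw [e]
  exact hsub.add (Lp.memLp f)

/-! ### Truncation by smooth cutoffs -/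

/-- A smooth cutoff function which is `1` near the origin. -/
def cutoffBump : ContDiffBump (0 : ℝ × ℝ) := ⟨1, 2, one_pos, one_lt_two⟩

/-- A smooth cutoff at the scale `n + 1`. -/
def cutoff (n : ℕ) (p : ℝ × ℝ) : ℝ := cutoffBump (((n : ℝ) + 1)⁻¹ • p)

theorem contDiff_cutoff (n : ℕ) : ContDiff ℝ ∞ (cutoff n) :=
  cutoffBump.contDiff.comp (contDiff_const_smul (((n : ℝ) + 1)⁻¹))

theorem hasCompactSupport_cutoff (n : ℕ) : HasCompactSupport (cutoff n) :=
  cutoffBump.hasCompactSupport.comp_smul (by positivity)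

theorem cutoff_mem_Icc (n : ℕ) (p : ℝ × ℝ) : cutoff n p ∈ Icc (0 : ℝ) 1 :=
  ⟨cutoffBump.nonneg, cutoffBump.le_one⟩

theorem tendsto_cutoff (p : ℝ × ℝ) : Tendsto (fun n => cutoff n p) atTop (𝓝 1) := by
  refine tendsto_const_nhds.congr' ?_
  obtain ⟨N, hN⟩ := exists_nat_ge ‖p‖
  filter_upwards [eventually_ge_atTop N] with n hn
  refine (cutoffBump.one_of_mem_closedBall ?_).symm
  rw [mem_closedBall_zero_iff, norm_smul, norm_inv, Real.norm_of_nonneg (by positivity)]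
  change _ ≤ (1 : ℝ)
  rw [inv_mul_le_iff₀ (by positivity)]
  have : (N : ℝ) ≤ n := by exact_mod_cast hn
  linarith

theorem exists_fderiv_cutoff_le : ∃ C : ℝ, ∀ (n : ℕ) (p v : ℝ × ℝ),
    |fderiv ℝ (cutoff n) p v| ≤ C * ‖v‖ / (n + 1) := by
  obtain ⟨C, hC⟩ := (cutoffBump.contDiff.continuous_fderiv (n := ∞)
    (by simp)).bounded_above_of_compact_support (cutoffBump.hasCompactSupport.fderiv ℝ)
  refine ⟨C, fun n p v => ?_⟩
  have h1 : HasFDerivAt (fun p : ℝ × ℝ => ((n : ℝ) + 1)⁻¹ • p)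
      (((n : ℝ) + 1)⁻¹ • ContinuousLinearMap.id ℝ (ℝ × ℝ)) p :=
    (((n : ℝ) + 1)⁻¹ • ContinuousLinearMap.id ℝ (ℝ × ℝ)).hasFDerivAt
  have h2 := ((cutoffBump.contDiff (n := ⊤)).differentiable (by simp)
    (((n : ℝ) + 1)⁻¹ • p)).hasFDerivAt.comp p h1
  rw [show fderiv ℝ (cutoff n) p = _ from h2.fderiv]
  simp only [ContinuousLinearMap.comp_apply, smul_apply,
    ContinuousLinearMap.id_apply, map_smul, smul_eq_mul, abs_mul]
  rw [abs_of_nonneg (by positivity : (0 : ℝ) ≤ ((n : ℝ) + 1)⁻¹), div_eq_inv_mul]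
  gcongr
  exact ((fderiv ℝ cutoffBump _).le_opNorm v).trans (by gcongr; exact hC _)

theorem tendsto_eLpNorm_cutoff_mul {f : ℝ × ℝ → ℂ} (hf : MemLp f 2 volume) :
    Tendsto (fun n => eLpNorm (fun p => (cutoff n p : ℂ) * f p - f p) 2 volume) atTop (𝓝 0) := by
  have hsq : Tendsto (fun n => ∫⁻ p, ‖(cutoff n p : ℂ) * f p - f p‖ₑ ^ 2) atTop
      (𝓝 (∫⁻ _ : ℝ × ℝ, 0)) := by
    refine tendsto_lintegral_of_dominated_convergence' (fun p => ‖f p‖ₑ ^ 2) (fun n => ?_)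
      (fun n => ae_of_all _ fun p => ?_) ?_ (ae_of_all _ fun p => ?_)
    · exact ((((Complex.continuous_ofReal.comp
        (contDiff_cutoff n).continuous).aestronglyMeasurable.mul hf.1).sub hf.1).enorm.pow_const 2)
    · refine pow_le_pow_left₀ zero_le ?_ 2
      rw [← sub_one_mul, enorm_mul]
      refine mul_le_of_le_one_left' ?_
      have := cutoff_mem_Icc n p
      rw [← ofReal_norm, ENNReal.ofReal_le_one,
        show (cutoff n p : ℂ) - 1 = ((cutoff n p - 1 : ℝ) : ℂ) by push_cast; ring,
        Complex.norm_real, Real.norm_eq_abs, abs_le]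
      constructor <;> linarith [this.1, this.2]
    · rw [← eLpNorm_two_sq]
      exact ENNReal.pow_ne_top hf.2.ne
    · have h1 : Tendsto (fun n => (cutoff n p : ℂ) * f p - f p) atTop (𝓝 (((1 : ℝ) : ℂ) * f p - f p)) :=
        (((Complex.continuous_ofReal.tendsto 1).comp (tendsto_cutoff p)).mul_const _).sub_const _
      have h2 := (ENNReal.continuous_pow 2).tendsto _ |>.comp ((continuous_enorm.tendsto _).comp h1)
      simpa [Function.comp_def] using h2
  simp only [lintegral_zero, ← eLpNorm_two_sq] at hsq
  have := (ENNReal.continuous_rpow_const (y := (2 : ℝ)⁻¹)).tendsto 0 |>.comp hsq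
  simp only [Function.comp_def, ENNReal.zero_rpow_of_pos (by norm_num : (0 : ℝ) < 2⁻¹)] at this
  refine this.congr fun n => ?_
  rw [← ENNReal.rpow_natCast, ← ENNReal.rpow_mul]
  norm_num

/-- The product of a smooth function with a cutoff function. -/
def cutTest (n : ℕ) (f : ℝ × ℝ → ℂ) (hf : ContDiff ℝ ∞ f) : testSpace :=
  ⟨fun p => (cutoff n p : ℂ) * f p, show _ ∧ _ from
    ⟨(Complex.ofRealCLM.contDiff.comp (contDiff_cutoff n)).mul hf,
      ((hasCompactSupport_cutoff n).comp_left (g := fun x : ℝ => (x : ℂ)) (by simp)).mul_right⟩⟩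

theorem fderiv_ofReal_mul {χ : ℝ × ℝ → ℝ} {f : ℝ × ℝ → ℂ} {p : ℝ × ℝ}
    (hχ : DifferentiableAt ℝ χ p) (hf : DifferentiableAt ℝ f p) (v : ℝ × ℝ) :
    fderiv ℝ (fun p => (χ p : ℂ) * f p) p v
      = (χ p : ℂ) * fderiv ℝ f p v + (fderiv ℝ χ p v : ℂ) * f p := by
  have h1 := (Complex.ofRealCLM.hasFDerivAt (x := χ p)).comp p hχ.hasFDerivAt
  have h2 : HasFDerivAt (fun p => (χ p : ℂ) * f p) _ p := h1.mul hf.hasFDerivAt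
  rw [h2.fderiv]
  simp [mul_comm]

/-- By the Leibniz rule the only new term carries the derivative of the cutoff, which is `O(1 / n)`
uniformly by scaling. -/
theorem tendsto_eLpNorm_fderiv_cutTest {f : ℝ × ℝ → ℂ} (hs : ContDiff ℝ ∞ f) (v : ℝ × ℝ)
    (hf : MemLp f 2 volume) (hg : MemLp (fun p => fderiv ℝ f p v) 2 volume) :
    Tendsto (fun n => eLpNorm (fun p => fderiv ℝ (cutTest n f hs) p v - fderiv ℝ f p v) 2 volume)
      atTop (𝓝 0) := by
  obtain ⟨C, hC⟩ := exists_fderiv_cutoff_le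
  have hz : Tendsto (fun n : ℕ => eLpNorm (fun p => (fderiv ℝ (cutoff n) p v : ℂ) * f p) 2 volume)
      atTop (𝓝 0) := by
    have hb : ∀ n : ℕ, eLpNorm (fun p => (fderiv ℝ (cutoff n) p v : ℂ) * f p) 2 volume ≤
        ENNReal.ofReal (C * ‖v‖ / (n + 1)) * eLpNorm f 2 volume := fun n => by
      refine eLpNorm_le_mul_eLpNorm_of_ae_le_mul (ae_of_all _ fun p => ?_) 2
      rw [norm_mul, Complex.norm_real, Real.norm_eq_abs]
      exact mul_le_mul_of_nonneg_right (hC n p v) (norm_nonneg _)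
    refine tendsto_of_tendsto_of_tendsto_of_le_of_le tendsto_const_nhds ?_ (fun _ => zero_le) hb
    have h1 : Tendsto (fun n : ℕ => C * ‖v‖ / ((n : ℝ) + 1)) atTop (𝓝 0) := by
      simpa [div_eq_mul_one_div (C * ‖v‖)] using
        (tendsto_one_div_add_atTop_nhds_zero_nat (𝕜 := ℝ)).const_mul (C * ‖v‖)
    have h2 := ENNReal.Tendsto.mul_const (ENNReal.tendsto_ofReal h1)
      (b := eLpNorm f 2 volume) (Or.inr hf.2.ne)
    simpa using h2
  have hsum := (tendsto_eLpNorm_cutoff_mul hg).add hz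
  rw [add_zero] at hsum
  refine tendsto_of_tendsto_of_tendsto_of_le_of_le tendsto_const_nhds hsum (fun _ => zero_le)
    fun n => ?_
  have e : (fun p => fderiv ℝ (cutTest n f hs) p v - fderiv ℝ f p v) =
      (fun p => (cutoff n p : ℂ) * fderiv ℝ f p v - fderiv ℝ f p v) +
      fun p => (fderiv ℝ (cutoff n) p v : ℂ) * f p := by
    ext p
    have := fderiv_ofReal_mul ((contDiff_cutoff n).differentiable (by simp) p)
      (hs.differentiable (by simp) p) v
    simp only [Pi.add_apply]
    rw [show fderiv ℝ (cutTest n f hs : ℝ × ℝ → ℂ) p v = _ from this]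
    ring
  rw [e]
  have hc : Continuous fun p => (cutoff n p : ℂ) :=
    Complex.continuous_ofReal.comp (contDiff_cutoff n).continuous
  have hd : Continuous fun p => (fderiv ℝ (cutoff n) p v : ℂ) :=
    Complex.continuous_ofReal.comp (contDiff_fderiv_apply (contDiff_cutoff n) v).continuous
  exact eLpNorm_add_le ((hc.aestronglyMeasurable.mul hg.1).sub hg.1)
    (hd.aestronglyMeasurable.mul hf.1) (by norm_num)

/-! ### Density of the test functions -/

theorem tendsto_testToLp_iff {ι : Type*} {l : Filter ι} (μ : Measure (ℝ × ℝ))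
    [IsFiniteMeasureOnCompacts μ] (φ : ι → testSpace) (ψ : Lp ℂ 2 μ) :
    Tendsto (fun n => testToLp μ (φ n)) l (𝓝 ψ) ↔
      Tendsto (fun n => eLpNorm (fun p => (φ n : ℝ × ℝ → ℂ) p - ψ p) 2 μ) l (𝓝 0) := by
  rw [Lp.tendsto_Lp_iff_tendsto_eLpNorm']
  refine tendsto_congr fun n => eLpNorm_congr_ae ?_
  filter_upwards [coeFn_testToLp μ (φ n)] with p hp
  simp [hp]

theorem tendsto_testToSobolev_iff {ι : Type*} {l : Filter ι} (φ : ι → testSpace) (u : sobolev) :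
    Tendsto (fun n => testToSobolev (φ n)) l (𝓝 u) ↔
      Tendsto (fun n => eLpNorm (fun p => (φ n : ℝ × ℝ → ℂ) p - coord 0 u p) 2 volume) l (𝓝 0) ∧
      Tendsto (fun n => eLpNorm (fun p => fderiv ℝ (φ n) p ex - coord 1 u p) 2 volume) l (𝓝 0) ∧
      Tendsto (fun n => eLpNorm (fun p => fderiv ℝ (φ n) p ey - coord 2 u p) 2 volume) l (𝓝 0) := by
  have h0 := tendsto_testToLp_iff (l := l) volume φ (coord 0 u)
  have h1 := tendsto_testToLp_iff (l := l) volume (fun n => testDeriv ex (φ n)) (coord 1 u)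
  have h2 := tendsto_testToLp_iff (l := l) volume (fun n => testDeriv ey (φ n)) (coord 2 u)
  simp only [testDeriv_apply] at h1 h2
  rw [← h0, ← h1, ← h2]
  constructor
  · intro h
    exact ⟨((coord 0).continuous.tendsto u).comp h, ((coord 1).continuous.tendsto u).comp h,
      ((coord 2).continuous.tendsto u).comp h⟩
  · rintro ⟨k0, k1, k2⟩
    rw [tendsto_iff_norm_sub_tendsto_zero] at k0 k1 k2 ⊢
    have hs := (((k0.pow 2).add (k1.pow 2)).add (k2.pow 2)).sqrt
    simp only [ne_eq, OfNat.ofNat_ne_zero, not_false_eq_true, zero_pow, add_zero,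
      Real.sqrt_zero] at hs
    refine hs.congr fun n => ?_
    rw [← Real.sqrt_sq (norm_nonneg (testToSobolev (φ n) - u)), sobolev_norm_sq]
    simp only [map_sub]
    rfl

/-- Mollify at one scale, which commutes with weak derivatives, then cut off the resulting smooth
function. Each operation uses half of the permitted error. -/
theorem denseRange_testToSobolev : DenseRange testToSobolev := by
  intro u
  have key : ∀ k : ℕ, ∃ φ : testSpace,
      eLpNorm (fun p => (φ : ℝ × ℝ → ℂ) p - coord 0 u p) 2 volume ≤ ((k : ℝ≥0∞) + 1)⁻¹ ∧
      eLpNorm (fun p => fderiv ℝ φ p ex - coord 1 u p) 2 volume ≤ ((k : ℝ≥0∞) + 1)⁻¹ ∧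
      eLpNorm (fun p => fderiv ℝ φ p ey - coord 2 u p) 2 volume ≤ ((k : ℝ≥0∞) + 1)⁻¹ := by
    intro k
    have hε : (0 : ℝ≥0∞) < ((k : ℝ≥0∞) + 1)⁻¹ / 2 :=
      ENNReal.half_pos (ENNReal.inv_ne_zero.2 (by simp))
    have ev := fun f : L2 => (tendsto_order.1 (tendsto_eLpNorm_mol f)).2 _ hε
    obtain ⟨n, hn0, hn1, hn2⟩ := ((ev (coord 0 u)).and ((ev (coord 1 u)).and (ev (coord 2 u)))).exists
    have hs := contDiff_mol n (coord 0 u)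
    have hx : (fun p => fderiv ℝ (mol n (coord 0 u)) p ex) = mol n (coord 1 u) :=
      funext (fderiv_mol n u.2.1)
    have hy : (fun p => fderiv ℝ (mol n (coord 0 u)) p ey) = mol n (coord 2 u) :=
      funext (fderiv_mol n u.2.2)
    have m0 := memLp_mol n (coord 0 u)
    have m1 := memLp_mol n (coord 1 u)
    have m2 := memLp_mol n (coord 2 u)
    obtain ⟨j, hj0, hj1, hj2⟩ := (((tendsto_order.1 (tendsto_eLpNorm_cutoff_mul m0)).2 _ hε).and
      (((tendsto_order.1 (tendsto_eLpNorm_fderiv_cutTest hs ex m0 (by rwa [hx]))).2 _ hε).and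
      ((tendsto_order.1 (tendsto_eLpNorm_fderiv_cutTest hs ey m0 (by rwa [hy]))).2 _ hε))).exists
    have tri : ∀ {f g : ℝ × ℝ → ℂ} {h : L2}, AEStronglyMeasurable f volume → MemLp g 2 volume →
        eLpNorm (fun p => f p - g p) 2 volume < ((k : ℝ≥0∞) + 1)⁻¹ / 2 →
        eLpNorm (fun p => g p - h p) 2 volume < ((k : ℝ≥0∞) + 1)⁻¹ / 2 →
        eLpNorm (fun p => f p - h p) 2 volume ≤ ((k : ℝ≥0∞) + 1)⁻¹ := by
      intro f g h hf hg h1 h2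
      have e : (fun p => f p - h p) = (fun p => f p - g p) + fun p => g p - h p := by
        ext p; simp
      rw [e]
      refine (eLpNorm_add_le (hf.sub hg.1) (hg.1.sub (Lp.aestronglyMeasurable h))
        (by norm_num)).trans ?_
      exact (add_le_add h1.le h2.le).trans (ENNReal.add_halves _).le
    simp only [fun p => congrFun hx p, fun p => congrFun hy p] at hj1 hj2
    exact ⟨cutTest j _ hs, tri (testSpace_continuous _).aestronglyMeasurable m0 hj0 hn0,
      tri (testSpace_continuous (testDeriv ex _)).aestronglyMeasurable m1 hj1 hn1,
      tri (testSpace_continuous (testDeriv ey _)).aestronglyMeasurable m2 hj2 hn2⟩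
  choose φ h0 h1 h2 using key
  have hlim : Tendsto (fun k : ℕ => ((k : ℝ≥0∞) + 1)⁻¹) atTop (𝓝 0) := by
    have := (tendsto_add_atTop_iff_nat 1).2 ENNReal.tendsto_inv_nat_nhds_zero
    simpa using this
  refine mem_closure_of_tendsto (b := atTop) ((tendsto_testToSobolev_iff φ u).2 ⟨?_, ?_, ?_⟩)
    (Eventually.of_forall fun n => mem_range_self (φ n))
  · exact tendsto_of_tendsto_of_tendsto_of_le_of_le tendsto_const_nhds hlim (fun _ => zero_le) h0
  · exact tendsto_of_tendsto_of_tendsto_of_le_of_le tendsto_const_nhds hlim (fun _ => zero_le) h1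
  · exact tendsto_of_tendsto_of_tendsto_of_le_of_le tendsto_const_nhds hlim (fun _ => zero_le) h2

end LeakyWire

end

noncomputable section

namespace LeakyWire

/-! ### Multiplication operators on `H¹(ℝ²)` and the diamagnetic inequality -/

theorem Lp_norm_sq {α : Type*} [MeasurableSpace α] {μ : Measure α} (f : Lp ℂ 2 μ) :
    ‖f‖ ^ 2 = ∫ x, ‖f x‖ ^ 2 ∂μ := by
  have h := L2.inner_def (𝕜 := ℂ) f f
  rw [inner_self_eq_norm_sq_to_K] at h
  have h2 : ((∫ x, ‖f x‖ ^ 2 ∂μ : ℝ) : ℂ) = ∫ x, inner ℂ (f x) (f x) ∂μ := by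
    rw [← integral_complex_ofReal]
    refine integral_congr_ae (ae_of_all _ fun x => ?_)
    simp only [inner_self_eq_norm_sq_to_K]
    simp
  rw [← h2] at h
  refine Complex.ofReal_injective (Eq.trans ?_ h)
  push_cast
  rfl

theorem Lp_norm_sq_of_ae {α : Type*} [MeasurableSpace α] {μ : Measure α} {f : Lp ℂ 2 μ}
    {g : α → ℂ} (h : f =ᵐ[μ] g) : ‖f‖ ^ 2 = ∫ x, ‖g x‖ ^ 2 ∂μ := by
  rw [Lp_norm_sq]
  exact integral_congr_ae (h.mono fun x hx => by simp only [hx])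

/-- Multiplication by `m` maps `H¹(ℝ²)` into `L²(ℝ²)`. -/
def IsMultiplier (m : ℝ × ℝ → ℝ) : Prop := ∀ ψ ∈ H1, MemLp (fun p => (m p : ℂ) * ψ p) 2 volume

/-- The multiplication by `m`, as a linear map from `H¹(ℝ²)` to `L²(ℝ²)`. -/
def mulLinear {m : ℝ × ℝ → ℝ} (hm : IsMultiplier m) : sobolev →ₗ[ℂ] L2 where
  toFun u := (hm _ (coord_mem_H1 u)).toLp _
  map_add' u w := by
    rw [← MemLp.toLp_add]
    refine MemLp.toLp_congr _ _ ?_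
    filter_upwards [Lp.coeFn_add (coord 0 u) (coord 0 w)] with p hp
    rw [map_add, hp]
    simp [mul_add]
  map_smul' c u := by
    rw [RingHom.id_apply, ← MemLp.toLp_const_smul]
    refine MemLp.toLp_congr _ _ ?_
    filter_upwards [Lp.coeFn_smul c (coord 0 u)] with p hp
    rw [map_smul, hp]
    simp only [Pi.smul_apply, smul_eq_mul]
    ring

theorem coeFn_mulLinear {m : ℝ × ℝ → ℝ} (hm : IsMultiplier m) (u : sobolev) :
    mulLinear hm u =ᵐ[volume] fun p => (m p : ℂ) * coord 0 u p :=
  MemLp.coeFn_toLp (hm _ (coord_mem_H1 u))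

theorem exists_subseq_ae {u : ℕ → L2} {x : L2} (h : Tendsto u atTop (𝓝 x)) :
    ∃ ns : ℕ → ℕ, StrictMono ns ∧
      ∀ᵐ p, Tendsto (fun i => u (ns i) p) atTop (𝓝 (x p)) :=
  (tendstoInMeasure_of_tendsto_Lp h).exists_seq_tendsto_ae

/-- Closed graph theorem: `L²` limits are almost everywhere limits along a subsequence, and
pointwise multiplication respects those. -/
theorem continuous_mulLinear {m : ℝ × ℝ → ℝ} (hm : IsMultiplier m) :
    Continuous (mulLinear hm) := by
  refine LinearMap.continuous_of_seq_closed_graph _ fun u x y hu hy => ?_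
  obtain ⟨ns, hns, h1⟩ := exists_subseq_ae (((coord 0).continuous.tendsto x).comp hu)
  obtain ⟨ks, hks, h2⟩ := exists_subseq_ae (hy.comp hns.tendsto_atTop)
  refine Lp.ext ?_
  have hall : ∀ᵐ p, ∀ i, mulLinear hm (u i) p = (m p : ℂ) * coord 0 (u i) p :=
    ae_all_iff.2 fun i => coeFn_mulLinear hm (u i)
  filter_upwards [h1, h2, hall, coeFn_mulLinear hm x] with p hp1 hp2 hp3 hp4
  rw [hp4]
  refine tendsto_nhds_unique hp2 ?_
  simp only [Function.comp_apply, hp3]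
  exact (hp1.comp hks.tendsto_atTop).const_mul _

/-- The multiplication by `m`, as a bounded operator from `H¹(ℝ²)` to `L²(ℝ²)`. -/
def mulOp {m : ℝ × ℝ → ℝ} (hm : IsMultiplier m) : sobolev →L[ℂ] L2 :=
  ⟨mulLinear hm, continuous_mulLinear hm⟩

theorem coeFn_mulOp {m : ℝ × ℝ → ℝ} (hm : IsMultiplier m) (u : sobolev) :
    mulOp hm u =ᵐ[volume] fun p => (m p : ℂ) * coord 0 u p :=
  coeFn_mulLinear hm u

theorem coeFn_mulOp_test {m : ℝ × ℝ → ℝ} (hm : IsMultiplier m) (φ : testSpace) :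
    mulOp hm (testToSobolev φ) =ᵐ[volume] fun p => (m p : ℂ) * (φ : ℝ × ℝ → ℂ) p := by
  filter_upwards [coeFn_mulOp hm (testToSobolev φ), coeFn_testToLp volume φ] with p h1 h2
  rw [h1, coord_zero_test, h2]

theorem IsMultiplier.memLp_test {m : ℝ × ℝ → ℝ} (hm : IsMultiplier m) (φ : testSpace) :
    MemLp (fun p => (m p : ℂ) * (φ : ℝ × ℝ → ℂ) p) 2 volume :=
  (memLp_congr_ae (coeFn_mulOp_test hm φ)).1 (Lp.memLp _)

theorem sobolev_norm_sq_test (φ : testSpace) :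
    ‖testToSobolev φ‖ ^ 2 = (∫ p, ‖(φ : ℝ × ℝ → ℂ) p‖ ^ 2) + (∫ p, ‖fderiv ℝ (φ : ℝ × ℝ → ℂ) p ex‖ ^ 2)
      + ∫ p, ‖fderiv ℝ (φ : ℝ × ℝ → ℂ) p ey‖ ^ 2 := by
  rw [sobolev_norm_sq, coord_zero_test, coord_one_test, coord_two_test,
    Lp_norm_sq_of_ae (coeFn_testToLp volume φ),
    Lp_norm_sq_of_ae (coeFn_testToLp volume (testDeriv ex φ)),
    Lp_norm_sq_of_ae (coeFn_testToLp volume (testDeriv ey φ))]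
  rfl

theorem IsMultiplier.exists_bound {m : ℝ × ℝ → ℝ} (hm : IsMultiplier m) :
    ∃ C : ℝ, 0 ≤ C ∧ ∀ v : ℝ × ℝ → ℝ, ContDiff ℝ ∞ v → HasCompactSupport v →
      Integrable (fun p => (m p * v p) ^ 2) ∧
      ∫ p, (m p * v p) ^ 2 ≤ C * ((∫ p, v p ^ 2) + (∫ p, (fderiv ℝ v p ex) ^ 2)
        + ∫ p, (fderiv ℝ v p ey) ^ 2) := by
  refine ⟨‖mulOp hm‖ ^ 2, sq_nonneg _, fun v hv hc => ?_⟩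
  have h := (mulOp hm).le_opNorm (testToSobolev (testOfReal v hv hc))
  have h2 := pow_le_pow_left₀ (norm_nonneg _) h 2
  have e : ∀ p, ‖(m p : ℂ) * (testOfReal v hv hc : ℝ × ℝ → ℂ) p‖ ^ 2 = (m p * v p) ^ 2 := fun p => by
    simp [testOfReal, mul_pow]
  rw [mul_pow, sobolev_norm_sq_test, Lp_norm_sq_of_ae (coeFn_mulOp_test hm _)] at h2
  simp only [e, testOfReal_deriv, Complex.norm_real, Real.norm_eq_abs, sq_abs] at h2
  refine ⟨?_, ?_⟩
  · have := (hm.memLp_test (testOfReal v hv hc)).integrable_norm_pow (p := 2) (by norm_num)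
    simpa only [e] using this
  · have e0 : ∀ p, ‖(testOfReal v hv hc : ℝ × ℝ → ℂ) p‖ ^ 2 = v p ^ 2 := fun p => by
      simp [testOfReal]
    simpa only [e0] using h2

/-- The covariant derivative `(i∂_v + m)φ` of a smooth function. -/
def covD (m : ℝ × ℝ → ℝ) (v : ℝ × ℝ) (φ : ℝ × ℝ → ℂ) (p : ℝ × ℝ) : ℂ :=
  Complex.I * fderiv ℝ φ p v + (m p : ℂ) * φ p

/-- The density `|(i∇ + A)φ|²`. -/
def magSq (A : ℝ × ℝ → ℝ × ℝ) (φ : ℝ × ℝ → ℂ) (p : ℝ × ℝ) : ℝ :=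
  ‖covD (fun q => (A q).1) ex φ p‖ ^ 2 + ‖covD (fun q => (A q).2) ey φ p‖ ^ 2

theorem magSq_nonneg (A : ℝ × ℝ → ℝ × ℝ) (φ : ℝ × ℝ → ℂ) (p : ℝ × ℝ) : 0 ≤ magSq A φ p := by
  unfold magSq; positivity

theorem IsMultiplier.memLp_covD {m : ℝ × ℝ → ℝ} (hm : IsMultiplier m) (v : ℝ × ℝ)
    (φ : testSpace) : MemLp (covD m v φ) 2 volume :=
  ((testSpace_memLp (testDeriv v φ) volume).const_mul Complex.I).add (hm.memLp_test φ)

theorem IsMultiplier.integrable_covD_sq {m : ℝ × ℝ → ℝ} (hm : IsMultiplier m) (v : ℝ × ℝ)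
    (φ : testSpace) : Integrable fun p => ‖covD m v φ p‖ ^ 2 :=
  (hm.memLp_covD v φ).integrable_norm_pow (p := 2) (by norm_num)

/-- The potential contributes `-i m φ` to `-i (i∂_v + m)φ`. It is real-orthogonal to `φ`, so the
radial part of the derivative does not see it. This is the source of the diamagnetic inequality. -/
theorem abs_inner_fderiv_le (m : ℝ × ℝ → ℝ) (v : ℝ × ℝ) (φ : ℝ × ℝ → ℂ) (p : ℝ × ℝ) :
    |inner ℝ (φ p) (fderiv ℝ φ p v)| ≤ ‖φ p‖ * ‖covD m v φ p‖ := by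
  have e : inner ℝ (φ p) (fderiv ℝ φ p v) = inner ℝ (φ p) (-Complex.I * covD m v φ p) := by
    simp only [Complex.inner, covD, Complex.mul_re, Complex.mul_im, Complex.add_re, Complex.add_im,
      Complex.I_re, Complex.I_im, Complex.ofReal_re, Complex.ofReal_im, Complex.conj_re,
      Complex.conj_im, Complex.neg_re, Complex.neg_im]
    ring
  rw [e]
  refine (abs_real_inner_le_norm _ _).trans ?_
  simp

theorem fderiv_norm_sq_apply {φ : ℝ × ℝ → ℂ} {p : ℝ × ℝ} (h : DifferentiableAt ℝ φ p)
    (v : ℝ × ℝ) : fderiv ℝ (fun q => ‖φ q‖ ^ 2) p v = 2 * inner ℝ (φ p) (fderiv ℝ φ p v) := by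
  rw [h.hasFDerivAt.norm_sq.fderiv]
  simp only [smul_apply, ContinuousLinearMap.comp_apply, innerSL_apply_apply, nsmul_eq_mul]
  norm_num

theorem abs_fderiv_norm_sq_le (m : ℝ × ℝ → ℝ) {φ : ℝ × ℝ → ℂ} {p : ℝ × ℝ}
    (h : DifferentiableAt ℝ φ p) (v : ℝ × ℝ) :
    |fderiv ℝ (fun q => ‖φ q‖ ^ 2) p v| ≤ 2 * (‖φ p‖ * ‖covD m v φ p‖) := by
  rw [fderiv_norm_sq_apply h, abs_mul, abs_two]
  gcongr
  exact abs_inner_fderiv_le m v φ p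

/-- The regularised modulus `√(|φ|² + ε²)`. -/
def regAbs (ε : ℝ) (φ : ℝ × ℝ → ℂ) (p : ℝ × ℝ) : ℝ := √(‖φ p‖ ^ 2 + ε ^ 2)

theorem regAbs_sq (ε : ℝ) (φ : ℝ × ℝ → ℂ) (p : ℝ × ℝ) :
    regAbs ε φ p ^ 2 = ‖φ p‖ ^ 2 + ε ^ 2 := Real.sq_sqrt (by positivity)

theorem contDiff_regAbs {ε : ℝ} (hε : 0 < ε) {φ : ℝ × ℝ → ℂ} (h : ContDiff ℝ ∞ φ) :
    ContDiff ℝ ∞ (regAbs ε φ) :=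
  ((h.norm_sq ℝ).add contDiff_const).sqrt fun p => by positivity

/-- The derivative is `Re (φ̄ ∂φ) / √(|φ|² + ε²)`, and `|φ|` is at most the denominator. -/
theorem abs_fderiv_regAbs_le (m : ℝ × ℝ → ℝ) {ε : ℝ} (hε : 0 < ε) {φ : ℝ × ℝ → ℂ}
    {p : ℝ × ℝ} (h : DifferentiableAt ℝ φ p) (v : ℝ × ℝ) :
    |fderiv ℝ (regAbs ε φ) p v| ≤ ‖covD m v φ p‖ := by
  have hpos : 0 < ‖φ p‖ ^ 2 + ε ^ 2 := by positivity
  have hd := (h.hasFDerivAt.norm_sq.add_const (ε ^ 2)).sqrt hpos.ne'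
  rw [show fderiv ℝ (regAbs ε φ) p = _ from hd.fderiv]
  have hs : 0 < √(‖φ p‖ ^ 2 + ε ^ 2) := Real.sqrt_pos.2 hpos
  have hle : ‖φ p‖ ≤ √(‖φ p‖ ^ 2 + ε ^ 2) := Real.le_sqrt_of_sq_le (by nlinarith [sq_nonneg ε])
  simp only [smul_apply, smul_eq_mul, ContinuousLinearMap.comp_apply,
    innerSL_apply_apply, nsmul_eq_mul]
  rw [show ((2 : ℕ) : ℝ) = 2 by norm_num, abs_mul, abs_mul, abs_two, abs_of_pos (by positivity),
    one_div, inv_mul_le_iff₀ (by positivity)]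
  have := abs_inner_fderiv_le m v φ p
  nlinarith [norm_nonneg (covD m v φ p)]

theorem norm_le_regAbs (ε : ℝ) (φ : ℝ × ℝ → ℂ) (p : ℝ × ℝ) : ‖φ p‖ ≤ regAbs ε φ p :=
  Real.le_sqrt_of_sq_le (by nlinarith [sq_nonneg ε])

theorem regAbs_le {ε : ℝ} (hε : 0 ≤ ε) (φ : ℝ × ℝ → ℂ) (p : ℝ × ℝ) :
    regAbs ε φ p ≤ ‖φ p‖ + ε :=
  Real.sqrt_le_iff.2 ⟨by positivity, by nlinarith [mul_nonneg hε (norm_nonneg (φ p))]⟩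

theorem le_regAbs (ε : ℝ) (φ : ℝ × ℝ → ℂ) (p : ℝ × ℝ) : ε ≤ regAbs ε φ p :=
  Real.le_sqrt_of_sq_le (by nlinarith [sq_nonneg ‖φ p‖])

theorem integrable_test_sq (φ : testSpace) : Integrable fun p => ‖(φ : ℝ × ℝ → ℂ) p‖ ^ 2 :=
  (testSpace_memLp φ volume).integrable_norm_pow (p := 2) (by norm_num)

/-- The regularised modulus `√(|φ|² + ε²) - ε`, which vanishes where `φ` does. -/
def cutAbs (ε : ℝ) (φ : ℝ × ℝ → ℂ) (p : ℝ × ℝ) : ℝ := regAbs ε φ p - ε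

theorem contDiff_cutAbs {ε : ℝ} (hε : 0 < ε) (φ : testSpace) : ContDiff ℝ ∞ (cutAbs ε φ) :=
  (contDiff_regAbs hε (testSpace_contDiff φ)).sub contDiff_const

theorem hasCompactSupport_cutAbs {ε : ℝ} (hε : 0 < ε) (φ : testSpace) :
    HasCompactSupport (cutAbs ε φ) := by
  refine (testSpace_hasCompactSupport φ).mono fun p hp => ?_
  contrapose! hp
  simp only [Function.mem_support, ne_eq, not_not] at hp ⊢
  simp [cutAbs, regAbs, hp, Real.sqrt_sq hε.le]

theorem cutAbs_nonneg (ε : ℝ) (φ : ℝ × ℝ → ℂ) (p : ℝ × ℝ) : 0 ≤ cutAbs ε φ p :=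
  sub_nonneg.2 (le_regAbs ε φ p)

theorem cutAbs_le {ε : ℝ} (hε : 0 < ε) (φ : ℝ × ℝ → ℂ) (p : ℝ × ℝ) : cutAbs ε φ p ≤ ‖φ p‖ := by
  have := regAbs_le hε.le φ p
  unfold cutAbs; linarith

theorem sub_le_cutAbs (ε : ℝ) (φ : ℝ × ℝ → ℂ) (p : ℝ × ℝ) : ‖φ p‖ - ε ≤ cutAbs ε φ p := by
  have := norm_le_regAbs ε φ p
  unfold cutAbs; linarith

theorem sq_fderiv_cutAbs_le (m : ℝ × ℝ → ℝ) {ε : ℝ} (hε : 0 < ε) (φ : testSpace) (p v : ℝ × ℝ) :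
    (fderiv ℝ (cutAbs ε φ) p v) ^ 2 ≤ ‖covD m v φ p‖ ^ 2 := by
  have : fderiv ℝ (cutAbs ε φ) p = fderiv ℝ (regAbs ε φ) p := fderiv_sub_const _
  rw [this, ← sq_abs]
  exact pow_le_pow_left₀ (abs_nonneg _)
    (abs_fderiv_regAbs_le m hε (testSpace_differentiable φ p) v) 2

theorem integrable_sq_of_hasCompactSupport {v : ℝ × ℝ → ℝ} (hv : Continuous v)
    (hc : HasCompactSupport v) : Integrable fun p => v p ^ 2 := by
  simp only [sq]
  exact (hv.mul hv).integrable_of_hasCompactSupport hc.mul_right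

theorem integral_cutAbs_le {A₁ A₂ : ℝ × ℝ → ℝ} (h₁ : IsMultiplier A₁) (h₂ : IsMultiplier A₂)
    {ε : ℝ} (hε : 0 < ε) (φ : testSpace) :
    (∫ p, cutAbs ε φ p ^ 2) + (∫ p, (fderiv ℝ (cutAbs ε φ) p ex) ^ 2)
        + ∫ p, (fderiv ℝ (cutAbs ε φ) p ey) ^ 2 ≤
      (∫ p, ‖(φ : ℝ × ℝ → ℂ) p‖ ^ 2) + (∫ p, ‖covD A₁ ex φ p‖ ^ 2)
        + ∫ p, ‖covD A₂ ey φ p‖ ^ 2 := by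
  have hs := contDiff_cutAbs hε φ
  have hc := hasCompactSupport_cutAbs hε φ
  have hi : ∀ w : ℝ × ℝ, Integrable fun p => (fderiv ℝ (cutAbs ε φ) p w) ^ 2 := fun w =>
    integrable_sq_of_hasCompactSupport (contDiff_fderiv_apply hs w).continuous
      (hasCompactSupport_fderiv_apply hc w)
  refine add_le_add (add_le_add ?_ ?_) ?_
  · exact integral_mono (integrable_sq_of_hasCompactSupport hs.continuous hc)
      (integrable_test_sq φ) fun p => pow_le_pow_left₀ (cutAbs_nonneg _ _ p) (cutAbs_le hε _ p) 2
  · exact integral_mono (hi ex) (h₁.integrable_covD_sq ex φ) fun p =>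
      sq_fderiv_cutAbs_le A₁ hε φ p ex
  · exact integral_mono (hi ey) (h₂.integrable_covD_sq ey φ) fun p =>
      sq_fderiv_cutAbs_le A₂ hε φ p ey

theorem IsMultiplier.tendsto_integral_cutAbs {m : ℝ × ℝ → ℝ} (hm : IsMultiplier m)
    (φ : testSpace) :
    Tendsto (fun n : ℕ => ∫ p, (m p * cutAbs (1 / ((n : ℝ) + 1)) φ p) ^ 2) atTop
      (𝓝 (∫ p, ‖(m p : ℂ) * (φ : ℝ × ℝ → ℂ) p‖ ^ 2)) := by
  obtain ⟨C, hC, hb⟩ := hm.exists_bound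
  have hpos : ∀ n : ℕ, 0 < 1 / ((n : ℝ) + 1) := fun n => by positivity
  have hint := (hm.memLp_test φ).integrable_norm_pow (p := 2) (by norm_num)
  refine tendsto_integral_of_dominated_convergence _
    (fun n => (hb _ (contDiff_cutAbs (hpos n) φ)
      (hasCompactSupport_cutAbs (hpos n) φ)).1.aestronglyMeasurable) hint
    (fun n => ae_of_all _ fun p => ?_) (ae_of_all _ fun p => ?_)
  · rw [norm_mul, Complex.norm_real, Real.norm_of_nonneg (sq_nonneg _), mul_pow, mul_pow,
      Real.norm_eq_abs, sq_abs]
    exact mul_le_mul_of_nonneg_left (pow_le_pow_left₀ (cutAbs_nonneg _ _ p)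
      (cutAbs_le (hpos n) _ p) 2) (sq_nonneg _)
  · have hl : Tendsto (fun n : ℕ => cutAbs (1 / ((n : ℝ) + 1)) φ p) atTop
        (𝓝 ‖(φ : ℝ × ℝ → ℂ) p‖) := by
      refine tendsto_of_tendsto_of_tendsto_of_le_of_le
        (g := fun n : ℕ => ‖(φ : ℝ × ℝ → ℂ) p‖ - 1 / ((n : ℝ) + 1))
        ?_ tendsto_const_nhds (fun n => sub_le_cutAbs _ _ p) fun n => cutAbs_le (hpos n) _ p
      simpa using tendsto_const_nhds.sub (tendsto_one_div_add_atTop_nhds_zero_nat (𝕜 := ℝ))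
    have := (hl.const_mul (m p)).pow 2
    rwa [norm_mul, Complex.norm_real, mul_pow, Real.norm_eq_abs, sq_abs, ← mul_pow]

/-- The multiplier bound is applied to the real test function `√(|φ|² + ε²) - ε`, whose Sobolev norm
is at most the magnetic one of `φ`. Then `ε → 0`. The potential in the energy need not be related to
`m`. -/
theorem IsMultiplier.exists_bound_magnetic {m : ℝ × ℝ → ℝ} (hm : IsMultiplier m)
    {A₁ A₂ : ℝ × ℝ → ℝ} (h₁ : IsMultiplier A₁) (h₂ : IsMultiplier A₂) :
    ∃ C : ℝ, 0 ≤ C ∧ ∀ φ : testSpace, ∫ p, ‖(m p : ℂ) * (φ : ℝ × ℝ → ℂ) p‖ ^ 2 ≤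
      C * ((∫ p, ‖(φ : ℝ × ℝ → ℂ) p‖ ^ 2) + (∫ p, ‖covD A₁ ex φ p‖ ^ 2)
        + ∫ p, ‖covD A₂ ey φ p‖ ^ 2) := by
  obtain ⟨C, hC, hb⟩ := hm.exists_bound
  refine ⟨C, hC, fun φ => le_of_tendsto' (hm.tendsto_integral_cutAbs φ) fun n => ?_⟩
  have hpos : 0 < 1 / ((n : ℝ) + 1) := by positivity
  exact (hb _ (contDiff_cutAbs hpos φ) (hasCompactSupport_cutAbs hpos φ)).2.trans
    (mul_le_mul_of_nonneg_left (integral_cutAbs_le h₁ h₂ hpos φ) hC)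

end LeakyWire

end

noncomputable section

namespace LeakyWire

/-! ### Bounds for restrictions to curves -/

/-- The value is the integral of the derivative from the left and minus the integral to the right.
Averaging the two gives the factor `1 / 2`, without which the threshold `α² / 4` would be missed. -/
theorem abs_le_half_integral_abs_deriv {f : ℝ → ℝ} (hf : ContDiff ℝ 1 f)
    (hc : HasCompactSupport f) (t : ℝ) : |f t| ≤ (∫ s, |deriv f s|) / 2 := by
  have h1 := hc.integral_Ioi_deriv_eq hf t
  have h2 := hc.integral_Iic_deriv_eq hf t
  have hi : Integrable fun s => |deriv f s| :=
    ((hf.continuous_deriv le_rfl).integrable_of_hasCompactSupport hc.deriv).abs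
  have h3 := abs_integral_le_integral_abs (f := deriv f) (μ := volume.restrict (Ioi t))
  have h4 := abs_integral_le_integral_abs (f := deriv f) (μ := volume.restrict (Iic t))
  rw [h1, abs_neg] at h3
  rw [h2] at h4
  have h5 := intervalIntegral.integral_Iic_add_Ioi (b := t) hi.integrableOn hi.integrableOn
  linarith

theorem hasCompactSupport_line {F : ℝ × ℝ → ℝ} (hc : HasCompactSupport F) (p : ℝ × ℝ)
    {v : ℝ × ℝ} (hv : v ≠ 0) : HasCompactSupport fun t : ℝ => F (p + t • v) :=
  hc.comp_isClosedEmbedding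
    ((Homeomorph.addLeft p).isClosedEmbedding.comp (isClosedEmbedding_smul_left hv))

theorem hasDerivAt_line {F : ℝ × ℝ → ℝ} (hF : Differentiable ℝ F) (p v : ℝ × ℝ) (t : ℝ) :
    HasDerivAt (fun t : ℝ => F (p + t • v)) (fderiv ℝ F (p + t • v) v) t := by
  have h : HasDerivAt (fun t : ℝ => p + t • v) v t := by
    simpa using ((hasDerivAt_id t).smul_const v).const_add p
  exact (hF _).hasFDerivAt.comp_hasDerivAt t h

theorem abs_le_half_integral_line {F : ℝ × ℝ → ℝ} (hF : ContDiff ℝ ∞ F)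
    (hc : HasCompactSupport F) (p : ℝ × ℝ) {v : ℝ × ℝ} (hv : v ≠ 0) (t : ℝ) :
    |F (p + t • v)| ≤ (∫ s : ℝ, |fderiv ℝ F (p + s • v) v|) / 2 := by
  have hd := hasDerivAt_line (hF.differentiable (by simp)) p v
  have hs : ContDiff ℝ 1 fun t : ℝ => F (p + t • v) :=
    (hF.of_le (by simp)).comp (contDiff_const.add (contDiff_id.smul contDiff_const))
  have := abs_le_half_integral_abs_deriv hs (hasCompactSupport_line hc p hv) t
  simpa only [fun s => (hd s).deriv] using this

theorem isClosedEmbedding_graph {γ : ℝ → ℝ} (hγ : Continuous γ) :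
    IsClosedEmbedding fun x : ℝ => (x, γ x) :=
  Function.LeftInverse.isClosedEmbedding (f := Prod.fst) (fun _ => rfl) continuous_fst
    (continuous_id.prodMk hγ)

theorem integrable_graph {F : ℝ × ℝ → ℝ} (hF : Continuous F) (hc : HasCompactSupport F)
    {γ : ℝ → ℝ} (hγ : Continuous γ) : Integrable fun x => F (x, γ x) :=
  (hF.comp (continuous_id.prodMk hγ)).integrable_of_hasCompactSupport
    (hc.comp_isClosedEmbedding (isClosedEmbedding_graph hγ))

/-- Each vertical line meets the graph once, so the one-dimensional bound can be integrated over `x`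
by Fubini. -/
theorem integral_graph_le {F : ℝ × ℝ → ℝ} (hF : ContDiff ℝ ∞ F) (hc : HasCompactSupport F)
    {γ : ℝ → ℝ} (hγ : Continuous γ) :
    ∫ x, F (x, γ x) ≤ (∫ p, |fderiv ℝ F p ey|) / 2 := by
  have hi : Integrable fun p => |fderiv ℝ F p ey| :=
    ((contDiff_fderiv_apply hF ey).continuous.integrable_of_hasCompactSupport
      (hasCompactSupport_fderiv_apply hc ey)).abs
  rw [Measure.volume_eq_prod, integral_prod _ hi, ← integral_div]
  refine integral_mono (integrable_graph hF.continuous hc hγ) (hi.integral_prod_left.div_const 2)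
    fun x => ?_
  have := abs_le_half_integral_line hF hc (x, 0) (v := ey) (by simp [ey]) (γ x)
  simp only [ey, Prod.smul_mk, smul_eq_mul, mul_zero, mul_one, Prod.mk_add_mk, add_zero,
    zero_add] at this
  exact (le_abs_self _).trans this

theorem setIntegral_antidiagonal {G : ℝ × ℝ → ℝ} (hG : Integrable G) (S : Set ℝ) :
    ∫ p in {p : ℝ × ℝ | p.1 + p.2 ∈ S}, G p = ∫ c in S, ∫ t, G (t, c - t) := by
  have hmp : MeasurePreserving (fun z : ℝ × ℝ => (z.2, z.1 - z.2)) volume volume :=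
    measurePreserving_prod_sub_swap volume volume
  have hemb : MeasurableEmbedding fun z : ℝ × ℝ => (z.2, z.1 - z.2) := by
    let e : ℝ × ℝ ≃ₜ ℝ × ℝ :=
      { toFun := fun z => (z.2, z.1 - z.2)
        invFun := fun z => (z.1 + z.2, z.1)
        left_inv := fun z => by simp
        right_inv := fun z => by simp
        continuous_toFun := by fun_prop
        continuous_invFun := by fun_prop }
    exact e.measurableEmbedding
  rw [← hmp.setIntegral_preimage_emb hemb]
  have hpre : (fun z : ℝ × ℝ => (z.2, z.1 - z.2)) ⁻¹' {p : ℝ × ℝ | p.1 + p.2 ∈ S} =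
      S ×ˢ (univ : Set ℝ) := by
    ext z; simp
  have hi : Integrable (fun z : ℝ × ℝ => G (z.2, z.1 - z.2)) :=
    (hmp.integrable_comp_emb hemb).2 hG
  rw [hpre, Measure.volume_eq_prod, setIntegral_prod _ hi.integrableOn]
  simp

/-- The one-dimensional bound on each antidiagonal `t ↦ (t, c - t)`, whose direction is `ex - ey`
and which meets the diagonal at `t = c / 2`. The set `S` of values `c` confines the estimate to a
union of antidiagonals. -/
theorem setIntegral_diagonal_le {F : ℝ × ℝ → ℝ} (hF : ContDiff ℝ ∞ F) (hc : HasCompactSupport F)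
    (S : Set ℝ) :
    ∫ c in S, F (c / 2, c / 2) ≤
      (∫ p in {p : ℝ × ℝ | p.1 + p.2 ∈ S}, |fderiv ℝ F p ex - fderiv ℝ F p ey|) / 2 := by
  have hi : Integrable fun p => |fderiv ℝ F p ex - fderiv ℝ F p ey| :=
    (((contDiff_fderiv_apply hF ex).continuous.integrable_of_hasCompactSupport
      (hasCompactSupport_fderiv_apply hc ex)).sub
      ((contDiff_fderiv_apply hF ey).continuous.integrable_of_hasCompactSupport
      (hasCompactSupport_fderiv_apply hc ey))).abs
  have hmp : MeasurePreserving (fun z : ℝ × ℝ => (z.2, z.1 - z.2)) volume volume :=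
    measurePreserving_prod_sub_swap volume volume
  have hi2 : Integrable (fun z : ℝ × ℝ => (fun p => |fderiv ℝ F p ex - fderiv ℝ F p ey|)
      (z.2, z.1 - z.2)) := hmp.integrable_comp_of_integrable hi
  rw [setIntegral_antidiagonal hi S, ← integral_div]
  have hdiag : IsClosedEmbedding fun c : ℝ => (c / 2, c / 2) :=
    Function.LeftInverse.isClosedEmbedding (f := fun p : ℝ × ℝ => p.1 + p.2)
      (fun c => add_halves c) (by fun_prop) (by fun_prop)
  have hcd : Integrable fun c : ℝ => F (c / 2, c / 2) :=
    (hF.continuous.comp hdiag.continuous).integrable_of_hasCompactSupport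
      (hc.comp_isClosedEmbedding hdiag)
  refine setIntegral_mono hcd.integrableOn (hi2.integral_prod_left.div_const 2).integrableOn
    fun c => ?_
  have := abs_le_half_integral_line hF hc (0, c) (v := (1, -1)) (by simp) (c / 2)
  simp only [Prod.smul_mk, smul_eq_mul, mul_one, mul_neg, Prod.mk_add_mk, zero_add,
    ← sub_eq_add_neg, sub_half] at this
  refine (le_abs_self _).trans (this.trans (le_of_eq ?_))
  have e : ((1 : ℝ), (-1 : ℝ)) = ex - ey := by simp [ex, ey]
  simp only [e, map_sub]

/-! ### Restrictions to graphs inside the square -/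

theorem abs_sub_le_setIntegral {f f' : ℝ → ℝ} (hd : ∀ t, HasDerivAt f (f' t) t)
    (hc : Continuous f') {a s t : ℝ} (hs : s ∈ Icc (-a) a) (ht : t ∈ Icc (-a) a) :
    |f t - f s| ≤ ∫ r in Ioo (-a) a, |f' r| := by
  rw [← intervalIntegral.integral_eq_sub_of_hasDerivAt (fun r _ => hd r)
    (hc.intervalIntegrable s t), ← Real.norm_eq_abs]
  refine (intervalIntegral.norm_integral_le_integral_norm_uIoc).trans ?_
  simp only [Real.norm_eq_abs]
  rw [← integral_Ioc_eq_integral_Ioo]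
  refine setIntegral_mono_set ?_ (ae_of_all _ fun r => abs_nonneg _) ?_
  · exact (hc.abs.integrableOn_Icc (a := -a) (b := a)).mono_set Ioc_subset_Icc_self
  · exact (Ioc_subset_Ioc (le_min hs.1 ht.1) (max_le hs.2 ht.2)).eventuallyLE

/-- Average `f t ≤ f s + ∫ |f'|` over `s`. On a bounded interval there is no decay, and the mean
takes its place. -/
theorem le_average_add_setIntegral {f f' : ℝ → ℝ} (hd : ∀ t, HasDerivAt f (f' t) t)
    (hc : Continuous f') {a t : ℝ} (ha : 0 < a) (ht : t ∈ Icc (-a) a) :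
    f t ≤ (2 * a)⁻¹ * (∫ r in Ioo (-a) a, f r) + ∫ r in Ioo (-a) a, |f' r| := by
  have hf : Continuous f := continuous_iff_continuousAt.2 fun t => (hd t).continuousAt
  have hvol : volume.real (Ioo (-a) a) = 2 * a := by
    rw [Real.volume_real_Ioo_of_le (by linarith)]; ring
  have hfin : IntegrableOn (fun _ : ℝ => ∫ r in Ioo (-a) a, |f' r|) (Ioo (-a) a) :=
    integrableOn_const (by simp)
  have hfi : IntegrableOn f (Ioo (-a) a) :=
    (hf.integrableOn_Icc (a := -a) (b := a)).mono_set Ioo_subset_Icc_self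
  have key : ∫ _ in Ioo (-a) a, f t ≤ ∫ s in Ioo (-a) a, (f s + ∫ r in Ioo (-a) a, |f' r|) := by
    refine setIntegral_mono_on (integrableOn_const (by simp)) (hfi.add hfin) measurableSet_Ioo
      fun s hs => ?_
    have := (le_abs_self _).trans (abs_sub_le_setIntegral hd hc (Ioo_subset_Icc_self hs) ht)
    linarith
  rw [integral_add hfi hfin, setIntegral_const, setIntegral_const, hvol, smul_eq_mul,
    smul_eq_mul] at key
  rw [← mul_le_mul_iff_right₀ (by positivity : 0 < 2 * a), mul_add, mul_inv_cancel_left₀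
    (by positivity)]
  exact key

theorem measurableSet_square (a : ℝ) : MeasurableSet (square a) :=
  measurableSet_Ioo.prod measurableSet_Ioo

theorem integrableOn_square {F : ℝ × ℝ → ℝ} (hF : Continuous F) (a : ℝ) :
    IntegrableOn F (square a) :=
  (hF.continuousOn.integrableOn_compact (isCompact_Icc.prod isCompact_Icc)).mono_set
    (prod_mono (Ioo_subset_Icc_self (a := -a) (b := a)) (Ioo_subset_Icc_self (a := -a) (b := a)))

theorem setIntegral_square {F : ℝ × ℝ → ℝ} (hF : Continuous F) (a : ℝ) :
    ∫ p in square a, F p = ∫ x in Ioo (-a) a, ∫ y in Ioo (-a) a, F (x, y) := by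
  have := integrableOn_square hF a
  rw [Measure.volume_eq_prod] at this ⊢
  exact setIntegral_prod F this

theorem integrableOn_slice {F : ℝ × ℝ → ℝ} (hF : Continuous F) (a : ℝ) :
    IntegrableOn (fun x => ∫ y in Ioo (-a) a, F (x, y)) (Ioo (-a) a) := by
  have h := integrableOn_square hF a
  rw [IntegrableOn, Measure.volume_eq_prod, square, ← Measure.prod_restrict] at h
  exact h.integral_prod_left

theorem setIntegral_graph_le {F : ℝ × ℝ → ℝ} (hF : ContDiff ℝ ∞ F) {γ : ℝ → ℝ}
    (hγ : Continuous γ) {a : ℝ} (ha : 0 < a) (hγa : ∀ x, |x| < a → |γ x| ≤ a) :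
    ∫ x in Ioo (-a) a, F (x, γ x) ≤
      (2 * a)⁻¹ * (∫ p in square a, F p) + ∫ p in square a, |fderiv ℝ F p ey| := by
  have hdc : Continuous fun p => |fderiv ℝ F p ey| := (contDiff_fderiv_apply hF ey).continuous.abs
  rw [setIntegral_square hF.continuous, setIntegral_square hdc, ← integral_const_mul,
    ← integral_add ((integrableOn_slice hF.continuous a).const_mul _) (integrableOn_slice hdc a)]
  have hi : IntegrableOn (fun x => F (x, γ x)) (Ioo (-a) a) :=
    ((hF.continuous.comp (continuous_id.prodMk hγ)).integrableOn_Icc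
      (a := -a) (b := a)).mono_set Ioo_subset_Icc_self
  refine setIntegral_mono_on hi (((integrableOn_slice hF.continuous a).const_mul _).add
    (integrableOn_slice hdc a)) measurableSet_Ioo fun x hx => ?_
  have hd : ∀ y, HasDerivAt (fun y => F (x, y)) (fderiv ℝ F (x, y) ey) y := fun y => by
    have := hasDerivAt_line (hF.differentiable (by simp)) (x, 0) ey y
    simpa [ey] using this
  exact le_average_add_setIntegral hd ((contDiff_fderiv_apply hF ey).continuous.comp
    (continuous_const.prodMk continuous_id)) ha (abs_le.1 (hγa x (abs_lt.2 hx)))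

end LeakyWire

end

noncomputable section

namespace LeakyWire

/-! ### Magnetic bounds for restrictions to curves -/

theorem contDiff_norm_sq_test (φ : testSpace) : ContDiff ℝ ∞ fun p => ‖(φ : ℝ × ℝ → ℂ) p‖ ^ 2 :=
  (testSpace_contDiff φ).norm_sq ℝ

theorem hasCompactSupport_norm_sq_test (φ : testSpace) :
    HasCompactSupport fun p => ‖(φ : ℝ × ℝ → ℂ) p‖ ^ 2 :=
  (testSpace_hasCompactSupport φ).comp_left (g := fun z : ℂ => ‖z‖ ^ 2) (by simp)

theorem integrable_abs_fderiv_norm_sq (φ : testSpace) (v : ℝ × ℝ) :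
    Integrable fun p => |fderiv ℝ (fun q => ‖(φ : ℝ × ℝ → ℂ) q‖ ^ 2) p v| :=
  ((contDiff_fderiv_apply (contDiff_norm_sq_test φ) v).continuous.integrable_of_hasCompactSupport
    (hasCompactSupport_fderiv_apply (hasCompactSupport_norm_sq_test φ) v)).abs

/-- The vertical slice bound for `|φ|²`, combined with the diamagnetic bound on its derivative and
Young's inequality. The free `κ` lets the trace take an arbitrarily small share of the energy. -/
theorem IsMultiplier.integral_graph_le {m : ℝ × ℝ → ℝ} (hm : IsMultiplier m) {γ : ℝ → ℝ}
    (hγ : Continuous γ) {κ : ℝ} (hκ : 0 < κ) (φ : testSpace) :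
    ∫ x, ‖(φ : ℝ × ℝ → ℂ) (x, γ x)‖ ^ 2 ≤
      κ * (∫ p, ‖(φ : ℝ × ℝ → ℂ) p‖ ^ 2) + (4 * κ)⁻¹ * ∫ p, ‖covD m ey φ p‖ ^ 2 := by
  refine (LeakyWire.integral_graph_le (contDiff_norm_sq_test φ)
    (hasCompactSupport_norm_sq_test φ) hγ).trans ?_
  rw [← integral_div, ← integral_const_mul, ← integral_const_mul, ← integral_add
    ((integrable_test_sq φ).const_mul _) ((hm.integrable_covD_sq ey φ).const_mul _)]
  refine integral_mono ((integrable_abs_fderiv_norm_sq φ ey).div_const 2)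
    (((integrable_test_sq φ).const_mul _).add ((hm.integrable_covD_sq ey φ).const_mul _))
    fun p => ?_
  have h := abs_fderiv_norm_sq_le m (testSpace_differentiable φ p) ey
  have h2 : 0 ≤ (κ * ‖(φ : ℝ × ℝ → ℂ) p‖ - ‖covD m ey φ p‖ / 2) ^ 2 / κ := by positivity
  have h3 : (κ * ‖(φ : ℝ × ℝ → ℂ) p‖ - ‖covD m ey φ p‖ / 2) ^ 2 / κ =
      κ * ‖(φ : ℝ × ℝ → ℂ) p‖ ^ 2 + (4 * κ)⁻¹ * ‖covD m ey φ p‖ ^ 2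
      - ‖(φ : ℝ × ℝ → ℂ) p‖ * ‖covD m ey φ p‖ := by
    field_simp; ring
  simp only
  linarith

variable {A : ℝ × ℝ → ℝ × ℝ}

theorem integrable_magSq (h₁ : IsMultiplier fun p => (A p).1) (h₂ : IsMultiplier fun p => (A p).2)
    (φ : testSpace) : Integrable (magSq A φ) :=
  (h₁.integrable_covD_sq ex φ).add (h₂.integrable_covD_sq ey φ)

/-- The transverse ground state bound for the straight wire, with its sharp constant. The factor `α
/ √2` is the coupling per unit of `c`, because a diagonal point is `(c / 2, c / 2)` and has arc
length element `dc / √2`. -/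
theorem setIntegral_diagonal_le_magSq (h₁ : IsMultiplier fun p => (A p).1)
    (h₂ : IsMultiplier fun p => (A p).2) {α : ℝ} (hα : 0 ≤ α) (S : Set ℝ) (φ : testSpace) :
    α / √2 * ∫ c in S, ‖(φ : ℝ × ℝ → ℂ) (c / 2, c / 2)‖ ^ 2 ≤
      (∫ p in {p : ℝ × ℝ | p.1 + p.2 ∈ S}, magSq A φ p) +
        α ^ 2 / 4 * ∫ p in {p : ℝ × ℝ | p.1 + p.2 ∈ S}, ‖(φ : ℝ × ℝ → ℂ) p‖ ^ 2 := by
  have hle := setIntegral_diagonal_le (contDiff_norm_sq_test φ)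
    (hasCompactSupport_norm_sq_test φ) S
  refine (mul_le_mul_of_nonneg_left hle (by positivity)).trans ?_
  have hdi : Integrable fun p => |fderiv ℝ (fun q => ‖(φ : ℝ × ℝ → ℂ) q‖ ^ 2) p ex -
      fderiv ℝ (fun q => ‖(φ : ℝ × ℝ → ℂ) q‖ ^ 2) p ey| :=
    (((contDiff_fderiv_apply (contDiff_norm_sq_test φ)
      ex).continuous.integrable_of_hasCompactSupport
      (hasCompactSupport_fderiv_apply (hasCompactSupport_norm_sq_test φ) ex)).sub
      ((contDiff_fderiv_apply (contDiff_norm_sq_test φ)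
      ey).continuous.integrable_of_hasCompactSupport
      (hasCompactSupport_fderiv_apply (hasCompactSupport_norm_sq_test φ) ey))).abs
  have hm := integrable_magSq h₁ h₂ φ
  rw [← integral_div, ← integral_const_mul, ← integral_const_mul, ← integral_add hm.integrableOn
    ((integrable_test_sq φ).const_mul _).integrableOn]
  refine setIntegral_mono ((hdi.div_const 2).const_mul _).integrableOn
    (hm.add ((integrable_test_sq φ).const_mul _)).integrableOn fun p => ?_
  have hx := abs_fderiv_norm_sq_le (fun q => (A q).1) (testSpace_differentiable φ p) ex
  have hy := abs_fderiv_norm_sq_le (fun q => (A q).2) (testSpace_differentiable φ p) ey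
  have hxy := abs_sub (fderiv ℝ (fun q => ‖(φ : ℝ × ℝ → ℂ) q‖ ^ 2) p ex)
    (fderiv ℝ (fun q => ‖(φ : ℝ × ℝ → ℂ) q‖ ^ 2) p ey)
  simp only [magSq]
  generalize ‖covD (fun q => (A q).1) ex φ p‖ = d at *
  generalize ‖covD (fun q => (A q).2) ey φ p‖ = e at *
  generalize ‖(φ : ℝ × ℝ → ℂ) p‖ = f at *
  calc α / √2 * (_ / 2) ≤ α / √2 * ((2 * (f * d) + 2 * (f * e)) / 2) := by gcongr; linarith
    _ ≤ d ^ 2 + e ^ 2 + α ^ 2 / 4 * f ^ 2 := by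
      have h2 : (√2) ^ 2 = 2 := Real.sq_sqrt (by norm_num)
      have hk : (α / √2) ^ 2 = α ^ 2 / 2 := by rw [div_pow, h2]
      -- The two squares leave `2 (α / (2√2))² f² = α² / 4 · f²`.
      nlinarith [sq_nonneg (d - α / √2 * f / 2), sq_nonneg (e - α / √2 * f / 2)]

theorem setIntegral_graph_le_magSq (h₁ : IsMultiplier fun p => (A p).1)
    (h₂ : IsMultiplier fun p => (A p).2) {γ : ℝ → ℝ} (hγ : Continuous γ) {a : ℝ} (ha : 0 < a)
    (hγa : ∀ x, |x| < a → |γ x| ≤ a) (φ : testSpace) :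
    ∫ x in Ioo (-a) a, ‖(φ : ℝ × ℝ → ℂ) (x, γ x)‖ ^ 2 ≤
      ((2 * a)⁻¹ + 1) * (∫ p in square a, ‖(φ : ℝ × ℝ → ℂ) p‖ ^ 2) +
        ∫ p in square a, magSq A φ p := by
  refine (setIntegral_graph_le (contDiff_norm_sq_test φ) hγ ha hγa).trans ?_
  have hm := integrable_magSq h₁ h₂ φ
  have : ∫ p in square a, |fderiv ℝ (fun q => ‖(φ : ℝ × ℝ → ℂ) q‖ ^ 2) p ey| ≤
      ∫ p in square a, (‖(φ : ℝ × ℝ → ℂ) p‖ ^ 2 + magSq A φ p) := by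
    refine setIntegral_mono (integrable_abs_fderiv_norm_sq φ ey).integrableOn
      ((integrable_test_sq φ).add hm).integrableOn fun p => ?_
    have hy := abs_fderiv_norm_sq_le (fun q => (A q).2) (testSpace_differentiable φ p) ey
    simp only [magSq]
    nlinarith [sq_nonneg (‖(φ : ℝ × ℝ → ℂ) p‖ - ‖covD (fun q => (A q).2) ey φ p‖),
      sq_nonneg ‖covD (fun q => (A q).1) ex φ p‖]
  rw [integral_add (integrable_test_sq φ).integrableOn hm.integrableOn] at this
  linarith

/-! ### The arc length measure and the trace operator -/

theorem measurable_arcDensity (γ : ℝ → ℝ) :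
    Measurable fun x => ENNReal.ofReal √(1 + deriv γ x ^ 2) :=
  (((measurable_deriv γ).pow_const 2).const_add 1).sqrt.ennreal_ofReal

theorem isFiniteMeasureOnCompacts_arcLength {γ : ℝ → ℝ} (hγ : Continuous γ) {W : ℝ}
    (hW : ∀ᵐ x, √(1 + deriv γ x ^ 2) ≤ W) : IsFiniteMeasureOnCompacts (arcLength γ) := by
  refine ⟨fun K hK => ?_⟩
  have hg : Measurable fun x => (x, γ x) := measurable_id.prodMk hγ.measurable
  have hpre : IsCompact ((fun x => (x, γ x)) ⁻¹' K) :=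
    (isClosedEmbedding_graph hγ).isCompact_preimage hK
  rw [arcLength, Measure.map_apply hg hK.measurableSet,
    withDensity_apply _ (hg hK.measurableSet)]
  calc _ ≤ ∫⁻ _ in (fun x => (x, γ x)) ⁻¹' K, ENNReal.ofReal W :=
        lintegral_mono_ae ((ae_restrict_of_ae hW).mono fun x hx => ENNReal.ofReal_le_ofReal hx)
    _ < ⊤ := by
        rw [setLIntegral_const]
        exact ENNReal.mul_lt_top ENNReal.ofReal_lt_top hpre.measure_lt_top

theorem integral_arcLength {γ : ℝ → ℝ} (hγ : Continuous γ) {F : ℝ × ℝ → ℝ} (hF : Continuous F) :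
    ∫ p, F p ∂(arcLength γ) = ∫ x, √(1 + deriv γ x ^ 2) * F (x, γ x) := by
  have hg : Measurable fun x => (x, γ x) := measurable_id.prodMk hγ.measurable
  rw [arcLength, integral_map hg.aemeasurable hF.aestronglyMeasurable,
    integral_withDensity_eq_integral_toReal_smul (measurable_arcDensity γ)
      (ae_of_all _ fun _ => ENNReal.ofReal_lt_top)]
  simp [ENNReal.toReal_ofReal (Real.sqrt_nonneg _)]

theorem norm_sq_testToLp_arcLength {γ : ℝ → ℝ} (hγ : Continuous γ)
    [IsFiniteMeasureOnCompacts (arcLength γ)] (φ : testSpace) :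
    ‖testToLp (arcLength γ) φ‖ ^ 2 =
      ∫ x, √(1 + deriv γ x ^ 2) * ‖(φ : ℝ × ℝ → ℂ) (x, γ x)‖ ^ 2 := by
  rw [Lp_norm_sq_of_ae (coeFn_testToLp _ φ)]
  exact integral_arcLength hγ (contDiff_norm_sq_test φ).continuous

theorem integrable_graph_test {γ : ℝ → ℝ} (hγ : Continuous γ) (φ : testSpace) :
    Integrable fun x => ‖(φ : ℝ × ℝ → ℂ) (x, γ x)‖ ^ 2 :=
  integrable_graph (contDiff_norm_sq_test φ).continuous (hasCompactSupport_norm_sq_test φ) hγ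

theorem integrable_arc_test {γ : ℝ → ℝ} (hγ : Continuous γ) {W : ℝ}
    (hW : ∀ᵐ x, √(1 + deriv γ x ^ 2) ≤ W) (φ : testSpace) :
    Integrable fun x => √(1 + deriv γ x ^ 2) * ‖(φ : ℝ × ℝ → ℂ) (x, γ x)‖ ^ 2 := by
  refine (integrable_graph_test hγ φ).bdd_mul (c := W)
    (((measurable_deriv γ).pow_const 2).const_add 1).sqrt.aestronglyMeasurable ?_
  filter_upwards [hW] with x hx
  rwa [Real.norm_of_nonneg (Real.sqrt_nonneg _)]

theorem norm_sq_testToLp_arcLength_le {γ : ℝ → ℝ} (hγ : Continuous γ)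
    [IsFiniteMeasureOnCompacts (arcLength γ)] {W : ℝ} (hW : ∀ᵐ x, √(1 + deriv γ x ^ 2) ≤ W)
    {m : ℝ × ℝ → ℝ} (hm : IsMultiplier m) {κ : ℝ} (hκ : 0 < κ) (φ : testSpace) :
    ‖testToLp (arcLength γ) φ‖ ^ 2 ≤ W * (κ * (∫ p, ‖(φ : ℝ × ℝ → ℂ) p‖ ^ 2) +
      (4 * κ)⁻¹ * ∫ p, ‖covD m ey φ p‖ ^ 2) := by
  have hW0 : 0 ≤ W := by
    obtain ⟨x, hx⟩ := hW.exists
    exact (Real.sqrt_nonneg _).trans hx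
  rw [norm_sq_testToLp_arcLength hγ]
  calc _ ≤ ∫ x, W * ‖(φ : ℝ × ℝ → ℂ) (x, γ x)‖ ^ 2 := by
        refine integral_mono_ae (integrable_arc_test hγ hW φ)
          ((integrable_graph_test hγ φ).const_mul W) ?_
        filter_upwards [hW] with x hx
        gcongr
    _ ≤ _ := by
        rw [integral_const_mul]
        exact mul_le_mul_of_nonneg_left (hm.integral_graph_le hγ hκ φ) hW0

theorem isMultiplier_zero : IsMultiplier fun _ => 0 := fun ψ _ => by
  simp

/-- The bound that lets the restriction of test functions extend to `H¹`. It is the magnetic trace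
bound with zero potential and `κ = 1`. -/
theorem exists_norm_testToLp_le {γ : ℝ → ℝ} (hγ : Continuous γ)
    [IsFiniteMeasureOnCompacts (arcLength γ)] {W : ℝ} (hW : ∀ᵐ x, √(1 + deriv γ x ^ 2) ≤ W) :
    ∃ C, ∀ φ : testSpace, ‖testToLp (arcLength γ) φ‖ ≤ C * ‖testToSobolev φ‖ := by
  have hW0 : 0 ≤ W := by
    obtain ⟨x, hx⟩ := hW.exists
    exact (Real.sqrt_nonneg _).trans hx
  refine ⟨√W, fun φ => ?_⟩
  have h := norm_sq_testToLp_arcLength_le hγ hW isMultiplier_zero one_pos φ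
  refine abs_le_of_sq_le_sq' ?_ (by positivity) |>.2
  rw [mul_pow, Real.sq_sqrt hW0, sobolev_norm_sq_test]
  refine h.trans (mul_le_mul_of_nonneg_left ?_ hW0)
  have e : ∀ p, ‖covD (fun _ => 0) ey φ p‖ ^ 2 = ‖fderiv ℝ (φ : ℝ × ℝ → ℂ) p ey‖ ^ 2 := fun p => by
    simp [covD]
  simp only [e]
  have i1 : 0 ≤ ∫ p, ‖fderiv ℝ (φ : ℝ × ℝ → ℂ) p ex‖ ^ 2 := integral_nonneg fun p => by positivity
  have i2 : 0 ≤ ∫ p, ‖fderiv ℝ (φ : ℝ × ℝ → ℂ) p ey‖ ^ 2 := integral_nonneg fun p => by positivity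
  linarith

/-- The trace on the graph of `γ`, as a bounded operator on `H¹(ℝ²)`. -/
def traceOp (γ : ℝ → ℝ) [IsFiniteMeasureOnCompacts (arcLength γ)] :
    sobolev →L[ℂ] Lp ℂ 2 (arcLength γ) :=
  (testToLp (arcLength γ)).extendOfNorm testToSobolev

theorem traceOp_test {γ : ℝ → ℝ} (hγ : Continuous γ) [IsFiniteMeasureOnCompacts (arcLength γ)]
    {W : ℝ} (hW : ∀ᵐ x, √(1 + deriv γ x ^ 2) ≤ W) (φ : testSpace) :
    traceOp γ (testToSobolev φ) = testToLp (arcLength γ) φ :=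
  LinearMap.extendOfNorm_eq denseRange_testToSobolev (exists_norm_testToLp_le hγ hW) φ

/-- Any sequence admitted by `IsTrace` converges in `sobolev`, so continuity of `traceOp` forces the
limit. Density of the test functions supplies such a sequence. Hence the arbitrary choice in `trace`
is harmless. -/
theorem isTrace_iff {γ : ℝ → ℝ} (hγ : Continuous γ) [IsFiniteMeasureOnCompacts (arcLength γ)]
    {W : ℝ} (hW : ∀ᵐ x, √(1 + deriv γ x ^ 2) ≤ W) (u : sobolev) (τ : Lp ℂ 2 (arcLength γ)) :
    IsTrace γ (coord 0 u) τ ↔ τ = traceOp γ u := by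
  constructor
  · rintro ⟨φ, hφ, h0, h1, h2, h3⟩
    let χ : ℕ → testSpace := fun n => ⟨φ n, hφ n⟩
    rw [weakDeriv_ex_coord] at h1
    rw [weakDeriv_ey_coord] at h2
    have hs := (tendsto_testToSobolev_iff χ u).2 ⟨h0, h1, h2⟩
    have ht := (tendsto_testToLp_iff (arcLength γ) χ τ).2 h3
    have ht' := ((traceOp γ).continuous.tendsto u).comp hs
    simp only [Function.comp_def, traceOp_test hγ hW] at ht'
    exact tendsto_nhds_unique ht ht'
  · rintro rfl
    obtain ⟨w, hw, hlim⟩ := mem_closure_iff_seq_limit.1 (denseRange_testToSobolev u)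
    choose χ hχ using hw
    obtain rfl : w = fun n => testToSobolev (χ n) := (funext hχ).symm
    have hs := (tendsto_testToSobolev_iff χ u).1 hlim
    refine ⟨fun n => χ n, fun n => (χ n).2, hs.1, ?_, ?_, ?_⟩
    · rw [weakDeriv_ex_coord]; exact hs.2.1
    · rw [weakDeriv_ey_coord]; exact hs.2.2
    · have ht' := ((traceOp γ).continuous.tendsto u).comp hlim
      refine (tendsto_testToLp_iff (arcLength γ) χ _).1 ?_
      simpa only [Function.comp_def, traceOp_test hγ hW] using ht'

theorem trace_coord {γ : ℝ → ℝ} (hγ : Continuous γ) [IsFiniteMeasureOnCompacts (arcLength γ)]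
    {W : ℝ} (hW : ∀ᵐ x, √(1 + deriv γ x ^ 2) ≤ W) (u : sobolev) :
    trace γ (coord 0 u) = traceOp γ u := by
  have hex : ∃ τ, IsTrace γ (coord 0 u) τ := ⟨_, (isTrace_iff hγ hW u _).2 rfl⟩
  rw [trace, dif_pos hex]
  exact (isTrace_iff hγ hW u _).1 hex.choose_spec

end LeakyWire

end

noncomputable section

namespace LeakyWire

/-! ### The Poincaré inequality on the square -/

theorem sq_setIntegral_abs_le {f : ℝ → ℝ} (hf : Continuous f) {a : ℝ} (ha : 0 < a) :
    (∫ r in Ioo (-a) a, |f r|) ^ 2 ≤ 2 * a * ∫ r in Ioo (-a) a, f r ^ 2 := by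
  have hvol : volume.real (Ioo (-a) a) = 2 * a := by
    rw [Real.volume_real_Ioo_of_le (by linarith)]; ring
  have hint : ∀ {g : ℝ → ℝ}, Continuous g → IntegrableOn g (Ioo (-a) a) := fun hg =>
    (hg.integrableOn_Icc (a := -a) (b := a)).mono_set Ioo_subset_Icc_self
  set I := ∫ r in Ioo (-a) a, |f r| with hI
  set c := I / (2 * a) with hc
  -- Cauchy–Schwarz as nonnegativity of the variance: `c` is the mean of `|f|`.
  have h0 : 0 ≤ ∫ r in Ioo (-a) a, (|f r| - c) ^ 2 := integral_nonneg fun r => sq_nonneg _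
  have e : ∫ r in Ioo (-a) a, (|f r| - c) ^ 2 =
      (∫ r in Ioo (-a) a, f r ^ 2) - 2 * c * I + c ^ 2 * (2 * a) := by
    have e1 : ∀ r, (|f r| - c) ^ 2 = f r ^ 2 - 2 * c * |f r| + c ^ 2 := fun r => by
      rw [sub_sq, sq_abs]; ring
    simp only [e1]
    rw [integral_add (hint (by fun_prop)) (hint (by fun_prop)),
      integral_sub (hint (by fun_prop)) (hint (by fun_prop)), integral_const_mul,
      setIntegral_const, hvol, smul_eq_mul]
    ring
  rw [e] at h0
  have hcI : c * (2 * a) = I := by rw [hc]; field_simp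
  nlinarith

theorem sq_sub_le_setIntegral {f f' : ℝ → ℝ} (hd : ∀ t, HasDerivAt f (f' t) t)
    (hc : Continuous f') {a s t : ℝ} (ha : 0 < a) (hs : s ∈ Icc (-a) a) (ht : t ∈ Icc (-a) a) :
    (f t - f s) ^ 2 ≤ 2 * a * ∫ r in Ioo (-a) a, f' r ^ 2 := by
  refine le_trans ?_ (sq_setIntegral_abs_le hc ha)
  rw [← sq_abs]
  exact pow_le_pow_left₀ (abs_nonneg _) (abs_sub_le_setIntegral hd hc hs ht) 2

theorem volume_real_square {a : ℝ} (ha : 0 < a) : volume.real (square a) = (2 * a) ^ 2 := by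
  rw [Measure.volume_eq_prod, square, measureReal_prod_prod,
    Real.volume_real_Ioo_of_le (by linarith)]
  ring

/-- The constant is the value of `w` at a point of a well-chosen horizontal line. Any point of the
square is reached from it by moving along that line and then vertically. The line must have no more
than average energy, since it is used for every `x`. -/
theorem exists_setIntegral_sub_sq_le {w : ℝ × ℝ → ℝ} (hw : ContDiff ℝ ∞ w) {a : ℝ} (ha : 0 < a) :
    ∃ c : ℝ, ∫ p in square a, (w p - c) ^ 2 ≤
      8 * a ^ 2 * ∫ p in square a, ((fderiv ℝ w p ex) ^ 2 + (fderiv ℝ w p ey) ^ 2) := by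
  have hvol : volume.real (Ioo (-a) a) = 2 * a := by
    rw [Real.volume_real_Ioo_of_le (by linarith)]; ring
  have hcx : Continuous fun p => fderiv ℝ w p ex := (contDiff_fderiv_apply hw ex).continuous
  have hcy : Continuous fun p => fderiv ℝ w p ey := (contDiff_fderiv_apply hw ey).continuous
  have hcx2 : Continuous fun p => (fderiv ℝ w p ex) ^ 2 := hcx.pow 2
  have hcy2 : Continuous fun p => (fderiv ℝ w p ey) ^ 2 := hcy.pow 2
  have hdx : ∀ x y, HasDerivAt (fun x => w (x, y)) (fderiv ℝ w (x, y) ex) x := fun x y => by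
    simpa [ex] using hasDerivAt_line (hw.differentiable (by simp)) (0, y) ex x
  have hdy : ∀ x y, HasDerivAt (fun y => w (x, y)) (fderiv ℝ w (x, y) ey) y := fun x y => by
    simpa [ey] using hasDerivAt_line (hw.differentiable (by simp)) (x, 0) ey y
  -- a horizontal line on which the energy is at most its average
  have hswap : Continuous fun q : ℝ × ℝ => (fderiv ℝ w (q.2, q.1) ex) ^ 2 :=
    (hcx.comp (continuous_snd.prodMk continuous_fst)).pow 2
  obtain ⟨y₀, hy₀, hle⟩ := exists_le_setAverage (by simp [ha]) (by simp)
    (integrableOn_slice hswap a)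
  have hfub : ∫ y in Ioo (-a) a, ∫ x in Ioo (-a) a, (fderiv ℝ w (x, y) ex) ^ 2 =
      ∫ p in square a, (fderiv ℝ w p ex) ^ 2 := by
    rw [setIntegral_square hcx2]
    have h := integrableOn_square hcx2 a
    rw [IntegrableOn, Measure.volume_eq_prod, square, ← Measure.prod_restrict] at h
    exact (integral_integral_swap h).symm
  simp only [setAverage_eq, hvol, smul_eq_mul] at hle
  rw [hfub] at hle
  set g := ∫ x in Ioo (-a) a, (fderiv ℝ w (x, y₀) ex) ^ 2 with hg
  have hg2 : 2 * a * g ≤ ∫ p in square a, (fderiv ℝ w p ex) ^ 2 := by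
    have := mul_le_mul_of_nonneg_left hle (by positivity : 0 ≤ 2 * a)
    rwa [mul_inv_cancel_left₀ (by positivity)] at this
  refine ⟨w (0, y₀), ?_⟩
  have hpt : ∀ x ∈ Ioo (-a) a, ∀ y ∈ Ioo (-a) a, (w (x, y) - w (0, y₀)) ^ 2 ≤
      4 * a * (∫ t in Ioo (-a) a, (fderiv ℝ w (x, t) ey) ^ 2) + 4 * a * g := by
    intro x hx y hy
    have h1 := sq_sub_le_setIntegral (hdy x) (hcy.comp (continuous_const.prodMk continuous_id)) ha
      (Ioo_subset_Icc_self hy₀) (Ioo_subset_Icc_self hy)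
    have h2 := sq_sub_le_setIntegral (fun x => hdx x y₀)
      (hcx.comp (continuous_id.prodMk continuous_const)) ha
      (s := 0) (by constructor <;> linarith) (Ioo_subset_Icc_self hx)
    rw [← hg] at h2
    nlinarith [sq_nonneg (w (x, y) - w (x, y₀) - (w (x, y₀) - w (0, y₀)))]
  rw [integral_add (integrableOn_square hcx2 a) (integrableOn_square hcy2 a),
    setIntegral_square (F := fun p => (w p - w (0, y₀)) ^ 2) ((hw.continuous.sub continuous_const).pow 2)]
  have hslice := integrableOn_slice hcy2 a
  have hconst : IntegrableOn (fun _ : ℝ => 2 * a * (4 * a * g)) (Ioo (-a) a) :=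
    integrableOn_const (by simp)
  calc _ ≤ ∫ x in Ioo (-a) a, (8 * a ^ 2 * (∫ t in Ioo (-a) a, (fderiv ℝ w (x, t) ey) ^ 2)
        + 2 * a * (4 * a * g)) := by
        refine setIntegral_mono_on
          (integrableOn_slice (F := fun p => (w p - w (0, y₀)) ^ 2)
            ((hw.continuous.sub continuous_const).pow 2) a)
          ((hslice.const_mul _).add hconst) measurableSet_Ioo fun x hx => ?_
        have hwx : Continuous fun y => (w (x, y) - w (0, y₀)) ^ 2 :=
          ((hw.continuous.comp (continuous_const.prodMk continuous_id)).sub continuous_const).pow 2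
        refine (setIntegral_mono_on ((hwx.integrableOn_Icc (a := -a) (b := a)).mono_set
          Ioo_subset_Icc_self) (integrableOn_const (by simp)) measurableSet_Ioo (hpt x hx)).trans ?_
        rw [setIntegral_const, hvol, smul_eq_mul]
        exact le_of_eq (by ring)
    _ = 8 * a ^ 2 * (∫ p in square a, (fderiv ℝ w p ey) ^ 2) + 8 * a ^ 2 * (2 * a * g) := by
        rw [integral_add (hslice.const_mul _) hconst, integral_const_mul, setIntegral_const, hvol,
          setIntegral_square hcy2, smul_eq_mul]
        ring
    _ ≤ _ := by
        rw [mul_add, add_comm]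
        gcongr

/-! ### Local bounds for multipliers -/

theorem eq_zero_of_notMem_square {η : ℝ × ℝ → ℝ} {a : ℝ} (h : tsupport η ⊆ square a)
    {p : ℝ × ℝ} (hp : p ∉ square a) : η p = 0 :=
  image_eq_zero_of_notMem_tsupport fun h' => hp (h h')

theorem tsupport_fderiv_apply_subset {η : ℝ × ℝ → ℝ} (v : ℝ × ℝ) :
    tsupport (fun p => fderiv ℝ η p v) ⊆ tsupport η :=
  (closure_mono fun p hp => by
    contrapose! hp
    simp only [Function.mem_support, not_not] at hp ⊢
    simp [hp]).trans (tsupport_fderiv_subset ℝ)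

theorem exists_abs_le_of_hasCompactSupport {η : ℝ × ℝ → ℝ} (h : Continuous η)
    (hc : HasCompactSupport η) : ∃ M, 0 ≤ M ∧ ∀ p, |η p| ≤ M := by
  obtain ⟨M, hM⟩ := h.bounded_above_of_compact_support hc
  exact ⟨M, (norm_nonneg _).trans (hM 0), hM⟩

theorem fderiv_mul_apply {f g : ℝ × ℝ → ℝ} {p : ℝ × ℝ} (hf : DifferentiableAt ℝ f p)
    (hg : DifferentiableAt ℝ g p) (v : ℝ × ℝ) :
    fderiv ℝ (fun p => f p * g p) p v = f p * fderiv ℝ g p v + g p * fderiv ℝ f p v := by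
  have h : HasFDerivAt (fun p => f p * g p) _ p := hf.hasFDerivAt.mul hg.hasFDerivAt
  rw [h.fderiv]
  simp

theorem sq_fderiv_mul_le {η f : ℝ × ℝ → ℝ} {p : ℝ × ℝ} (hη : DifferentiableAt ℝ η p)
    (hf : DifferentiableAt ℝ f p) (v : ℝ × ℝ) {M : ℝ} (h0 : |η p| ≤ M)
    (h1 : |fderiv ℝ η p v| ≤ M) :
    (fderiv ℝ (fun p => η p * f p) p v) ^ 2 ≤
      2 * M ^ 2 * (f p ^ 2 + (fderiv ℝ f p v) ^ 2) := by
  rw [fderiv_mul_apply hη hf]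
  have i0 : η p ^ 2 ≤ M ^ 2 := sq_le_sq' (abs_le.1 h0).1 (abs_le.1 h0).2
  have i1 : (fderiv ℝ η p v) ^ 2 ≤ M ^ 2 := sq_le_sq' (abs_le.1 h1).1 (abs_le.1 h1).2
  have j0 := mul_le_mul_of_nonneg_right i0 (sq_nonneg (fderiv ℝ f p v))
  have j1 := mul_le_mul_of_nonneg_right i1 (sq_nonneg (f p))
  nlinarith [sq_nonneg (η p * fderiv ℝ f p v - f p * fderiv ℝ η p v)]

/-- The Sobolev energy of a smooth function on the square. -/
def squareEnergy (a : ℝ) (f : ℝ × ℝ → ℝ) : ℝ :=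
  ∫ p in square a, (f p ^ 2 + (fderiv ℝ f p ex) ^ 2 + (fderiv ℝ f p ey) ^ 2)

/-- Localising by `η` makes the multiplier bound available for smooth functions without compact
support, such as the regularised modulus and its shifts by constants. -/
theorem IsMultiplier.exists_local_bound {m : ℝ × ℝ → ℝ} (hm : IsMultiplier m) {a : ℝ}
    {η : ℝ × ℝ → ℝ} (hη : ContDiff ℝ ∞ η) (hc : HasCompactSupport η)
    (hs : tsupport η ⊆ square a) :
    ∃ C : ℝ, 0 ≤ C ∧ ∀ f : ℝ × ℝ → ℝ, ContDiff ℝ ∞ f →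
      Integrable (fun p => (m p * (η p * f p)) ^ 2) ∧
      ∫ p, (m p * (η p * f p)) ^ 2 ≤ C * squareEnergy a f := by
  obtain ⟨C, hC, hb⟩ := hm.exists_bound
  obtain ⟨M₀, hM₀, h₀⟩ := exists_abs_le_of_hasCompactSupport hη.continuous hc
  obtain ⟨M₁, hM₁, h₁⟩ := exists_abs_le_of_hasCompactSupport
    (contDiff_fderiv_apply hη ex).continuous (hasCompactSupport_fderiv_apply hc ex)
  obtain ⟨M₂, hM₂, h₂⟩ := exists_abs_le_of_hasCompactSupport
    (contDiff_fderiv_apply hη ey).continuous (hasCompactSupport_fderiv_apply hc ey)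
  set M := M₀ + M₁ + M₂
  -- One `M²` comes from the function and `2 M²` from each of the two derivatives.
  refine ⟨C * (5 * M ^ 2), by positivity, fun f hf => ?_⟩
  have hsm : ContDiff ℝ ∞ fun p => η p * f p := hη.mul hf
  have hcs : HasCompactSupport fun p => η p * f p := hc.mul_right
  refine ⟨(hb _ hsm hcs).1, (hb _ hsm hcs).2.trans ?_⟩
  rw [mul_assoc]
  refine mul_le_mul_of_nonneg_left ?_ hC
  have hi : ∀ v, Integrable fun p => (fderiv ℝ (fun p => η p * f p) p v) ^ 2 := fun v =>
    integrable_sq_of_hasCompactSupport (contDiff_fderiv_apply hsm v).continuous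
      (hasCompactSupport_fderiv_apply hcs v)
  have hi0 := integrable_sq_of_hasCompactSupport hsm.continuous hcs
  have hi1 : Integrable fun p => (η p * f p) ^ 2 + (fderiv ℝ (fun p => η p * f p) p ex) ^ 2 :=
    hi0.add (hi ex)
  have hcont : Continuous fun p => f p ^ 2 + (fderiv ℝ f p ex) ^ 2 + (fderiv ℝ f p ey) ^ 2 :=
    ((hf.continuous.pow 2).add ((contDiff_fderiv_apply hf ex).continuous.pow 2)).add
      ((contDiff_fderiv_apply hf ey).continuous.pow 2)
  rw [squareEnergy, ← integral_add hi0 (hi ex), ← integral_add hi1 (hi ey),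
    ← integral_const_mul, ← setIntegral_eq_integral_of_forall_compl_eq_zero (s := square a)]
  · refine setIntegral_mono (hi1.add (hi ey)).integrableOn ((integrableOn_square hcont a).const_mul _) fun p => ?_
    have k0 : |η p| ≤ M := (h₀ p).trans (by simp only [M]; linarith)
    have dη := hη.differentiable (by simp) p
    have df := hf.differentiable (by simp) p
    have kx := sq_fderiv_mul_le dη df ex k0 ((h₁ p).trans (by simp only [M]; linarith))
    have ky := sq_fderiv_mul_le dη df ey k0 ((h₂ p).trans (by simp only [M]; linarith))
    have i0 : η p ^ 2 ≤ M ^ 2 := sq_le_sq' (abs_le.1 k0).1 (abs_le.1 k0).2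
    have j0 := mul_le_mul_of_nonneg_right i0 (sq_nonneg (f p))
    simp only
    nlinarith [mul_nonneg (sq_nonneg M) (sq_nonneg (fderiv ℝ f p ex)),
      mul_nonneg (sq_nonneg M) (sq_nonneg (fderiv ℝ f p ey))]
  · intro p hp
    have hsub : tsupport (fun p => η p * f p) ⊆ square a :=
      (closure_mono (Function.support_mul_subset_left _ _)).trans hs
    have z0 := eq_zero_of_notMem_square hsub hp
    have z1 := eq_zero_of_notMem_square ((tsupport_fderiv_apply_subset ex).trans hsub) hp
    have z2 := eq_zero_of_notMem_square ((tsupport_fderiv_apply_subset ey).trans hsub) hp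
    rw [z0, z1, z2]
    norm_num

end LeakyWire

end

noncomputable section

namespace LeakyWire

/-! ### The field tested against the modulus of a function -/

theorem mul_le_young {δ : ℝ} (hδ : 0 < δ) (P Q : ℝ) : 2 * |P * Q| ≤ δ * P ^ 2 + δ⁻¹ * Q ^ 2 := by
  have h : 0 ≤ δ⁻¹ * (δ * |P| - |Q|) ^ 2 := by positivity
  have e : δ⁻¹ * (δ * |P| - |Q|) ^ 2 = δ * P ^ 2 + δ⁻¹ * Q ^ 2 - 2 * |P * Q| := by
    rw [abs_mul, ← sq_abs P, ← sq_abs Q]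
    field_simp
    ring
  linarith

/-- Young's inequality pairs every occurrence of the potential with a factor that does not
oscillate. What is left with the weight `δ⁻¹` is the deviation `D = w - c` and the gradient of `w`.
-/
theorem abs_sub_le_young {δ : ℝ} (hδ : 0 < δ) (a₁ a₂ k cx cy W D wx wy : ℝ) :
    |a₁ * (cy * W * D + 2 * (k * wy)) - a₂ * (cx * W * D + 2 * (k * wx))| ≤
      δ * ((a₁ * k) ^ 2 + (a₂ * k) ^ 2 + (a₁ * (cy * W)) ^ 2 + (a₂ * (cx * W)) ^ 2) +
        δ⁻¹ * (D ^ 2 + wx ^ 2 + wy ^ 2) := by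
  have y₁ := mul_le_young hδ (a₁ * k) wy
  have y₂ := mul_le_young hδ (a₂ * k) wx
  have y₃ := mul_le_young hδ (a₁ * (cy * W)) D
  have y₄ := mul_le_young hδ (a₂ * (cx * W)) D
  have n₃ : 0 ≤ δ * (a₁ * (cy * W)) ^ 2 := by positivity
  have n₄ : 0 ≤ δ * (a₂ * (cx * W)) ^ 2 := by positivity
  have e : a₁ * (cy * W * D + 2 * (k * wy)) - a₂ * (cx * W * D + 2 * (k * wx)) =
      a₁ * (cy * W) * D + 2 * (a₁ * k * wy) - a₂ * (cx * W) * D - 2 * (a₂ * k * wx) := by ring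
  rw [e, abs_le]
  have l₁ := abs_le.1 (le_refl |a₁ * k * wy|)
  have l₂ := abs_le.1 (le_refl |a₂ * k * wx|)
  have l₃ := abs_le.1 (le_refl |a₁ * (cy * W) * D|)
  have l₄ := abs_le.1 (le_refl |a₂ * (cx * W) * D|)
  constructor <;> linarith [l₁.1, l₁.2, l₂.1, l₂.2, l₃.1, l₃.2, l₄.1, l₄.2]

theorem fderiv_mul_sq_sub_apply {χ w : ℝ × ℝ → ℝ} {p : ℝ × ℝ} (hχ : DifferentiableAt ℝ χ p)
    (hw : DifferentiableAt ℝ w p) (c : ℝ) (v : ℝ × ℝ) :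
    fderiv ℝ (fun p => χ p * (w p ^ 2 - c ^ 2)) p v =
      fderiv ℝ χ p v * (w p + c) * (w p - c) + 2 * (χ p * w p * fderiv ℝ w p v) := by
  have h1 : HasFDerivAt (fun p => w p ^ 2 - c ^ 2) _ p :=
    (hw.hasFDerivAt.pow 2).sub_const (c ^ 2)
  rw [fderiv_mul_apply hχ h1.differentiableAt, h1.fderiv]
  simp
  ring

theorem setIntegral_indicator_eq {a : ℝ} (f : ℝ × ℝ → ℝ) :
    ∫ p, (square a).indicator f p = ∫ p in square a, f p :=
  integral_indicator (measurableSet_square a)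

theorem IsVectorPotential.isMultiplier_fst {B : ℝ × ℝ → ℝ} {A : ℝ × ℝ → ℝ × ℝ}
    (h : IsVectorPotential B A) : IsMultiplier fun p => (A p).1 := h.memLp_fst

theorem IsVectorPotential.isMultiplier_snd {B : ℝ × ℝ → ℝ} {A : ℝ × ℝ → ℝ × ℝ}
    (h : IsVectorPotential B A) : IsMultiplier fun p => (A p).2 := h.memLp_snd

/-- The field tested against `w² - c²` is controlled by the oscillation of `w`. -/
theorem IsVectorPotential.exists_oscillation_bound {B : ℝ × ℝ → ℝ} {A : ℝ × ℝ → ℝ × ℝ}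
    (hA : IsVectorPotential B A) {a : ℝ} {χ : ℝ × ℝ → ℝ} (hχ : ContDiff ℝ ∞ χ)
    (hc : HasCompactSupport χ) (hs : tsupport χ ⊆ square a) :
    ∃ C : ℝ, 0 ≤ C ∧ ∀ w : ℝ × ℝ → ℝ, ContDiff ℝ ∞ w → ∀ c δ : ℝ, 0 < δ →
      |∫ p, B p * (χ p * (w p ^ 2 - c ^ 2))| ≤
        δ * (C * (squareEnergy a w + squareEnergy a fun p => w p + c)) +
        δ⁻¹ * ∫ p in square a, ((w p - c) ^ 2 + (fderiv ℝ w p ex) ^ 2 + (fderiv ℝ w p ey) ^ 2) := by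
  have hχx := contDiff_fderiv_apply hχ ex
  have hχy := contDiff_fderiv_apply hχ ey
  have hsx := (tsupport_fderiv_apply_subset (η := χ) ex).trans hs
  have hsy := (tsupport_fderiv_apply_subset (η := χ) ey).trans hs
  obtain ⟨C₁, hC₁, b₁⟩ := hA.isMultiplier_fst.exists_local_bound hχ hc hs
  obtain ⟨C₂, hC₂, b₂⟩ := hA.isMultiplier_snd.exists_local_bound hχ hc hs
  obtain ⟨C₃, hC₃, b₃⟩ := hA.isMultiplier_fst.exists_local_bound hχy
    (hasCompactSupport_fderiv_apply hc ey) hsy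
  obtain ⟨C₄, hC₄, b₄⟩ := hA.isMultiplier_snd.exists_local_bound hχx
    (hasCompactSupport_fderiv_apply hc ex) hsx
  refine ⟨C₁ + C₂ + C₃ + C₄, by positivity, fun w hw c δ hδ => ?_⟩
  have hwc : ContDiff ℝ ∞ fun p => w p + c := hw.add contDiff_const
  obtain ⟨i₁, j₁⟩ := b₁ w hw
  obtain ⟨i₂, j₂⟩ := b₂ w hw
  obtain ⟨i₃, j₃⟩ := b₃ _ hwc
  obtain ⟨i₄, j₄⟩ := b₄ _ hwc
  have hcont : Continuous fun p =>
      (w p - c) ^ 2 + (fderiv ℝ w p ex) ^ 2 + (fderiv ℝ w p ey) ^ 2 :=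
    (((hw.continuous.sub continuous_const).pow 2).add
      ((contDiff_fderiv_apply hw ex).continuous.pow 2)).add
      ((contDiff_fderiv_apply hw ey).continuous.pow 2)
  have i₅ : Integrable ((square a).indicator fun p =>
      (w p - c) ^ 2 + (fderiv ℝ w p ex) ^ 2 + (fderiv ℝ w p ey) ^ 2) :=
    (integrable_indicator_iff (measurableSet_square a)).2 (integrableOn_square hcont a)
  have hE₁ : 0 ≤ squareEnergy a w := integral_nonneg fun p => by positivity
  have hE₂ : 0 ≤ squareEnergy a fun p => w p + c := integral_nonneg fun p => by positivity
  -- The field is traded for its potential, because a merely integrable `B` cannot be paired with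
  -- `w² - c²` using energy bounds alone.
  rw [← hA.rot_eq _ (hχ.mul ((hw.pow 2).sub contDiff_const)) hc.mul_right]
  have hpt : ∀ p, ‖(A p).1 * fderiv ℝ (fun p => χ p * (w p ^ 2 - c ^ 2)) p ey -
      (A p).2 * fderiv ℝ (fun p => χ p * (w p ^ 2 - c ^ 2)) p ex‖ ≤
      δ * (((A p).1 * (χ p * w p)) ^ 2 + ((A p).2 * (χ p * w p)) ^ 2 +
        ((A p).1 * (fderiv ℝ χ p ey * (w p + c))) ^ 2 +
        ((A p).2 * (fderiv ℝ χ p ex * (w p + c))) ^ 2) +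
      δ⁻¹ * (square a).indicator (fun p =>
        (w p - c) ^ 2 + (fderiv ℝ w p ex) ^ 2 + (fderiv ℝ w p ey) ^ 2) p := by
    intro p
    have dχ := hχ.differentiable (by simp) p
    have dw := hw.differentiable (by simp) p
    rw [fderiv_mul_sq_sub_apply dχ dw, fderiv_mul_sq_sub_apply dχ dw, Real.norm_eq_abs]
    by_cases hp : p ∈ square a
    · rw [indicator_of_mem hp]
      exact abs_sub_le_young hδ _ _ _ _ _ _ _ _ _
    · have z0 := eq_zero_of_notMem_square hs hp
      have z1 := eq_zero_of_notMem_square hsx hp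
      have z2 := eq_zero_of_notMem_square hsy hp
      rw [indicator_of_notMem hp, z0, z1, z2]
      simp
  have i₆ : Integrable fun p => ((A p).1 * (χ p * w p)) ^ 2 + ((A p).2 * (χ p * w p)) ^ 2 :=
    i₁.add i₂
  have i₇ : Integrable fun p => ((A p).1 * (χ p * w p)) ^ 2 + ((A p).2 * (χ p * w p)) ^ 2 +
      ((A p).1 * (fderiv ℝ χ p ey * (w p + c))) ^ 2 := i₆.add i₃
  have i₈ : Integrable fun p => ((A p).1 * (χ p * w p)) ^ 2 + ((A p).2 * (χ p * w p)) ^ 2 +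
      ((A p).1 * (fderiv ℝ χ p ey * (w p + c))) ^ 2 +
      ((A p).2 * (fderiv ℝ χ p ex * (w p + c))) ^ 2 := i₇.add i₄
  refine (norm_integral_le_of_norm_le ((i₈.const_mul δ).add (i₅.const_mul δ⁻¹))
    (ae_of_all _ hpt)).trans ?_
  rw [integral_add' (i₈.const_mul δ) (i₅.const_mul δ⁻¹), integral_const_mul, integral_const_mul,
    integral_add i₇ i₄, integral_add i₆ i₃, integral_add i₁ i₂, setIntegral_indicator_eq]
  gcongr
  nlinarith [mul_nonneg hC₁ hE₂, mul_nonneg hC₂ hE₂, mul_nonneg hC₃ hE₁, mul_nonneg hC₄ hE₁]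

/-! ### The gauge invariant commutator identity -/

theorem fderiv_im_star_mul {φ ξ : ℝ × ℝ → ℂ} {p : ℝ × ℝ} (hφ : DifferentiableAt ℝ φ p)
    (hξ : DifferentiableAt ℝ ξ p) (v : ℝ × ℝ) :
    fderiv ℝ (fun p => (star (φ p) * ξ p).im) p v =
      (star (fderiv ℝ φ p v) * ξ p).im + (star (φ p) * fderiv ℝ ξ p v).im := by
  have h1 : HasFDerivAt (fun p => star (φ p)) _ p :=
    (starL' ℝ (A := ℂ)).toContinuousLinearMap.hasFDerivAt.comp p hφ.hasFDerivAt
  have h2 : HasFDerivAt (fun p => star (φ p) * ξ p) _ p := h1.mul hξ.hasFDerivAt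
  have h3 : HasFDerivAt (fun p => (star (φ p) * ξ p).im) _ p :=
    Complex.imCLM.hasFDerivAt.comp p h2
  rw [h3.fderiv]
  simp
  ring

theorem fderiv_fderiv_comm (φ : testSpace) (p : ℝ × ℝ) :
    fderiv ℝ (fun q => fderiv ℝ (φ : ℝ × ℝ → ℂ) q ex) p ey =
      fderiv ℝ (fun q => fderiv ℝ (φ : ℝ × ℝ → ℂ) q ey) p ex := by
  have hd : DifferentiableAt ℝ (fderiv ℝ (φ : ℝ × ℝ → ℂ)) p :=
    ((testSpace_contDiff φ).fderiv_right (m := ∞) (by simp)).differentiable (by simp) p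
  have hsymm : IsSymmSndFDerivAt ℝ (φ : ℝ × ℝ → ℂ) p :=
    (testSpace_contDiff φ).contDiffAt.isSymmSndFDerivAt
      (by
        rw [minSmoothness_of_isRCLikeNormedField]
        exact WithTop.coe_le_coe.2 (le_top : (2 : ℕ∞) ≤ ⊤))
  have e : ∀ v u, fderiv ℝ (fun q => fderiv ℝ (φ : ℝ × ℝ → ℂ) q v) p u =
      fderiv ℝ (fderiv ℝ (φ : ℝ × ℝ → ℂ)) p u v := fun v u => by
    have h : HasFDerivAt (fun q => fderiv ℝ (φ : ℝ × ℝ → ℂ) q v) _ p :=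
      hd.hasFDerivAt.clm_apply (hasFDerivAt_const v p)
    rw [h.fderiv]; simp
  rw [e, e, hsymm.eq]

theorem contDiff_im_star_mul (φ ξ : testSpace) :
    ContDiff ℝ ∞ fun p => (star ((φ : ℝ × ℝ → ℂ) p) * (ξ : ℝ × ℝ → ℂ) p).im :=
  Complex.imCLM.contDiff.comp
    (((starL' ℝ (A := ℂ)).toContinuousLinearMap.contDiff.comp (testSpace_contDiff φ)).mul
      (testSpace_contDiff ξ))

theorem integral_mul_fderiv_eq_neg {χ g : ℝ × ℝ → ℝ} (hχ : ContDiff ℝ ∞ χ)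
    (hc : HasCompactSupport χ) (hg : ContDiff ℝ ∞ g) (v : ℝ × ℝ) :
    ∫ p, χ p * fderiv ℝ g p v = -∫ p, fderiv ℝ χ p v * g p :=
  integral_mul_fderiv_eq_neg_fderiv_mul_of_integrable
    (((contDiff_fderiv_apply hχ v).continuous.mul hg.continuous).integrable_of_hasCompactSupport
      (hasCompactSupport_fderiv_apply hc v).mul_right)
    ((hχ.continuous.mul (contDiff_fderiv_apply hg v).continuous).integrable_of_hasCompactSupport
      hc.mul_right)
    ((hχ.continuous.mul hg.continuous).integrable_of_hasCompactSupport hc.mul_right)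
    (fun p _ => hχ.differentiable (by simp) p) (fun p _ => hg.differentiable (by simp) p)

/-- The field-free part of the commutator, whose integral vanishes. -/
def freeCommutator (χ : ℝ × ℝ → ℝ) (φ : ℝ × ℝ → ℂ) (p : ℝ × ℝ) : ℝ :=
  fderiv ℝ χ p ey * (star (φ p) * fderiv ℝ φ p ex).im
    - fderiv ℝ χ p ex * (star (φ p) * fderiv ℝ φ p ey).im
    - χ p * (2 * (star (fderiv ℝ φ p ex) * fderiv ℝ φ p ey).im)

/-- After integration by parts the mixed second derivatives cancel, and `∂ₓ Im (φ̄ ∂_yφ) - ∂_y Im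
(φ̄ ∂ₓφ)` reduces to `2 Im (∂ₓφ̄ ∂_yφ)`. -/
theorem integral_freeCommutator {χ : ℝ × ℝ → ℝ} (hχ : ContDiff ℝ ∞ χ)
    (hc : HasCompactSupport χ) (φ : testSpace) :
    Integrable (freeCommutator χ φ) ∧ ∫ p, freeCommutator χ φ p = 0 := by
  have hg₁ := contDiff_im_star_mul φ (testDeriv ex φ)
  have hg₂ := contDiff_im_star_mul φ (testDeriv ey φ)
  have hg₃ := contDiff_im_star_mul (testDeriv ex φ) (testDeriv ey φ)
  simp only [testDeriv_apply] at hg₁ hg₂ hg₃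
  have i₁ : Integrable fun p => fderiv ℝ χ p ey *
      (star ((φ : ℝ × ℝ → ℂ) p) * fderiv ℝ (φ : ℝ × ℝ → ℂ) p ex).im :=
    ((contDiff_fderiv_apply hχ ey).continuous.mul hg₁.continuous).integrable_of_hasCompactSupport
      (hasCompactSupport_fderiv_apply hc ey).mul_right
  have i₂ : Integrable fun p => fderiv ℝ χ p ex *
      (star ((φ : ℝ × ℝ → ℂ) p) * fderiv ℝ (φ : ℝ × ℝ → ℂ) p ey).im :=
    ((contDiff_fderiv_apply hχ ex).continuous.mul hg₂.continuous).integrable_of_hasCompactSupport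
      (hasCompactSupport_fderiv_apply hc ex).mul_right
  have i₃ : Integrable fun p => χ p * (2 *
      (star (fderiv ℝ (φ : ℝ × ℝ → ℂ) p ex) * fderiv ℝ (φ : ℝ × ℝ → ℂ) p ey).im) :=
    (hχ.continuous.mul (continuous_const.mul hg₃.continuous)).integrable_of_hasCompactSupport
      hc.mul_right
  refine ⟨(i₁.sub i₂).sub i₃, ?_⟩
  have b₁ := integral_mul_fderiv_eq_neg hχ hc hg₁ ey
  have b₂ := integral_mul_fderiv_eq_neg hχ hc hg₂ ex
  have j₁ : Integrable fun p => χ p * fderiv ℝ (fun p =>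
      (star ((φ : ℝ × ℝ → ℂ) p) * fderiv ℝ (φ : ℝ × ℝ → ℂ) p ex).im) p ey :=
    (hχ.continuous.mul (contDiff_fderiv_apply hg₁ ey).continuous).integrable_of_hasCompactSupport
      hc.mul_right
  have j₂ : Integrable fun p => χ p * fderiv ℝ (fun p =>
      (star ((φ : ℝ × ℝ → ℂ) p) * fderiv ℝ (φ : ℝ × ℝ → ℂ) p ey).im) p ex :=
    (hχ.continuous.mul (contDiff_fderiv_apply hg₂ ex).continuous).integrable_of_hasCompactSupport
      hc.mul_right
  have e : ∫ p, χ p * (2 *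
      (star (fderiv ℝ (φ : ℝ × ℝ → ℂ) p ex) * fderiv ℝ (φ : ℝ × ℝ → ℂ) p ey).im) =
      (∫ p, χ p * fderiv ℝ (fun p =>
        (star ((φ : ℝ × ℝ → ℂ) p) * fderiv ℝ (φ : ℝ × ℝ → ℂ) p ey).im) p ex) -
      ∫ p, χ p * fderiv ℝ (fun p =>
        (star ((φ : ℝ × ℝ → ℂ) p) * fderiv ℝ (φ : ℝ × ℝ → ℂ) p ex).im) p ey := by
    rw [← integral_sub j₂ j₁]
    refine integral_congr_ae (ae_of_all _ fun p => ?_)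
    have d := testSpace_differentiable φ p
    have dx : DifferentiableAt ℝ (fun p => fderiv ℝ (φ : ℝ × ℝ → ℂ) p ex) p :=
      testSpace_differentiable (testDeriv ex φ) p
    have dy : DifferentiableAt ℝ (fun p => fderiv ℝ (φ : ℝ × ℝ → ℂ) p ey) p :=
      testSpace_differentiable (testDeriv ey φ) p
    simp only
    rw [fderiv_im_star_mul d dy, fderiv_im_star_mul d dx, fderiv_fderiv_comm]
    simp only [Complex.star_def, Complex.mul_im, Complex.conj_re, Complex.conj_im]
    ring
  simp only [freeCommutator]
  have i₄ : Integrable fun p =>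
      fderiv ℝ χ p ey * (star ((φ : ℝ × ℝ → ℂ) p) * fderiv ℝ (φ : ℝ × ℝ → ℂ) p ex).im -
      fderiv ℝ χ p ex * (star ((φ : ℝ × ℝ → ℂ) p) * fderiv ℝ (φ : ℝ × ℝ → ℂ) p ey).im := i₁.sub i₂
  rw [integral_sub i₄ i₃, integral_sub i₁ i₂, e, b₁, b₂]
  ring

/-- The gauge invariant part of the commutator. -/
def gaugeCommutator (A : ℝ × ℝ → ℝ × ℝ) (χ : ℝ × ℝ → ℝ) (φ : ℝ × ℝ → ℂ) (p : ℝ × ℝ) : ℝ :=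
  fderiv ℝ χ p ey * (star (φ p) * covD (fun q => (A q).1) ex φ p).re
    - fderiv ℝ χ p ex * (star (φ p) * covD (fun q => (A q).2) ey φ p).re
    + χ p * (2 * (star (covD (fun q => (A q).1) ex φ p) * covD (fun q => (A q).2) ey φ p).im)

/-- A weak form of the statement that the commutator of the two covariant derivatives is the field.
It is pointwise algebra without derivatives of `A`. Apart from terms of vanishing integral, `A`
enters only through covariant derivatives. -/
theorem rot_mul_norm_sq_eq (A : ℝ × ℝ → ℝ × ℝ) {χ : ℝ × ℝ → ℝ} (hχ : ContDiff ℝ ∞ χ)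
    (φ : testSpace) (p : ℝ × ℝ) :
    (A p).1 * fderiv ℝ (fun p => χ p * ‖(φ : ℝ × ℝ → ℂ) p‖ ^ 2) p ey
      - (A p).2 * fderiv ℝ (fun p => χ p * ‖(φ : ℝ × ℝ → ℂ) p‖ ^ 2) p ex =
      gaugeCommutator A χ φ p + freeCommutator χ φ p := by
  have dχ := hχ.differentiable (by simp) p
  have dF := (contDiff_norm_sq_test φ).differentiable (by simp) p
  rw [fderiv_mul_apply dχ dF, fderiv_mul_apply dχ dF,
    fderiv_norm_sq_apply (testSpace_differentiable φ p),
    fderiv_norm_sq_apply (testSpace_differentiable φ p)]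
  simp only [gaugeCommutator, freeCommutator, covD, Complex.inner, Complex.sq_norm,
    Complex.normSq_apply, Complex.star_def, Complex.mul_re, Complex.mul_im, Complex.add_re,
    Complex.add_im, Complex.I_re, Complex.I_im, Complex.ofReal_re, Complex.ofReal_im,
    Complex.conj_re, Complex.conj_im]
  ring

theorem abs_gaugeCommutator_le (A : ℝ × ℝ → ℝ × ℝ) {χ : ℝ × ℝ → ℝ} (φ : ℝ × ℝ → ℂ) (p : ℝ × ℝ)
    {M δ : ℝ} (hδ : 0 < δ) (h₀ : |χ p| ≤ M) (h₁ : |fderiv ℝ χ p ex| ≤ M)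
    (h₂ : |fderiv ℝ χ p ey| ≤ M) :
    |gaugeCommutator A χ φ p| ≤ M * (δ * ‖φ p‖ ^ 2 + (1 + δ⁻¹) * magSq A φ p) := by
  have hM : 0 ≤ M := (abs_nonneg _).trans h₀
  have r₁ := Complex.abs_re_le_norm (star (φ p) * covD (fun q => (A q).1) ex φ p)
  have r₂ := Complex.abs_re_le_norm (star (φ p) * covD (fun q => (A q).2) ey φ p)
  have r₃ := Complex.abs_im_le_norm
    (star (covD (fun q => (A q).1) ex φ p) * covD (fun q => (A q).2) ey φ p)
  rw [norm_mul, norm_star] at r₁ r₂ r₃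
  have y₁ := mul_le_young hδ ‖φ p‖ ‖covD (fun q => (A q).1) ex φ p‖
  have y₂ := mul_le_young hδ ‖φ p‖ ‖covD (fun q => (A q).2) ey φ p‖
  rw [abs_of_nonneg (by positivity)] at y₁ y₂
  have t₁ := mul_le_mul h₂ r₁ (abs_nonneg _) hM
  have t₂ := mul_le_mul h₁ r₂ (abs_nonneg _) hM
  have t₃ := mul_le_mul h₀ r₃ (abs_nonneg _) hM
  rw [← abs_mul] at t₁ t₂ t₃
  unfold gaugeCommutator magSq
  generalize ‖φ p‖ = f at *
  generalize ‖covD (fun q => (A q).1) ex φ p‖ = d at *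
  generalize ‖covD (fun q => (A q).2) ey φ p‖ = e at *
  refine (abs_add_le _ _).trans ((add_le_add (abs_sub _ _) le_rfl).trans ?_)
  rw [mul_left_comm (χ p) 2, abs_mul 2, abs_two]
  have hsq : 2 * (d * e) ≤ d ^ 2 + e ^ 2 := by nlinarith [sq_nonneg (d - e)]
  have hδi : 0 ≤ δ⁻¹ := by positivity
  have key : f * d + f * e + 2 * (d * e) ≤ δ * f ^ 2 + (1 + δ⁻¹) * (d ^ 2 + e ^ 2) := by
    nlinarith [mul_nonneg hδi (sq_nonneg d), mul_nonneg hδi (sq_nonneg e)]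
  have := mul_le_mul_of_nonneg_left key hM
  linarith

/-- The field tested against `|φ|²` is controlled by the magnetic energy. -/
theorem exists_magnetic_bound {a : ℝ} {χ : ℝ × ℝ → ℝ} (hχ : ContDiff ℝ ∞ χ)
    (hc : HasCompactSupport χ) (hs : tsupport χ ⊆ square a) :
    ∃ M : ℝ, 0 ≤ M ∧ ∀ (B : ℝ × ℝ → ℝ) (A : ℝ × ℝ → ℝ × ℝ), IsVectorPotential B A →
      ∀ (φ : testSpace) (δ : ℝ), 0 < δ →
      |∫ p, B p * (χ p * ‖(φ : ℝ × ℝ → ℂ) p‖ ^ 2)| ≤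
        M * (δ * (∫ p in square a, ‖(φ : ℝ × ℝ → ℂ) p‖ ^ 2) +
          (1 + δ⁻¹) * ∫ p in square a, magSq A φ p) := by
  obtain ⟨M₀, hM₀, h₀⟩ := exists_abs_le_of_hasCompactSupport hχ.continuous hc
  obtain ⟨M₁, hM₁, h₁⟩ := exists_abs_le_of_hasCompactSupport
    (contDiff_fderiv_apply hχ ex).continuous (hasCompactSupport_fderiv_apply hc ex)
  obtain ⟨M₂, hM₂, h₂⟩ := exists_abs_le_of_hasCompactSupport
    (contDiff_fderiv_apply hχ ey).continuous (hasCompactSupport_fderiv_apply hc ey)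
  -- The constant is fixed by `χ` and its first derivatives before any field or potential is given.
  refine ⟨M₀ + M₁ + M₂, by positivity, fun B A hA φ δ hδ => ?_⟩
  set M := M₀ + M₁ + M₂ with hM
  have hbd : ∀ {δ : ℝ}, 0 < δ → ∀ p, |gaugeCommutator A χ φ p| ≤
      M * (δ * ‖(φ : ℝ × ℝ → ℂ) p‖ ^ 2 + (1 + δ⁻¹) * magSq A φ p) := fun hδ p =>
    abs_gaugeCommutator_le A φ p hδ ((h₀ p).trans (by linarith)) ((h₁ p).trans (by linarith))
      ((h₂ p).trans (by linarith))
  have hmi := integrable_magSq hA.isMultiplier_fst hA.isMultiplier_snd φ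
  have hbi : Integrable fun p => M * (δ * ‖(φ : ℝ × ℝ → ℂ) p‖ ^ 2 + (1 + δ⁻¹) * magSq A φ p) :=
    (((integrable_test_sq φ).const_mul δ).add (hmi.const_mul _)).const_mul M
  have hstar : Continuous fun p => star ((φ : ℝ × ℝ → ℂ) p) := (testSpace_continuous φ).star
  have m₁ := (hA.isMultiplier_fst.memLp_covD ex φ).1
  have m₂ := (hA.isMultiplier_snd.memLp_covD ey φ).1
  have hmeas : AEStronglyMeasurable (gaugeCommutator A χ φ) volume := by
    refine ((((contDiff_fderiv_apply hχ ey).continuous.aestronglyMeasurable.mul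
      (Complex.continuous_re.comp_aestronglyMeasurable
        (hstar.aestronglyMeasurable.mul m₁)))).sub
      ((contDiff_fderiv_apply hχ ex).continuous.aestronglyMeasurable.mul
      (Complex.continuous_re.comp_aestronglyMeasurable
        (hstar.aestronglyMeasurable.mul m₂)))).add
      (hχ.continuous.aestronglyMeasurable.mul (AEStronglyMeasurable.const_mul
        (Complex.continuous_im.comp_aestronglyMeasurable (m₁.star.mul m₂)) 2))
  have hgi : Integrable (gaugeCommutator A χ φ) := hbi.mono' hmeas (ae_of_all _ (hbd hδ))
  obtain ⟨hfi, hf0⟩ := integral_freeCommutator hχ hc φ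
  rw [← hA.rot_eq _ (hχ.mul (contDiff_norm_sq_test φ)) hc.mul_right]
  simp only [rot_mul_norm_sq_eq A hχ φ]
  rw [integral_add hgi hfi, hf0, add_zero,
    ← setIntegral_eq_integral_of_forall_compl_eq_zero (s := square a)]
  · refine (norm_integral_le_of_norm_le (f := gaugeCommutator A χ φ) hbi.integrableOn
      (ae_of_all _ (hbd hδ))).trans ?_
    rw [integral_const_mul, integral_add ((integrable_test_sq φ).const_mul δ).integrableOn
      (hmi.const_mul _).integrableOn, integral_const_mul, integral_const_mul]
  · intro p hp
    have z0 := eq_zero_of_notMem_square hs hp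
    have z1 := eq_zero_of_notMem_square ((tsupport_fderiv_apply_subset ex).trans hs) hp
    have z2 := eq_zero_of_notMem_square ((tsupport_fderiv_apply_subset ey).trans hs) hp
    simp only [gaugeCommutator, z0, z1, z2]
    ring

end LeakyWire

end

noncomputable section

namespace LeakyWire

/-! ### The magnetic Hardy inequality on the square -/

theorem exists_test_integral_ne_zero {a : ℝ} {B : ℝ × ℝ → ℝ} (hB : LocallyIntegrable B volume)
    (hBsupp : tsupport B ⊆ square a) (hB0 : ¬ B =ᵐ[volume] 0) :
    ∃ χ : ℝ × ℝ → ℝ, ContDiff ℝ ∞ χ ∧ HasCompactSupport χ ∧ tsupport χ ⊆ square a ∧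
      ∫ p, B p * χ p ≠ 0 := by
  by_contra! h
  refine hB0 ?_
  have hopen : IsOpen (square a) := isOpen_Ioo.prod isOpen_Ioo
  have := hopen.ae_eq_zero_of_integral_contDiff_smul_eq_zero (hB.locallyIntegrableOn _)
    fun χ h₁ h₂ h₃ => by simpa [mul_comm] using h χ h₁ h₂ h₃
  filter_upwards [this] with p hp
  by_cases hs : p ∈ square a
  · exact hp hs
  · exact eq_zero_of_notMem_square hBsupp hs

theorem integrable_field_mul {B : ℝ × ℝ → ℝ} (hB : LocallyIntegrable B volume) {f : ℝ × ℝ → ℝ}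
    (hf : Continuous f) (hc : HasCompactSupport f) : Integrable fun p => B p * f p := by
  simpa [mul_comm] using hB.integrable_smul_left_of_hasCompactSupport hf hc

theorem squareEnergy_eq {w : ℝ × ℝ → ℝ} (hw : ContDiff ℝ ∞ w) (a : ℝ) :
    squareEnergy a w = (∫ p in square a, w p ^ 2) +
      ∫ p in square a, ((fderiv ℝ w p ex) ^ 2 + (fderiv ℝ w p ey) ^ 2) := by
  have h1 : Continuous fun p => w p ^ 2 := hw.continuous.pow 2
  have h2 : Continuous fun p => (fderiv ℝ w p ex) ^ 2 + (fderiv ℝ w p ey) ^ 2 :=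
    ((contDiff_fderiv_apply hw ex).continuous.pow 2).add
      ((contDiff_fderiv_apply hw ey).continuous.pow 2)
  rw [squareEnergy, ← integral_add (integrableOn_square h1 a) (integrableOn_square h2 a)]
  simp only [add_assoc]

/-- Writing `w + c = 2w - (w - c)` avoids a term in `c²`, which is the quantity to be estimated in
the Hardy inequality. -/
theorem squareEnergy_add_const_le {w : ℝ × ℝ → ℝ} (hw : ContDiff ℝ ∞ w) (a c : ℝ) :
    squareEnergy a (fun p => w p + c) ≤ 8 * (∫ p in square a, w p ^ 2) +
      2 * (∫ p in square a, (w p - c) ^ 2) +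
      ∫ p in square a, ((fderiv ℝ w p ex) ^ 2 + (fderiv ℝ w p ey) ^ 2) := by
  rw [squareEnergy_eq (hw.add contDiff_const)]
  simp only [fderiv_add_const]
  gcongr
  have h1 : Continuous fun p => w p ^ 2 := hw.continuous.pow 2
  have h2 : Continuous fun p => (w p - c) ^ 2 := (hw.continuous.sub continuous_const).pow 2
  have h3 : Continuous fun p => (w p + c) ^ 2 := (hw.continuous.add continuous_const).pow 2
  rw [← integral_const_mul, ← integral_const_mul, ← integral_add
    ((integrableOn_square h1 a).const_mul _) ((integrableOn_square h2 a).const_mul _)]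
  refine setIntegral_mono (integrableOn_square h3 a)
    (((integrableOn_square h1 a).const_mul _).add ((integrableOn_square h2 a).const_mul _))
    fun p => ?_
  simp only
  nlinarith [sq_nonneg (2 * w p + (w p - c))]

theorem setIntegral_sq_le {w : ℝ × ℝ → ℝ} (hw : Continuous w) {a : ℝ} (ha : 0 < a) (c : ℝ) :
    ∫ p in square a, w p ^ 2 ≤ 2 * c ^ 2 * (2 * a) ^ 2 + 2 * ∫ p in square a, (w p - c) ^ 2 := by
  have h1 : Continuous fun p => w p ^ 2 := hw.pow 2
  have h2 : Continuous fun p => (w p - c) ^ 2 := (hw.sub continuous_const).pow 2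
  have h3 := integrableOn_square (F := fun _ => 2 * c ^ 2) continuous_const a
  have e : ∫ _ in square a, 2 * c ^ 2 = 2 * c ^ 2 * (2 * a) ^ 2 := by
    rw [setIntegral_const, volume_real_square ha, smul_eq_mul]; ring
  rw [← e, ← integral_const_mul, ← integral_add h3 ((integrableOn_square h2 a).const_mul _)]
  refine setIntegral_mono (integrableOn_square h1 a)
    (h3.add ((integrableOn_square h2 a).const_mul _)) fun p => ?_
  simp only
  nlinarith [sq_nonneg (w p - 2 * c)]

theorem setIntegral_gradient_regAbs_le {A : ℝ × ℝ → ℝ × ℝ} (h₁ : IsMultiplier fun p => (A p).1)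
    (h₂ : IsMultiplier fun p => (A p).2) (φ : testSpace) {ε : ℝ} (hε : 0 < ε) (a : ℝ) :
    ∫ p in square a, ((fderiv ℝ (regAbs ε φ) p ex) ^ 2 + (fderiv ℝ (regAbs ε φ) p ey) ^ 2) ≤
      ∫ p in square a, magSq A φ p := by
  have hw := contDiff_regAbs hε (testSpace_contDiff φ)
  have hc : Continuous fun p =>
      (fderiv ℝ (regAbs ε φ) p ex) ^ 2 + (fderiv ℝ (regAbs ε φ) p ey) ^ 2 :=
    ((contDiff_fderiv_apply hw ex).continuous.pow 2).add
      ((contDiff_fderiv_apply hw ey).continuous.pow 2)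
  refine setIntegral_mono (integrableOn_square hc a)
    (integrable_magSq h₁ h₂ φ).integrableOn fun p => ?_
  have kx := abs_fderiv_regAbs_le (fun q => (A q).1) hε (testSpace_differentiable φ p) ex
  have ky := abs_fderiv_regAbs_le (fun q => (A q).2) hε (testSpace_differentiable φ p) ey
  simp only [magSq]
  rw [← sq_abs (fderiv ℝ (regAbs ε φ) p ex), ← sq_abs (fderiv ℝ (regAbs ε φ) p ey)]
  gcongr

theorem setIntegral_regAbs_sq (φ : testSpace) (ε : ℝ) {a : ℝ} (ha : 0 < a) :
    ∫ p in square a, regAbs ε φ p ^ 2 =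
      (∫ p in square a, ‖(φ : ℝ × ℝ → ℂ) p‖ ^ 2) + ε ^ 2 * (2 * a) ^ 2 := by
  simp only [regAbs_sq]
  rw [integral_add (integrable_test_sq φ).integrableOn
    (integrableOn_square (F := fun _ => ε ^ 2) continuous_const a), setIntegral_const,
    volume_real_square ha, smul_eq_mul]
  ring

/-- A local magnetic Hardy inequality whose constant depends on the field only. -/
theorem exists_hardy {a : ℝ} (ha : 0 < a) {B : ℝ × ℝ → ℝ} (hB : LocallyIntegrable B volume)
    (hBsupp : tsupport B ⊆ square a) (hB0 : ¬ B =ᵐ[volume] 0) :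
    ∃ K : ℝ, 0 ≤ K ∧ ∀ A, IsVectorPotential B A → ∀ φ : testSpace,
      ∫ p in square a, ‖(φ : ℝ × ℝ → ℂ) p‖ ^ 2 ≤ K * ∫ p in square a, magSq A φ p := by
  -- The oscillation estimate needs just one potential, chosen once for all. If there is none, the
  -- claim is vacuous.
  by_cases hex : ∃ A₀, IsVectorPotential B A₀
  swap
  · exact ⟨0, le_rfl, fun A hA => (hex ⟨A, hA⟩).elim⟩
  obtain ⟨A₀, hA₀⟩ := hex
  obtain ⟨χ, hχ, hχc, hχs, hb⟩ := exists_test_integral_ne_zero hB hBsupp hB0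
  obtain ⟨C, hC, hosc⟩ := hA₀.exists_oscillation_bound hχ hχc hχs
  obtain ⟨M, hM, hmag⟩ := exists_magnetic_bound hχ hχc hχs
  set b := ∫ p, B p * χ p
  have hb' : 0 < |b| := abs_pos.2 hb
  set q := (2 * a) ^ 2 with hq
  have hq0 : 0 < q := by positivity
  set s := 8 * a ^ 2 with hs
  have hs0 : 0 < s := by positivity
  -- Small enough to absorb the mass terms into the left side. The `9` is `1 + 8`, from the energies
  -- of `w` and `w + c`; the extra `1` keeps the denominator positive.
  set δ := |b| / (4 * q * (9 * C + M + 1)) with hδ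
  have hδ0 : 0 < δ := by positivity
  set R := δ * (C * (2 * s + 2)) + δ⁻¹ * (s + 1) + M * (1 + δ⁻¹) with hR
  refine ⟨4 * q * R / |b| + 4 * s, by positivity, fun A hA φ => ?_⟩
  set X := ∫ p in square a, ‖(φ : ℝ × ℝ → ℂ) p‖ ^ 2 with hX
  set Y := ∫ p in square a, magSq A φ p with hY
  have hX0 : 0 ≤ X := integral_nonneg fun p => by positivity
  have hY0 : 0 ≤ Y := integral_nonneg fun p => magSq_nonneg A φ p
  have key : ∀ ε : ℝ, 0 < ε → X ≤ (4 * q * R / |b| + 4 * s) * Y + 4 * q * ε ^ 2 := by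
    intro ε hε
    have hw := contDiff_regAbs hε (testSpace_contDiff φ)
    obtain ⟨c, hc⟩ := exists_setIntegral_sub_sq_le hw ha
    have hZ := setIntegral_gradient_regAbs_le hA.isMultiplier_fst hA.isMultiplier_snd φ hε a
    have ho := hosc _ hw c δ hδ0
    have hm := hmag B A hA φ δ hδ0
    have hXw := setIntegral_regAbs_sq φ ε ha
    have hsq := setIntegral_sq_le hw.continuous ha c
    have hE := squareEnergy_eq hw a
    have hE' := squareEnergy_add_const_le hw a c
    have hlast : ∫ p in square a, ((regAbs ε φ p - c) ^ 2 + (fderiv ℝ (regAbs ε φ) p ex) ^ 2 +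
        (fderiv ℝ (regAbs ε φ) p ey) ^ 2) = (∫ p in square a, (regAbs ε φ p - c) ^ 2) +
        ∫ p in square a, ((fderiv ℝ (regAbs ε φ) p ex) ^ 2 +
          (fderiv ℝ (regAbs ε φ) p ey) ^ 2) := by
      have := squareEnergy_eq (hw.sub (contDiff_const (c := c))) a
      simpa only [squareEnergy, fderiv_sub_const] using this
    -- Here `w² - c² = |φ|² + (ε² - c²)`, which brings in `c² b`.
    have hsplit : ∫ p, B p * (χ p * (regAbs ε φ p ^ 2 - c ^ 2)) =
        (∫ p, B p * (χ p * ‖(φ : ℝ × ℝ → ℂ) p‖ ^ 2)) + (ε ^ 2 - c ^ 2) * b := by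
      rw [← integral_const_mul, ← integral_add
        (integrable_field_mul hB (hχ.mul (contDiff_norm_sq_test φ)).continuous hχc.mul_right)
        ((integrable_field_mul hB hχ.continuous hχc).const_mul _)]
      refine integral_congr_ae (ae_of_all _ fun p => ?_)
      simp only [regAbs_sq]
      ring
    rw [hlast, hsplit, hE] at ho
    generalize (∫ p in square a, (regAbs ε φ p - c) ^ 2) = P at *
    generalize (∫ p in square a, ((fderiv ℝ (regAbs ε φ) p ex) ^ 2 +
      (fderiv ℝ (regAbs ε φ) p ey) ^ 2)) = Z at *
    generalize (∫ p in square a, regAbs ε φ p ^ 2) = Xw at *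
    generalize (squareEnergy a fun p => regAbs ε φ p + c) = E' at *
    generalize (∫ p, B p * (χ p * ‖(φ : ℝ × ℝ → ℂ) p‖ ^ 2)) = J at *
    have hδi : 0 < δ⁻¹ := by positivity
    have hXX : X ≤ Xw := by rw [hXw]; nlinarith [sq_nonneg ε]
    have hPY : P ≤ s * Y := hc.trans (mul_le_mul_of_nonneg_left hZ hs0.le)
    have hcb : c ^ 2 * |b| ≤ |J + (ε ^ 2 - c ^ 2) * b| + |J| + ε ^ 2 * |b| := by
      have e : c ^ 2 * b = -(J + (ε ^ 2 - c ^ 2) * b) + J + ε ^ 2 * b := by ring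
      calc c ^ 2 * |b| = |c ^ 2 * b| := by rw [abs_mul, abs_of_nonneg (sq_nonneg c)]
        _ ≤ |-(J + (ε ^ 2 - c ^ 2) * b)| + |J| + |ε ^ 2 * b| := by
          rw [e]; exact abs_add_three _ _ _
        _ = _ := by rw [abs_neg, abs_mul, abs_of_nonneg (sq_nonneg ε)]
    have ho2 : |J + (ε ^ 2 - c ^ 2) * b| ≤
        δ * (C * (9 * Xw + (2 * s + 2) * Y)) + δ⁻¹ * ((s + 1) * Y) := by
      refine ho.trans (add_le_add ?_ ?_)
      · exact mul_le_mul_of_nonneg_left (mul_le_mul_of_nonneg_left (by linarith) hC) hδ0.le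
      · exact mul_le_mul_of_nonneg_left (by linarith) hδi.le
    have hm2 : |J| ≤ M * (δ * Xw + (1 + δ⁻¹) * Y) := by
      refine hm.trans (mul_le_mul_of_nonneg_left ?_ hM)
      gcongr
    have hcb2 : c ^ 2 * |b| ≤ δ * (9 * C + M) * Xw + R * Y + ε ^ 2 * |b| := by
      refine hcb.trans ((add_le_add (add_le_add ho2 hm2) le_rfl).trans (le_of_eq ?_))
      rw [hR]; ring
    have hδ1 : 2 * q * (δ * (9 * C + M)) ≤ |b| / 2 := by
      have : 2 * q * (δ * (9 * C + M + 1)) = |b| / 2 := by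
        rw [hδ]; field_simp; norm_num
      rw [← this]
      exact mul_le_mul_of_nonneg_left (mul_le_mul_of_nonneg_left (by linarith) hδ0.le)
        (by positivity)
    have hXw0 : 0 ≤ Xw := hX0.trans hXX
    -- The mass is at most `2 q c² + 2 P`. Inserting the bounds on `c²` and `P` leaves half of the
    -- mass on the right, by the choice of `δ`.
    have hfin : |b| * Xw ≤ |b| / 2 * Xw + 2 * q * (R * Y) + 2 * q * (ε ^ 2 * |b|) +
        2 * (s * Y) * |b| := by
      have t1 := mul_le_mul_of_nonneg_left hcb2 (by positivity : 0 ≤ 2 * q)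
      have t2 := mul_le_mul_of_nonneg_right hδ1 hXw0
      have t3 := mul_le_mul_of_nonneg_left hsq hb'.le
      have t4 := mul_le_mul_of_nonneg_left hPY hb'.le
      nlinarith
    refine hXX.trans ?_
    rw [← mul_le_mul_iff_right₀ hb']
    have e2 : |b| * ((4 * q * R / |b| + 4 * s) * Y + 4 * q * ε ^ 2) =
        4 * q * (R * Y) + 4 * (s * Y) * |b| + 4 * q * (ε ^ 2 * |b|) := by
      field_simp
    rw [e2]
    linarith
  -- The regularisation is removed by choosing `ε² = η / (4q)`, so that its error is exactly `η`.
  refine le_of_forall_pos_le_add fun η hη => ?_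
  have h := key √(η / (4 * q)) (by positivity)
  rw [Real.sq_sqrt (by positivity)] at h
  have : 4 * q * (η / (4 * q)) = η := by field_simp
  linarith

end LeakyWire

end

noncomputable section

namespace LeakyWire

/-! ### The lower bound for the form -/

theorem deriv_eq_one_of_lt_abs {a : ℝ} {γ : ℝ → ℝ} (h : ∀ x, a ≤ |x| → γ x = x) {x : ℝ}
    (hx : a < |x|) : deriv γ x = 1 := by
  have : γ =ᶠ[𝓝 x] id := by
    filter_upwards [continuous_abs.continuousAt.eventually (lt_mem_nhds hx)] with y hy
    exact h y hy.le
  rw [this.deriv_eq, deriv_id]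

theorem setIntegral_arc_outside {a : ℝ} {γ : ℝ → ℝ} (h : ∀ x, a ≤ |x| → γ x = x)
    (φ : testSpace) :
    ∫ x in (Ioo (-a) a)ᶜ, √(1 + deriv γ x ^ 2) * ‖(φ : ℝ × ℝ → ℂ) (x, γ x)‖ ^ 2 =
      √2 * ∫ x in (Ioo (-a) a)ᶜ, ‖(φ : ℝ × ℝ → ℂ) (x, x)‖ ^ 2 := by
  rw [← integral_const_mul]
  refine setIntegral_congr_ae measurableSet_Ioo.compl ?_
  -- At `±a` the curve may have corners; these two points are null.
  have h1 : ∀ᵐ x : ℝ, x ≠ a := by simp [ae_iff]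
  have h2 : ∀ᵐ x : ℝ, x ≠ -a := by simp [ae_iff]
  filter_upwards [h1, h2] with x hx1 hx2 hx
  have hle : a ≤ |x| := by
    rw [mem_compl_iff, mem_Ioo, ← abs_lt] at hx
    exact not_lt.1 hx
  have hlt : a < |x| := by
    refine lt_of_le_of_ne hle fun he => ?_
    rcases abs_choice x with h' | h' <;> rw [h'] at he
    · exact hx1 he.symm
    · exact hx2 (by linarith)
  rw [deriv_eq_one_of_lt_abs h hlt, h x hle]
  norm_num

theorem setIntegral_half_preimage (S : Set ℝ) (hS : MeasurableSet S) (f : ℝ → ℝ) :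
    ∫ c in {c : ℝ | c / 2 ∈ S}, f (c / 2) = 2 * ∫ s in S, f s := by
  have hm : MeasurableSet {c : ℝ | c / 2 ∈ S} := (measurable_id.div_const 2) hS
  rw [← integral_indicator hm, ← integral_indicator hS]
  have e : ({c : ℝ | c / 2 ∈ S}).indicator (fun c => f (c / 2)) =
      fun c => S.indicator f (c / 2) := by
    ext c
    simp [indicator]
  rw [e, Measure.integral_comp_div]
  simp

/-- The energy of the square and that of the strips beyond it are disjoint budgets. The former pays
for the deformed piece through `hK` and `hsmall`. The latter, with the mass term `α² / 4`, pays for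
the straight ends. -/
theorem arc_le_magSq {a : ℝ} (ha : 0 < a) {B : ℝ × ℝ → ℝ} {A : ℝ × ℝ → ℝ × ℝ}
    (hA : IsVectorPotential B A) {γ : ℝ → ℝ} (hγ : IsDeformedLine a γ)
    [IsFiniteMeasureOnCompacts (arcLength γ)] {α W K : ℝ} (hα : 0 ≤ α)
    (hW : ∀ᵐ x, √(1 + deriv γ x ^ 2) ≤ W) (φ : testSpace)
    (hK : ∫ p in square a, ‖(φ : ℝ × ℝ → ℂ) p‖ ^ 2 ≤ K * ∫ p in square a, magSq A φ p)
    (hsmall : α * W * (((2 * a)⁻¹ + 1) * K + 1) ≤ 1) :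
    α * ‖testToLp (arcLength γ) φ‖ ^ 2 ≤
      (∫ p, magSq A φ p) + α ^ 2 / 4 * ∫ p, ‖(φ : ℝ × ℝ → ℂ) p‖ ^ 2 := by
  have hγc : Continuous γ := hγ.piecewiseC1.1
  have hW0 : 0 ≤ W := by
    obtain ⟨x, hx⟩ := hW.exists
    exact (Real.sqrt_nonneg _).trans hx
  have harc := integrable_arc_test hγc hW φ
  have hmi := integrable_magSq hA.isMultiplier_fst hA.isMultiplier_snd φ
  have hpi := integrable_test_sq φ
  rw [norm_sq_testToLp_arcLength hγc,
    ← integral_add_compl (measurableSet_Ioo (a := -a) (b := a)) harc,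
    setIntegral_arc_outside hγ.eq_outside]
  have hY0 : 0 ≤ ∫ p in square a, magSq A φ p := integral_nonneg fun p => magSq_nonneg A φ p
  -- inside the square
  have hin : α * ∫ x in Ioo (-a) a, √(1 + deriv γ x ^ 2) * ‖(φ : ℝ × ℝ → ℂ) (x, γ x)‖ ^ 2 ≤
      ∫ p in square a, magSq A φ p := by
    have h1 : ∫ x in Ioo (-a) a, √(1 + deriv γ x ^ 2) * ‖(φ : ℝ × ℝ → ℂ) (x, γ x)‖ ^ 2 ≤
        W * ∫ x in Ioo (-a) a, ‖(φ : ℝ × ℝ → ℂ) (x, γ x)‖ ^ 2 := by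
      rw [← integral_const_mul]
      refine setIntegral_mono_ae harc.integrableOn
        ((integrable_graph_test hγc φ).const_mul W).integrableOn ?_
      filter_upwards [hW] with x hx
      exact mul_le_mul_of_nonneg_right hx (by positivity)
    have h2 := setIntegral_graph_le_magSq hA.isMultiplier_fst hA.isMultiplier_snd hγc ha
      hγ.abs_le_inside φ
    have h3 : ∫ x in Ioo (-a) a, ‖(φ : ℝ × ℝ → ℂ) (x, γ x)‖ ^ 2 ≤
        (((2 * a)⁻¹ + 1) * K + 1) * ∫ p in square a, magSq A φ p := by
      have := mul_le_mul_of_nonneg_left hK (by positivity : 0 ≤ (2 * a)⁻¹ + 1)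
      linarith
    calc _ ≤ α * (W * ((((2 * a)⁻¹ + 1) * K + 1) * ∫ p in square a, magSq A φ p)) := by gcongr; exact h1.trans (by gcongr)
      _ = α * W * (((2 * a)⁻¹ + 1) * K + 1) * ∫ p in square a, magSq A φ p := by ring
      _ ≤ 1 * ∫ p in square a, magSq A φ p := by gcongr
      _ = _ := one_mul _
  -- outside the square
  set S : Set ℝ := {c | c / 2 ∈ (Ioo (-a) a)ᶜ} with hS
  set T : Set (ℝ × ℝ) := {p | p.1 + p.2 ∈ S} with hT
  have hout := setIntegral_diagonal_le_magSq hA.isMultiplier_fst hA.isMultiplier_snd hα S φ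
  rw [setIntegral_half_preimage _ measurableSet_Ioo.compl
    (fun s => ‖(φ : ℝ × ℝ → ℂ) (s, s)‖ ^ 2)] at hout
  have hTm : MeasurableSet T :=
    (((measurable_fst.add measurable_snd).div_const 2) measurableSet_Ioo.compl)
  have hdisj : Disjoint (square a) T := by
    rw [Set.disjoint_left]
    rintro p ⟨⟨h1, h2⟩, h3, h4⟩ hp
    exact hp ⟨by linarith, by linarith⟩
  have hsum : (∫ p in square a, magSq A φ p) + ∫ p in T, magSq A φ p ≤ ∫ p, magSq A φ p := by
    rw [← setIntegral_union hdisj hTm hmi.integrableOn hmi.integrableOn]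
    exact setIntegral_le_integral hmi (ae_of_all _ fun p => magSq_nonneg A φ p)
  have hpT : ∫ p in T, ‖(φ : ℝ × ℝ → ℂ) p‖ ^ 2 ≤ ∫ p, ‖(φ : ℝ × ℝ → ℂ) p‖ ^ 2 :=
    setIntegral_le_integral hpi (ae_of_all _ fun p => by positivity)
  have hroot : α / √2 * (2 * ∫ x in (Ioo (-a) a)ᶜ, ‖(φ : ℝ × ℝ → ℂ) (x, x)‖ ^ 2) =
      α * (√2 * ∫ x in (Ioo (-a) a)ᶜ, ‖(φ : ℝ × ℝ → ℂ) (x, x)‖ ^ 2) := by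
    have h2 : √2 * √2 = 2 := Real.mul_self_sqrt (by norm_num)
    have h0 : √2 ≠ 0 := by positivity
    rw [div_mul_eq_mul_div, div_eq_iff h0]
    linear_combination -α * (∫ x in (Ioo (-a) a)ᶜ, ‖(φ : ℝ × ℝ → ℂ) (x, x)‖ ^ 2) * h2
  rw [hroot] at hout
  have hpT' := mul_le_mul_of_nonneg_left hpT (by positivity : 0 ≤ α ^ 2 / 4)
  rw [mul_add]
  linarith

/-! ### The form as a bounded form on `H¹(ℝ²)` -/

/-- The covariant derivative, as a bounded operator from `H¹(ℝ²)` to `L²(ℝ²)`. -/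
def covOp {m : ℝ × ℝ → ℝ} (hm : IsMultiplier m) (i : Fin 3) : sobolev →L[ℂ] L2 :=
  Complex.I • coord i + mulOp hm

theorem coeFn_covOp {m : ℝ × ℝ → ℝ} (hm : IsMultiplier m) (i : Fin 3) (u : sobolev) :
    covOp hm i u =ᵐ[volume] fun p => Complex.I * coord i u p + (m p : ℂ) * coord 0 u p := by
  have e : covOp hm i u = Complex.I • coord i u + mulOp hm u := rfl
  rw [e]
  filter_upwards [Lp.coeFn_add (Complex.I • coord i u) (mulOp hm u),
    Lp.coeFn_smul Complex.I (coord i u), coeFn_mulOp hm u] with p h1 h2 h3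
  rw [h1, Pi.add_apply, h2, h3]
  rfl

theorem norm_sq_covOp_ex_test {m : ℝ × ℝ → ℝ} (hm : IsMultiplier m) (φ : testSpace) :
    ‖covOp hm 1 (testToSobolev φ)‖ ^ 2 = ∫ p, ‖covD m ex φ p‖ ^ 2 := by
  refine Lp_norm_sq_of_ae ?_
  filter_upwards [coeFn_covOp hm 1 (testToSobolev φ), coeFn_testToLp volume φ,
    coeFn_testToLp volume (testDeriv ex φ)] with p h1 h2 h3
  rw [h1, coord_zero_test, coord_one_test, h2, h3]
  rfl

theorem norm_sq_covOp_ey_test {m : ℝ × ℝ → ℝ} (hm : IsMultiplier m) (φ : testSpace) :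
    ‖covOp hm 2 (testToSobolev φ)‖ ^ 2 = ∫ p, ‖covD m ey φ p‖ ^ 2 := by
  refine Lp_norm_sq_of_ae ?_
  filter_upwards [coeFn_covOp hm 2 (testToSobolev φ), coeFn_testToLp volume φ,
    coeFn_testToLp volume (testDeriv ey φ)] with p h1 h2 h3
  rw [h1, coord_zero_test, coord_two_test, h2, h3]
  rfl

theorem norm_sq_coord_zero_test (φ : testSpace) :
    ‖coord 0 (testToSobolev φ)‖ ^ 2 = ∫ p, ‖(φ : ℝ × ℝ → ℂ) p‖ ^ 2 :=
  Lp_norm_sq_of_ae (coeFn_testToLp volume φ)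

/-- Both sides are continuous on `H¹`, so the estimate passes from the dense test functions. -/
theorem exists_norm_sq_mulOp_le {m A₁ A₂ : ℝ × ℝ → ℝ} (hm : IsMultiplier m)
    (h₁ : IsMultiplier A₁) (h₂ : IsMultiplier A₂) :
    ∃ C : ℝ, 0 ≤ C ∧ ∀ u, ‖mulOp hm u‖ ^ 2 ≤
      C * (‖coord 0 u‖ ^ 2 + ‖covOp h₁ 1 u‖ ^ 2 + ‖covOp h₂ 2 u‖ ^ 2) := by
  obtain ⟨C, hC, hb⟩ := hm.exists_bound_magnetic h₁ h₂
  refine ⟨C, hC, fun u => denseRange_testToSobolev.induction_on u ?_ fun φ => ?_⟩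
  · exact isClosed_le (by fun_prop) (by fun_prop)
  · rw [norm_sq_coord_zero_test, norm_sq_covOp_ex_test, norm_sq_covOp_ey_test,
      Lp_norm_sq_of_ae (coeFn_mulOp_test hm φ)]
    exact hb φ

theorem norm_sq_coord_le {m : ℝ × ℝ → ℝ} (hm : IsMultiplier m) (i : Fin 3) (u : sobolev) :
    ‖coord i u‖ ^ 2 ≤ 2 * ‖covOp hm i u‖ ^ 2 + 2 * ‖mulOp hm u‖ ^ 2 := by
  have e : Complex.I • coord i u = covOp hm i u - mulOp hm u := by simp [covOp]
  have h := norm_sub_le (covOp hm i u) (mulOp hm u)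
  rw [← e, norm_smul, Complex.norm_I, one_mul] at h
  nlinarith [norm_nonneg (coord i u), sq_nonneg (‖covOp hm i u‖ - ‖mulOp hm u‖)]

/-- The Sobolev norm is controlled by the magnetic Sobolev norm. -/
theorem exists_norm_sq_le {A₁ A₂ : ℝ × ℝ → ℝ} (h₁ : IsMultiplier A₁) (h₂ : IsMultiplier A₂) :
    ∃ C : ℝ, 0 < C ∧ ∀ u : sobolev, ‖u‖ ^ 2 ≤
      C * (‖coord 0 u‖ ^ 2 + ‖covOp h₁ 1 u‖ ^ 2 + ‖covOp h₂ 2 u‖ ^ 2) := by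
  obtain ⟨C₁, hC₁, b₁⟩ := exists_norm_sq_mulOp_le h₁ h₁ h₂
  obtain ⟨C₂, hC₂, b₂⟩ := exists_norm_sq_mulOp_le h₂ h₁ h₂
  refine ⟨2 * C₁ + 2 * C₂ + 2, by positivity, fun u => ?_⟩
  have k₁ := norm_sq_coord_le h₁ 1 u
  have k₂ := norm_sq_coord_le h₂ 2 u
  have l₁ := b₁ u
  have l₂ := b₂ u
  rw [sobolev_norm_sq]
  nlinarith [sq_nonneg ‖coord 0 u‖]

variable {A : ℝ × ℝ → ℝ × ℝ} (h₁ : IsMultiplier fun p => (A p).1)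
  (h₂ : IsMultiplier fun p => (A p).2) (γ : ℝ → ℝ) [IsFiniteMeasureOnCompacts (arcLength γ)]

/-- The operator on `H¹(ℝ²)` which represents the form `q - lam ‖·‖²`. -/
def formOp (α lam : ℝ) : sobolev →L[ℂ] sobolev :=
  (covOp h₁ 1).adjoint ∘L covOp h₁ 1 + (covOp h₂ 2).adjoint ∘L covOp h₂ 2
    - (traceOp γ).adjoint ∘L ((α : ℂ) • traceOp γ) - (coord 0).adjoint ∘L ((lam : ℂ) • coord 0)

theorem inner_formOp (α lam : ℝ) (u w : sobolev) :
    inner ℂ u (formOp h₁ h₂ γ α lam w) =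
      inner ℂ (covOp h₁ 1 u) (covOp h₁ 1 w) + inner ℂ (covOp h₂ 2 u) (covOp h₂ 2 w)
        - α * inner ℂ (traceOp γ u) (traceOp γ w) - lam * inner ℂ (coord 0 u) (coord 0 w) := by
  simp only [formOp, sub_apply, add_apply,
    smul_apply, ContinuousLinearMap.comp_apply, inner_sub_right,
    inner_add_right, inner_smul_right, ContinuousLinearMap.adjoint_inner_right]

theorem star_mul_eq_inner (z w : ℂ) : star z * w = inner ℂ z w := by
  simp [mul_comm]

theorem form_coord {W α : ℝ} (hγ : Continuous γ) (hW : ∀ᵐ x, √(1 + deriv γ x ^ 2) ≤ W)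
    (u w : sobolev) :
    form A γ α (coord 0 u) (coord 0 w) =
      inner ℂ (covOp h₁ 1 u) (covOp h₁ 1 w) + inner ℂ (covOp h₂ 2 u) (covOp h₂ 2 w)
        - α * inner ℂ (traceOp γ u) (traceOp γ w) := by
  have hx : ∀ u : sobolev, magX A (coord 0 u) =ᵐ[volume] covOp h₁ 1 u := fun u => by
    filter_upwards [coeFn_covOp h₁ 1 u] with p hp
    rw [hp, magX, weakDeriv_ex_coord]
  have hy : ∀ u : sobolev, magY A (coord 0 u) =ᵐ[volume] covOp h₂ 2 u := fun u => by
    filter_upwards [coeFn_covOp h₂ 2 u] with p hp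
    rw [hp, magY, weakDeriv_ey_coord]
  rw [form, trace_coord hγ hW, trace_coord hγ hW, L2.inner_def, L2.inner_def, L2.inner_def,
    ← integral_add (L2.integrable_inner _ _) (L2.integrable_inner _ _)]
  congr 1
  · refine integral_congr_ae ?_
    filter_upwards [hx u, hx w, hy u, hy w] with p k₁ k₂ k₃ k₄
    rw [k₁, k₂, k₃, k₄, star_mul_eq_inner, star_mul_eq_inner]
  · congr 1
    refine integral_congr_ae (ae_of_all _ fun p => ?_)
    exact star_mul_eq_inner _ _

end LeakyWire

end

noncomputable section

namespace LeakyWire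

/-! ### Coercivity and the resolvent -/

theorem sqrt_one_add_deriv_sq_le {γ : ℝ → ℝ} {r : ℝ} (hr : 0 ≤ r)
    (h : eLpNorm (deriv γ) ∞ volume ^ 2 ≤ ENNReal.ofReal r) :
    ∀ᵐ x, √(1 + deriv γ x ^ 2) ≤ √(1 + r) := by
  filter_upwards [enorm_ae_le_eLpNormEssSup (deriv γ) volume] with x hx
  refine Real.sqrt_le_sqrt ?_
  have h2 : ENNReal.ofReal (deriv γ x ^ 2) ≤ ENNReal.ofReal r := by
    refine le_trans ?_ h
    rw [← sq_abs, ENNReal.ofReal_pow (abs_nonneg _), ← Real.enorm_eq_ofReal_abs]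
    rw [← eLpNorm_exponent_top] at hx
    gcongr
  have := (ENNReal.ofReal_le_ofReal_iff hr).1 h2
  linarith

variable {A : ℝ × ℝ → ℝ × ℝ} (h₁ : IsMultiplier fun p => (A p).1)
  (h₂ : IsMultiplier fun p => (A p).2) (γ : ℝ → ℝ) [IsFiniteMeasureOnCompacts (arcLength γ)]

theorem re_inner_formOp_self (α lam : ℝ) (u : sobolev) :
    (inner ℂ u (formOp h₁ h₂ γ α lam u)).re =
      ‖covOp h₁ 1 u‖ ^ 2 + ‖covOp h₂ 2 u‖ ^ 2 - α * ‖traceOp γ u‖ ^ 2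
        - lam * ‖coord 0 u‖ ^ 2 := by
  rw [inner_formOp, inner_self_eq_norm_sq_to_K, inner_self_eq_norm_sq_to_K,
    inner_self_eq_norm_sq_to_K, inner_self_eq_norm_sq_to_K]
  simp only [Complex.coe_algebraMap, ← Complex.ofReal_pow, ← Complex.ofReal_mul,
    ← Complex.ofReal_add, ← Complex.ofReal_sub, Complex.ofReal_re]

variable {γ}

theorem norm_sq_traceOp_le (hγ : Continuous γ) {W α : ℝ}
    (hW : ∀ᵐ x, √(1 + deriv γ x ^ 2) ≤ W) (hα : 0 < α) (hW0 : 0 < W) (u : sobolev) :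
    α * ‖traceOp γ u‖ ^ 2 ≤ (α * W) ^ 2 / 2 * ‖coord 0 u‖ ^ 2 + ‖covOp h₂ 2 u‖ ^ 2 / 2 := by
  refine denseRange_testToSobolev.induction_on u ?_ fun φ => ?_
  · exact isClosed_le (by fun_prop) (by fun_prop)
  · rw [traceOp_test hγ hW, norm_sq_coord_zero_test, norm_sq_covOp_ey_test]
    -- This `κ` makes the energy coefficient `α W / (4κ)` equal to `1 / 2`.
    have hκ : 0 < α * W / 2 := by positivity
    have h := mul_le_mul_of_nonneg_left
      (norm_sq_testToLp_arcLength_le hγ hW h₂ hκ φ) hα.le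
    refine h.trans (le_of_eq ?_)
    field_simp
    ring

theorem lower_bound_of_test {α : ℝ} (hγ : Continuous γ) {W : ℝ}
    (hW : ∀ᵐ x, √(1 + deriv γ x ^ 2) ≤ W)
    (h : ∀ φ : testSpace, α * ‖testToLp (arcLength γ) φ‖ ^ 2 ≤
      (∫ p, magSq A φ p) + α ^ 2 / 4 * ∫ p, ‖(φ : ℝ × ℝ → ℂ) p‖ ^ 2) (u : sobolev) :
    α * ‖traceOp γ u‖ ^ 2 ≤ ‖covOp h₁ 1 u‖ ^ 2 + ‖covOp h₂ 2 u‖ ^ 2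
      + α ^ 2 / 4 * ‖coord 0 u‖ ^ 2 := by
  refine denseRange_testToSobolev.induction_on u ?_ fun φ => ?_
  · exact isClosed_le (by fun_prop) (by fun_prop)
  · rw [traceOp_test hγ hW, norm_sq_coord_zero_test, norm_sq_covOp_ey_test, norm_sq_covOp_ex_test,
      ← integral_add (h₁.integrable_covD_sq ex φ) (h₂.integrable_covD_sq ey φ)]
    exact h φ

/-- The lower bound for the form leaves a gap `d` that controls the mass. As the trace uses at most
half of the magnetic energy plus mass, the energy is controlled too, and the magnetic norm dominates
the Sobolev norm. -/
theorem exists_coercive {α lam W : ℝ} (hγ : Continuous γ)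
    (hW : ∀ᵐ x, √(1 + deriv γ x ^ 2) ≤ W) (hα : 0 < α) (hW0 : 0 < W)
    (h : ∀ φ : testSpace, α * ‖testToLp (arcLength γ) φ‖ ^ 2 ≤
      (∫ p, magSq A φ p) + α ^ 2 / 4 * ∫ p, ‖(φ : ℝ × ℝ → ℂ) p‖ ^ 2)
    (hlam : lam < -(α ^ 2 / 4)) :
    ∃ c : ℝ, 0 < c ∧ ∀ u : sobolev, c * ‖u‖ ^ 2 ≤ (inner ℂ u (formOp h₁ h₂ γ α lam u)).re := by
  obtain ⟨C, hC, hb⟩ := exists_norm_sq_le h₁ h₂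
  set d := -(α ^ 2 / 4) - lam with hd
  have hd0 : 0 < d := by linarith
  set L := (α * W) ^ 2 / 2 with hL
  have hL0 : 0 ≤ L := by positivity
  set k := C * (2 + 2 * L / d + 1 / d) with hk
  have hk0 : 0 < k := by positivity
  refine ⟨k⁻¹, by positivity, fun u => ?_⟩
  rw [inv_mul_le_iff₀ hk0, re_inner_formOp_self]
  have b₁ := lower_bound_of_test h₁ h₂ hγ hW h u
  have b₂ := norm_sq_traceOp_le h₂ hγ hW hα hW0 u
  refine (hb u).trans ?_
  have n₀ := sq_nonneg ‖coord 0 u‖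
  have n₁ := sq_nonneg ‖covOp h₁ 1 u‖
  have n₂ := sq_nonneg ‖covOp h₂ 2 u‖
  have hlam0 : lam < 0 := by nlinarith [sq_nonneg α]
  generalize ‖coord 0 u‖ ^ 2 = N at *
  generalize ‖covOp h₁ 1 u‖ ^ 2 = E₁ at *
  generalize ‖covOp h₂ 2 u‖ ^ 2 = E₂ at *
  generalize α * ‖traceOp γ u‖ ^ 2 = τ at *
  set q := E₁ + E₂ - τ - lam * N with hq
  have q₁ : d * N ≤ q := by rw [hd, hq]; nlinarith
  have q₂ : E₁ + E₂ ≤ 2 * q + 2 * L * N := by nlinarith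
  have hN : N ≤ q / d := by rw [le_div_iff₀ hd0]; linarith
  rw [hk, mul_assoc]
  refine mul_le_mul_of_nonneg_left ?_ hC.le
  have hLN : 2 * L * N ≤ 2 * L * (q / d) := by gcongr
  have e : (2 + 2 * L / d + 1 / d) * q = 2 * q + 2 * L * (q / d) + q / d := by ring
  rw [e]
  linarith

/-- The equation `(H - lam) w = g` says that `formOp` maps `w` to the adjoint of the embedding
`coord 0` applied to `g`. So the resolvent is the embedding, the inverse of `formOp` and the adjoint
embedding, composed. -/
theorem mem_resolventSet_of_isUnit {α lam W : ℝ} (hγ : Continuous γ)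
    (hW : ∀ᵐ x, √(1 + deriv γ x ^ 2) ≤ W) (hu : IsUnit (formOp h₁ h₂ γ α lam)) :
    (lam : ℂ) ∈ resolventSet (hamiltonian A γ α) := by
  obtain ⟨S, hS⟩ := hu
  have hSi : ∀ x, formOp h₁ h₂ γ α lam ((↑S⁻¹ : sobolev →L[ℂ] sobolev) x) = x := fun x => by
    rw [← hS, ← mul_apply_eq_comp, S.mul_inv, one_apply_eq_self]
  have hiS : ∀ x, (↑S⁻¹ : sobolev →L[ℂ] sobolev) (formOp h₁ h₂ γ α lam x) = x := fun x => by
    rw [← hS, ← mul_apply_eq_comp, S.inv_mul, one_apply_eq_self]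
  have key : ∀ (w : sobolev) (g : L2), (∀ φ ∈ H1, form A γ α φ (coord 0 w) =
      inner ℂ φ (g + (lam : ℂ) • coord 0 w)) ↔
      formOp h₁ h₂ γ α lam w = (coord 0).adjoint g := by
    intro w g
    have hform : ∀ u : sobolev, form A γ α (coord 0 u) (coord 0 w) =
        inner ℂ u (formOp h₁ h₂ γ α lam w) + lam * inner ℂ (coord 0 u) (coord 0 w) := fun u => by
      rw [form_coord h₁ h₂ γ hγ hW, inner_formOp]
      ring
    constructor
    · intro h
      refine ext_inner_left ℂ fun u => ?_
      have := h _ (coord_mem_H1 u)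
      rw [hform, inner_add_right, inner_smul_right] at this
      rw [ContinuousLinearMap.adjoint_inner_right]
      linear_combination this
    · intro h φ hφ
      obtain ⟨u, rfl⟩ := exists_coord_eq hφ
      rw [hform, h, ContinuousLinearMap.adjoint_inner_right, inner_add_right, inner_smul_right]
  refine ⟨coord 0 ∘L (↑S⁻¹ : sobolev →L[ℂ] sobolev) ∘L (coord 0).adjoint, fun ψ g => ?_⟩
  constructor
  · rintro ⟨hψ, h⟩
    obtain ⟨w, rfl⟩ := exists_coord_eq hψ
    have := (key w g).1 h
    simp only [ContinuousLinearMap.comp_apply]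
    rw [← this, hiS]
  · rintro rfl
    exact ⟨coord_mem_H1 _, (key _ g).2 (hSi _)⟩

/-- Lax–Milgram for the operator that represents the shifted form. -/
theorem isUnit_formOp {α lam c : ℝ} (hc : 0 < c)
    (h : ∀ u : sobolev, c * ‖u‖ ^ 2 ≤ (inner ℂ u (formOp h₁ h₂ γ α lam u)).re) :
    IsUnit (formOp h₁ h₂ γ α lam) := by
  refine ContinuousLinearMap.isUnit_of_forall_le_norm_inner_map _ (c := ⟨c, hc.le⟩) hc fun u => ?_
  rw [← norm_inner_symm]
  refine le_trans ?_ ((h u).trans (Complex.re_le_norm _))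
  exact le_of_eq (mul_comm _ _)

end LeakyWire

end

/-! ### The choice of the constant and the conclusion -/

theorem theorem2 (a : ℝ) (ha : 0 < a) (B : ℝ × ℝ → ℝ)
    (hB : LocallyIntegrable B volume) (hBsupp : tsupport B ⊆ LeakyWire.square a)
    (hB0 : ¬ B =ᵐ[volume] 0) :
    ∃ α₀ : ℝ, 0 < α₀ ∧
      ∀ A : ℝ × ℝ → ℝ × ℝ, LeakyWire.IsVectorPotential B A →
      ∀ γ : ℝ → ℝ, LeakyWire.IsDeformedLine a γ →
      ∀ α : ℝ, 0 < α → α ≤ α₀ →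
        eLpNorm (deriv γ) ∞ volume ^ 2 ≤ ENNReal.ofReal (2 * α₀ ^ 2 / α ^ 2 - 1) →
        ∀ lam : ℝ, lam < -(α ^ 2 / 4) →
          (lam : ℂ) ∉ LeakyWire.spectrum (LeakyWire.hamiltonian A γ α) := by
  obtain ⟨K, hK, hardy⟩ := LeakyWire.exists_hardy ha hB hBsupp hB0
  set D := ((2 * a)⁻¹ + 1) * K + 1 with hD
  have hD0 : 0 < D := by positivity
  -- `D` bounds the restriction to the curve in the square by the energy there. The value of `α₀` is
  -- dictated by `α W D = 1` with `W = √2 α₀ / α`.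
  obtain ⟨α₀, hα₀⟩ : ∃ x, x = 1 / (√2 * D) := ⟨_, rfl⟩
  have hα₀_pos : 0 < α₀ := by rw [hα₀]; positivity
  refine ⟨α₀, hα₀_pos, fun A hA γ hγ α hα hle hγ' lam hlam => ?_⟩
  have hγc : Continuous γ := hγ.piecewiseC1.1
  have hr : 0 ≤ 2 * α₀ ^ 2 / α ^ 2 - 1 := by
    have : 1 ≤ α₀ ^ 2 / α ^ 2 := by
      rw [one_le_div (by positivity)]
      exact pow_le_pow_left₀ hα.le hle 2
    rw [mul_div_assoc]
    linarith
  have hW := LeakyWire.sqrt_one_add_deriv_sq_le hr hγ'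
  -- The slope condition says exactly that the arc length density is at most `√2 α₀ / α`, so `α`
  -- times this bound does not depend on `α`.
  have hWval : √(1 + (2 * α₀ ^ 2 / α ^ 2 - 1)) = √2 * α₀ / α := by
    rw [show 1 + (2 * α₀ ^ 2 / α ^ 2 - 1) = 2 * (α₀ / α) ^ 2 by rw [div_pow]; ring,
      Real.sqrt_mul (by norm_num), Real.sqrt_sq (by positivity), mul_div_assoc]
  rw [hWval] at hW
  have : IsFiniteMeasureOnCompacts (LeakyWire.arcLength γ) :=
    LeakyWire.isFiniteMeasureOnCompacts_arcLength hγc hW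
  have hsmall : α * (√2 * α₀ / α) * D ≤ 1 := by
    rw [hα₀]
    exact le_of_eq (by field_simp)
  obtain ⟨c, hc, hcoer⟩ := LeakyWire.exists_coercive hA.isMultiplier_fst hA.isMultiplier_snd hγc hW
    hα (by positivity)
    (fun φ => LeakyWire.arc_le_magSq ha hA hγ hα.le hW φ (hardy A hA φ) hsmall) hlam
  exact not_not_intro (LeakyWire.mem_resolventSet_of_isUnit hA.isMultiplier_fst
    hA.isMultiplier_snd hγc hW
    (LeakyWire.isUnit_formOp hA.isMultiplier_fst hA.isMultiplier_snd hc hcoer))
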